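/- \textbf{Setting.} Fix $n,d$, a matrix $X_0\in\mathbb R^{n\times d}$, nonrandom vectors $a_{01},a_{02},\ldots\in\mathbb R^n$ and random vectors $\tilde c_1,\tilde c_2,\ldots\in\mathbb R^{n+d}$. For each $m$ let $A_0$ be the $m\times n$ matrix with rows $a_{0i}^\top$ and $\tilde C$ the $m\times(n+d)$ matrix with rows $\tilde c_i^\top$ ($i\le m$); one observes $C=[A,B]=[A_0,A_0X_0]+\tilde C$. For $X\in\mathbb R^{n\times d}$ put $Z=Z(X)=\begin{bmatrix}X\\-\mathrm I_d\end{bmatrix}$, and for $J\subset\{1,\dots,n+d\}$ let $Z_J$ be the submatrix of the rows of $Z$ with index in $J$. Assume: (i) the $\tilde c_i$ are independent with zero mean and finite second moments; (ii) for a fixed $J$, $\mathsf E\tilde c_{ij}^2=0$ for all $j\notin J$ and all $i$, and $\operatorname{cov}(\tilde c_{ij},\,j\in J)=\sigma^2\Sigma_i$ for all $i$, with $\sigma^2>0$ and known matrices $\Sigma_i$; (iii) there is $\varkappa>0$ with $\lambda_{\min}(\Sigma_i)\ge\varkappa^2$ for all $i$; (iv) $\operatorname{rank}(Z(X_0)_J)=d$;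 (v) there is $r\ge2$ with $r>d\left(|J|-\frac{d+1}{2}\right)$ and $\sup_{i\ge1,\,j\in J}\mathsf E|\tilde c_{ij}|^{2r}<\infty$; (viii) for some $\delta>0$, $\sup_{i\ge1,\,j\in J}\mathsf E|\tilde c_{ij}|^{4+2\delta}<\infty$; (ix) for this $\delta$, $m^{-(1+\delta/2)}\sum_{i=1}^m\|a_{0i}\|^{2+\delta}\to0$ as $m\to\infty$; (x) $\frac1mA_0^\top A_0\to V_A$ as $m\to\infty$, with $V_A$ nonsingular; (xi) $\Sigma_i\to\Sigma_\infty$ as $i\to\infty$, for some matrix $\Sigma_\infty$; (xii) $\mathsf E\,\tilde c_{ip}\tilde c_{iq}\tilde c_{is}=0$ for all $i$ and all $p,q,s\in J$ (not necessarily distinct); (xiii) for all $p,q,s,u\in J$ (not necessarily distinct), $\frac1m\sum_{i=1}^m\mathsf E\,\tilde c_{ip}\tilde c_{iq}\tilde c_{is}\tilde c_{iu}$ converges to a finite limit as $m\to\infty$. \textbf{Estimator.} For each $m$ let $\hat X=\hat X_m$ be an EW-TLS estimator: a Borel measurable map of the data matrix $C$ into $\mathbb R^{n\times d}\cup\{\infty\}$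 whose value is the $X$-component of a solution $(X,\Delta A,\Delta B)$ of $$\min_{X,\Delta A,\Delta B}\ \sum_{i=1}^m\bigl\|\Sigma_i^{-1/2}(\Delta c_{ij})_{j\in J}\bigr\|^2$$ subject to $(A-\Delta A)X=B-\Delta B$, $\ \Delta c_{ij}=0$ for all $i$ and all $j\notin J$, $\ \operatorname{rank}(Z_J)=d$, where $[\Delta A,\Delta B]=(\Delta c_{ij})$, if a solution exists, and is $\infty$ otherwise. \textbf{Theorem 7.} Put $S_i=\sigma^{-2}\operatorname{cov}(\tilde c_i)$. Then the limit $S_\infty=\begin{bmatrix}S_a^\infty&S_{ab}^\infty\\S_{ba}^\infty&S_b^\infty\end{bmatrix}=\lim_{i\to\infty}S_i$ exists (with $S_a^\infty\in\mathbb R^{n\times n}$), and $$\frac1{\sqrt m}\sum_{i=1}^m\bigl(a_{0i}\tilde c_i^\top,\ \tilde c_i\tilde c_i^\top-\sigma^2S_i\bigr)$$ converges in distribution, as $m\to\infty$, to a centered Gaussian pair $(\Gamma_1,\Gamma_2)$ of random matrices with $\Gamma_1$ and $\Gamma_2$ independent. Moreover, $\hat X$ is finite with probability tending to one, and $$\sqrt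 m(\hat X-X_0)\ \longrightarrow\ X_\infty:=V_A^{-1}\Gamma(X_0)\quad\text{in distribution as }m\to\infty$$ (whatever finite value $\hat X$ is given where it equals $\infty$), where $$\Gamma(X)=\Gamma_1Z+P_a\Gamma_2Z-[S_a^\infty,S_{ab}^\infty]\,Z\,(Z^\top S_\infty Z)^{-1}(Z^\top\Gamma_2Z),\qquad P_a=[\mathrm I_n,0].$$ Finally, for every nonzero $u\in\mathbb R^d$ the covariance matrix $\operatorname{cov}(X_\infty u)$ is nonsingular. -/

import Mathlib

open MeasureTheory ProbabilityTheory Filter Topology Matrix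

noncomputable section

namespace EWTLS

/-- Real matrices carry the product (entrywise) σ-algebra; for finite index types it is the Borel
σ-algebra of the entrywise topology. -/
instance instMeasurableSpaceMatrix {ι κ : Type*} : MeasurableSpace (Matrix ι κ ℝ) :=
  inferInstanceAs (MeasurableSpace (ι → κ → ℝ))

instance instSecondCountableMatrix {ι κ : Type*} [Countable ι] [Countable κ] :
    SecondCountableTopology (Matrix ι κ ℝ) :=
  inferInstanceAs (SecondCountableTopology (ι → κ → ℝ))

instance instBorelSpaceMatrix {ι κ : Type*} [Countable ι] [Countable κ] :
    BorelSpace (Matrix ι κ ℝ) :=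
  inferInstanceAs (BorelSpace (ι → κ → ℝ))

/-- The columns of `[A, B]`: the `n` columns of `A` followed by the `d` columns of `B`. -/
abbrev Col (n d : ℕ) : Type := Fin n ⊕ Fin d

/-- `Z = [X; -I_d]`. -/
def Z {n d : ℕ} (X : Matrix (Fin n) (Fin d) ℝ) : Matrix (Col n d) (Fin d) ℝ :=
  Matrix.fromRows X (-1)

/-- `Z_J`, the submatrix of the rows of `Z` with index in `J`. -/
def rowsIn {n d : ℕ} (J : Finset (Col n d)) (M : Matrix (Col n d) (Fin d) ℝ) :
    Matrix J (Fin d) ℝ :=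
  M.submatrix Subtype.val id

/-- The true input matrix `A₀` with rows `a₀₁ᵀ, …, a₀ₘᵀ`. -/
def trueInput {n : ℕ} (a₀ : ℕ → Fin n → ℝ) (m : ℕ) : Matrix (Fin m) (Fin n) ℝ :=
  Matrix.of fun i => a₀ i

/-- The observed matrix `C = [A, B] = [A₀, A₀ X₀] + C̃` of the first `m` rows, for the errors
`err i ω = c̃ᵢ(ω)`. -/
def data {n d : ℕ} {Ω : Type*} (X₀ : Matrix (Fin n) (Fin d) ℝ) (a₀ : ℕ → Fin n → ℝ)
    (err : ℕ → Ω → Col n d → ℝ) (m : ℕ) (ω : Ω) : Matrix (Fin m) (Col n d) ℝ :=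
  Matrix.fromCols (trueInput a₀ m) (trueInput a₀ m * X₀) + Matrix.of fun (i : Fin m) => err i ω

/-- The constraints of the weighted least squares problem on `X` and the corrections
`ΔC = [ΔA, ΔB]`: `(A - ΔA) X = B - ΔB`, no correction outside the columns in `J`, and
`rank Z_J = d`. -/
structure Feasible {n d m : ℕ} (J : Finset (Col n d)) (C : Matrix (Fin m) (Col n d) ℝ)
    (X : Matrix (Fin n) (Fin d) ℝ) (ΔC : Matrix (Fin m) (Col n d) ℝ) : Prop where
  eqn : (C - ΔC).toCols₁ * X = (C - ΔC).toCols₂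
  errorFree : ∀ i, ∀ j ∉ J, ΔC i j = 0
  rank_eq : (rowsIn J (Z X)).rank = d

open scoped MatrixOrder in
/-- The weighted sum of squared corrections `∑ᵢ ‖Σᵢ^(-1/2) Δcᵢᴶ‖²`, Euclidean norm. -/
def cost {n d m : ℕ} {J : Finset (Col n d)} (Sig : ℕ → Matrix J J ℝ)
    (ΔC : Matrix (Fin m) (Col n d) ℝ) : ℝ :=
  ∑ i : Fin m, ‖WithLp.toLp 2 ((CFC.sqrt (Sig i))⁻¹ *ᵥ fun j : J => ΔC i j)‖ ^ 2

/-- `X` solves the weighted least squares problem for the data matrix `C`: together with suitable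
corrections it attains the minimum of the cost under the constraints. -/
def Solves {n d m : ℕ} {J : Finset (Col n d)} (Sig : ℕ → Matrix J J ℝ)
    (C : Matrix (Fin m) (Col n d) ℝ) (X : Matrix (Fin n) (Fin d) ℝ) : Prop :=
  ∃ ΔC, Feasible J C X ΔC ∧ ∀ X' ΔC', Feasible J C X' ΔC' → cost Sig ΔC ≤ cost Sig ΔC'

/-- An element-wise weighted total least squares estimator from `m` rows: a Borel measurable map of
the data matrix into `ℝ^{n×d} ∪ {∞}` that selects a solution of the problem whenever there is one,
and is `∞` otherwise. -/
structure IsEstimator {n d m : ℕ} {J : Finset (Col n d)} (Sig : ℕ → Matrix J J ℝ)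
    (T : Matrix (Fin m) (Col n d) ℝ → OnePoint (Matrix (Fin n) (Fin d) ℝ)) : Prop where
  borel_measurable : @Measurable _ _ _ (borel _) T
  solves : ∀ C, (∃ X, Solves Sig C X) → ∃ X : Matrix (Fin n) (Fin d) ℝ, T C = ↑X ∧ Solves Sig C X
  infty : ∀ C, (¬ ∃ X, Solves Sig C X) → T C = OnePoint.infty

/-- The covariance matrix of a random vector `ξ`. -/
def covMat {ι Ω : Type*} [MeasurableSpace Ω] (P : Measure Ω) (ξ : Ω → ι → ℝ) : Matrix ι ι ℝ :=
  Matrix.of fun p q => cov[fun ω => ξ ω p, fun ω => ξ ω q; P]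

/-- `Sᵢ = σ⁻² cov(c̃ᵢ)`. -/
def S {n d : ℕ} {Ω : Type*} [MeasurableSpace Ω] (P : Measure Ω) (err : ℕ → Ω → Col n d → ℝ)
    (σ : ℝ) (i : ℕ) : Matrix (Col n d) (Col n d) ℝ :=
  (1 / σ ^ 2) • covMat P (err i)

/-- `Wᵢ = (a₀ᵢ c̃ᵢᵀ, c̃ᵢ c̃ᵢᵀ - σ² Sᵢ)`. -/
def W {n d : ℕ} {Ω : Type*} [MeasurableSpace Ω] (P : Measure Ω) (a₀ : ℕ → Fin n → ℝ)
    (err : ℕ → Ω → Col n d → ℝ) (σ : ℝ) (i : ℕ) (ω : Ω) :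
    Matrix (Fin n) (Col n d) ℝ × Matrix (Col n d) (Col n d) ℝ :=
  (vecMulVec (a₀ i) (err i ω), vecMulVec (err i ω) (err i ω) - σ ^ 2 • S P err σ i)

/-- The matrix `P_a = [I_n, 0]` of the projector `[a; b] ↦ a`. -/
def Pa (n d : ℕ) : Matrix (Fin n) (Col n d) ℝ := Matrix.fromCols 1 0

/-- `Γ(X) = Γ₁ Z + P_a Γ₂ Z - [S_a, S_ab] Z (Zᵀ S Z)⁻¹ (Zᵀ Γ₂ Z)` for `S = [S_a, S_ab; S_ba, S_b]`
and `g = (Γ₁, Γ₂)`. -/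
def Gam {n d : ℕ} (S : Matrix (Col n d) (Col n d) ℝ)
    (g : Matrix (Fin n) (Col n d) ℝ × Matrix (Col n d) (Col n d) ℝ)
    (X : Matrix (Fin n) (Fin d) ℝ) : Matrix (Fin n) (Fin d) ℝ :=
  g.1 * Z X + Pa n d * g.2 * Z X
    - Matrix.fromCols S.toBlocks₁₁ S.toBlocks₁₂ * Z X * ((Z X)ᵀ * S * Z X)⁻¹ * ((Z X)ᵀ * g.2 * Z X)

/-- The value of an estimator as a matrix, the zero matrix where it is `∞`. -/
def finitePart {n d : ℕ} (x : OnePoint (Matrix (Fin n) (Fin d) ℝ)) : Matrix (Fin n) (Fin d) ℝ :=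
  x.elim 0 id

end EWTLS

end

/-!
The corrections can be eliminated: for fixed `X` with `rank Z_J = d`, the cheapest corrections of
the row `cᵢ` cost `cᵢᵀ Z (Zᵀ Sᵢ Z)⁻¹ Zᵀ cᵢ` with `Sᵢ` the extension of `Σᵢ` by zero, so the
estimator minimises the sum of these terms, the reduced objective (`EWTLS.solves_iff`).

*Consistency.* The averages of `cᵢ cᵢᵀ` tend in probability to
`K = [I, X₀]ᵀ V [I, X₀] + σ² S_∞`, which is positive definite. By comparison of quadratic forms,
uniformly in `X`, the averaged objective is, up to a factor close to one, at least
`trace ((Zᵀ S_∞ Z)⁻¹ Zᵀ K Z) = σ² d + trace ((Zᵀ S_∞ Z)⁻¹ (X - X₀)ᵀ V (X - X₀))`,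
whereas its value at `X₀` tends to `σ² d`. Since the last trace is small only near `X₀`, every `X`
that does at least as well as `X₀` is close to it (`EWTLS.RowLLN.eventually_abs_sub_le`), and
compactness yields a minimiser (`EWTLS.RowLLN.eventually_exists_minimiser`). Convergence in
probability suffices here; it is handled as convergence along the filter `EWTLS.inProb`.

*Linearization.* At a minimiser the score, half the gradient of the objective, vanishes
(`EWTLS.sum_score_eq_zero`). The score of `Sᵢ` itself is zero, so at `X₀` the score of a row is
linear in `(a₀ᵢ c̃ᵢᵀ, c̃ᵢ c̃ᵢᵀ - σ² Sᵢ)`, and by the definition of `Γ` the normalized score is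
`Γ(X₀) (Z₀ᵀ S_∞ Z₀)⁻¹` evaluated at the normalized sums of these pairs, up to a term tending to
zero (`EWTLS.ErrorModel.tendsto_score_truth`). The averaged increment of the score is
`V (X̂ - X₀) (Z₀ᵀ S_∞ Z₀)⁻¹` to first order. Hence `√m (X̂ - X₀)` differs from `-V⁻¹ Γ(X₀)` at the
normalized sums by a term tending to zero in probability (`EWTLS.ErrorModel.tendsto_linearization`).

*Limit law.* The normalized sums satisfy a central limit theorem under Lyapunov's condition, proved
by characteristic functions (`EWTLS.tendstoInDistribution_of_lyapunov`). The covariances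
between the two components are third moments of the errors and vanish, so the components are
independent in the limit, and the sign in `-V⁻¹ Γ(X₀)` disappears because a centred
Gaussian law is symmetric. The covariance of `X_∞ u` is the sum of
`σ² (uᵀ Z₀ᵀ S_∞ Z₀ u) V⁻¹`, which comes from `Γ₁`, and of a positive semidefinite matrix, which comes from `Γ₂` (`EWTLS.isUnit_covMat_limit`).
-/

namespace EWTLS

/-! ### A central limit theorem under Lyapunov's condition -/

/-- Quadratic Taylor bound for `e^{ix}` in the form that a Lyapunov condition of order `2 + δ` can
use: the cubic bound is applied for `|x| ≤ ε` and the quadratic one beyond. -/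
lemma norm_exp_mul_I_sub_taylor_le {δ ε : ℝ} (hδ : 0 < δ) (hε : 0 < ε) (hε1 : ε ≤ 1) (x : ℝ) :
    ‖Complex.exp (x * Complex.I) - (1 + x * Complex.I - (x : ℂ) ^ 2 / 2)‖ ≤
      4 * ε * x ^ 2 + 4 * ε ^ (-δ) * |x| ^ (2 + δ) := by
  have hx2 : |x| ^ 2 = x ^ 2 := sq_abs x
  have hn : ‖(x : ℂ) * Complex.I‖ = |x| := by simp
  rcases le_or_gt |x| ε with h | h
  · have h1 : ‖(x : ℂ) * Complex.I‖ ≤ 1 := by rw [hn]; linarith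
    have key := Complex.exp_bound h1 (n := 3) (by norm_num)
    have e : ∑ m ∈ Finset.range 3, ((x : ℂ) * Complex.I) ^ m / (m.factorial : ℂ) =
        1 + x * Complex.I - (x : ℂ) ^ 2 / 2 := by
      simp [Finset.sum_range_succ, Nat.factorial, mul_pow]
      ring
    rw [e, hn] at key
    norm_num [Nat.factorial] at key
    have h0 : 0 ≤ 4 * ε ^ (-δ) * |x| ^ (2 + δ) := by positivity
    have h3 : |x| ^ 3 ≤ ε * x ^ 2 := by
      rw [← hx2, pow_succ, mul_comm]
      gcongr
    nlinarith [sq_nonneg x, mul_nonneg hε.le (sq_nonneg x)]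
  · have hxpos : 0 < |x| := hε.trans h
    have h3 : ε ^ δ * x ^ 2 ≤ |x| ^ (2 + δ) := by
      rw [Real.rpow_add hxpos, mul_comm, Real.rpow_two, hx2]
      gcongr
    have h4 : x ^ 2 ≤ ε ^ (-δ) * |x| ^ (2 + δ) := by
      have := mul_le_mul_of_nonneg_left h3 (Real.rpow_nonneg hε.le (-δ))
      rwa [← mul_assoc, ← Real.rpow_add hε, neg_add_cancel, Real.rpow_zero, one_mul] at this
    have h0 : 0 ≤ 4 * ε * x ^ 2 := by positivity
    rcases le_or_gt |x| 1 with h1' | h1'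
    · have h1 : ‖(x : ℂ) * Complex.I‖ ≤ 1 := by rw [hn]; linarith
      have key := Complex.norm_exp_sub_one_sub_id_le h1
      rw [hn, hx2] at key
      have : ‖Complex.exp (x * Complex.I) - (1 + x * Complex.I - (x : ℂ) ^ 2 / 2)‖ ≤
          ‖Complex.exp (x * Complex.I) - 1 - x * Complex.I‖ + ‖(x : ℂ) ^ 2 / 2‖ := by
        refine le_trans (le_of_eq ?_) (norm_add_le _ _)
        congr 1; ring
      have e2 : ‖(x : ℂ) ^ 2 / 2‖ = x ^ 2 / 2 := by simp
      rw [e2] at this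
      nlinarith [sq_nonneg x]
    · have : ‖Complex.exp (x * Complex.I) - (1 + x * Complex.I - (x : ℂ) ^ 2 / 2)‖ ≤
          1 + (1 + |x| + x ^ 2 / 2) := by
        refine (norm_sub_le _ _).trans ?_
        gcongr
        · rw [Complex.norm_exp_ofReal_mul_I]
        · refine (norm_sub_le _ _).trans ?_
          gcongr
          · refine (norm_add_le _ _).trans ?_
            simp
          · simp
      nlinarith [sq_nonneg x]

lemma norm_prod_sub_prod_le {ι : Type*} (s : Finset ι) (f g : ι → ℂ) (hf : ∀ i ∈ s, ‖f i‖ ≤ 1)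
    (hg : ∀ i ∈ s, ‖g i‖ ≤ 1) :
    ‖∏ i ∈ s, f i - ∏ i ∈ s, g i‖ ≤ ∑ i ∈ s, ‖f i - g i‖ := by
  classical
  induction s using Finset.induction_on with
  | empty => simp
  | insert a s ha ih =>
    rw [Finset.prod_insert ha, Finset.prod_insert ha, Finset.sum_insert ha]
    have h1 : ‖∏ i ∈ s, f i‖ ≤ 1 := by
      rw [norm_prod]
      exact Finset.prod_le_one (fun _ _ => norm_nonneg _)
        (fun i hi => hf i (Finset.mem_insert_of_mem hi))
    have e : f a * ∏ i ∈ s, f i - g a * ∏ i ∈ s, g i =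
        (f a - g a) * ∏ i ∈ s, f i + g a * (∏ i ∈ s, f i - ∏ i ∈ s, g i) := by ring
    rw [e]
    refine (norm_add_le _ _).trans (add_le_add ?_ ?_)
    · rw [norm_mul]
      exact mul_le_of_le_one_right (norm_nonneg _) h1
    · rw [norm_mul]
      refine (mul_le_of_le_one_left (norm_nonneg _) (hg a (Finset.mem_insert_self _ _))).trans ?_
      exact ih (fun i hi => hf i (Finset.mem_insert_of_mem hi))
        (fun i hi => hg i (Finset.mem_insert_of_mem hi))

lemma abs_exp_neg_sub_le {a : ℝ} (ha : 0 ≤ a) : |Real.exp (-a) - (1 - a)| ≤ a ^ 2 := by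
  have h1 := Real.add_one_le_exp (-a)
  have h2 := Real.add_one_le_exp a
  have h3 : Real.exp (-a) * Real.exp a = 1 := by rw [← Real.exp_add]; simp
  rw [abs_le]
  constructor
  · nlinarith [sq_nonneg a]
  · have : Real.exp (-a) ≤ 1 / (1 + a) := by
      rw [le_div_iff₀ (by linarith)]
      nlinarith [Real.exp_pos (-a)]
    have h4 : 1 / (1 + a) ≤ 1 - a + a ^ 2 := by
      rw [div_le_iff₀ (by linarith)]
      nlinarith [pow_nonneg ha 3]
    linarith

section
variable {Ω : Type*} [MeasurableSpace Ω] {P : Measure Ω} [IsProbabilityMeasure P]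

/-- The characteristic function of one summand, up to an error controlled by the second and the
`(2 + δ)`-th absolute moments. -/
lemma norm_charFun_sub_le {X : Ω → ℝ} (hm : Measurable X) (h0 : ∫ ω, X ω ∂P = 0)
    (h2 : Integrable (fun ω => X ω ^ 2) P) {δ : ℝ} (hδ : 0 < δ)
    (hL : Integrable (fun ω => |X ω| ^ (2 + δ)) P) {ε : ℝ} (hε : 0 < ε) (hε1 : ε ≤ 1) (t : ℝ) :
    ‖charFun (P.map X) t - ((1 - t ^ 2 * (∫ ω, X ω ^ 2 ∂P) / 2 : ℝ) : ℂ)‖ ≤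
      4 * ε * (t ^ 2 * ∫ ω, X ω ^ 2 ∂P) +
        4 * ε ^ (-δ) * (|t| ^ (2 + δ) * ∫ ω, |X ω| ^ (2 + δ) ∂P) := by
  have hX : Integrable X P := by
    have : MemLp X 2 P := (memLp_two_iff_integrable_sq hm.aestronglyMeasurable).2 h2
    exact this.integrable (by norm_num)
  have e1 : charFun (P.map X) t = ∫ ω, Complex.exp ((t * X ω : ℝ) * Complex.I) ∂P := by
    rw [charFun_apply_real, integral_map hm.aemeasurable (by fun_prop)]
    simp
  have hi1 : Integrable (fun ω => Complex.exp ((t * X ω : ℝ) * Complex.I)) P := by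
    refine Integrable.of_bound (by fun_prop) 1 (ae_of_all _ fun ω => ?_)
    rw [Complex.norm_exp_ofReal_mul_I]
  have hiX : Integrable (fun ω => ((t * X ω : ℝ) : ℂ) * Complex.I) P :=
    ((hX.const_mul t).ofReal).mul_const _
  have hiX2 : Integrable (fun ω => (((t * X ω : ℝ) : ℂ)) ^ 2 / 2) P := by
    have := ((h2.const_mul (t ^ 2)).ofReal (𝕜 := ℂ)).div_const 2
    refine this.congr (ae_of_all _ fun ω => ?_)
    simp [mul_pow]
  have hi2 : Integrable (fun ω => (1 : ℂ) + ((t * X ω : ℝ) : ℂ) * Complex.I -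
      (((t * X ω : ℝ) : ℂ)) ^ 2 / 2) P := ((integrable_const _).add hiX).sub hiX2
  have e2 : ((1 - t ^ 2 * (∫ ω, X ω ^ 2 ∂P) / 2 : ℝ) : ℂ) =
      ∫ ω, ((1 : ℂ) + ((t * X ω : ℝ) : ℂ) * Complex.I - (((t * X ω : ℝ) : ℂ)) ^ 2 / 2) ∂P := by
    have hi3 : Integrable (fun ω => (1 : ℂ) + ((t * X ω : ℝ) : ℂ) * Complex.I) P :=
      (integrable_const _).add hiX
    rw [integral_sub hi3 hiX2, integral_add (integrable_const _) hiX]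
    have a1 : ∫ ω, ((t * X ω : ℝ) : ℂ) * Complex.I ∂P = 0 := by
      rw [integral_mul_const, integral_complex_ofReal, integral_const_mul, h0]
      simp
    have a2 : ∫ ω, (((t * X ω : ℝ) : ℂ)) ^ 2 / 2 ∂P =
        ((t ^ 2 * (∫ ω, X ω ^ 2 ∂P) / 2 : ℝ) : ℂ) := by
      rw [← integral_const_mul, ← integral_div, ← integral_complex_ofReal]
      congr 1; ext ω; push_cast; ring
    rw [a1, a2]
    simp
  rw [e1, e2, ← integral_sub hi1 hi2]
  have hb : Integrable (fun ω => 4 * ε * (t ^ 2 * X ω ^ 2) +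
      4 * ε ^ (-δ) * (|t| ^ (2 + δ) * |X ω| ^ (2 + δ))) P :=
    ((h2.const_mul _).const_mul _).add ((hL.const_mul _).const_mul _)
  refine (norm_integral_le_of_norm_le hb (ae_of_all _ fun ω => ?_)).trans (le_of_eq ?_)
  · have := norm_exp_mul_I_sub_taylor_le hδ hε hε1 (t * X ω)
    rwa [abs_mul, Real.mul_rpow (abs_nonneg _) (abs_nonneg _), mul_pow] at this
  · rw [integral_add ((h2.const_mul _).const_mul _) ((hL.const_mul _).const_mul _)]
    simp only [integral_const_mul]

/-- A single variance is negligible against `m` under Lyapunov's condition. -/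
lemma integral_sq_le_of_lyapunov {X : Ω → ℝ} (h2 : Integrable (fun ω => X ω ^ 2) P) {δ : ℝ}
    (hδ : 0 < δ) (hL : Integrable (fun ω => |X ω| ^ (2 + δ)) P) {c : ℝ} (hc : 0 < c) :
    ∫ ω, X ω ^ 2 ∂P ≤ c + c ^ (-(δ / 2)) * ∫ ω, |X ω| ^ (2 + δ) ∂P := by
  rw [← integral_const_mul]
  have : ∫ ω, X ω ^ 2 ∂P ≤ ∫ ω, (c + c ^ (-(δ / 2)) * |X ω| ^ (2 + δ)) ∂P := by
    refine integral_mono h2 ((integrable_const _).add (hL.const_mul _)) fun ω => ?_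
    have hp : 0 ≤ c ^ (-(δ / 2)) * |X ω| ^ (2 + δ) := by positivity
    rcases le_or_gt (X ω ^ 2) c with h | h
    · simp only; linarith
    · have hx : 0 < |X ω| := by
        rw [abs_pos]; rintro h'; rw [h'] at h; simp at h; linarith
      have h3 : c ^ (δ / 2) * X ω ^ 2 ≤ |X ω| ^ (2 + δ) := by
        rw [Real.rpow_add hx, mul_comm, Real.rpow_two, sq_abs]
        gcongr
        calc c ^ (δ / 2) ≤ (|X ω| ^ 2) ^ (δ / 2) := by
              rw [sq_abs]; gcongr
          _ = |X ω| ^ δ := by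
              rw [← Real.rpow_natCast, ← Real.rpow_mul hx.le]; congr 1; push_cast; ring
      have h4 := mul_le_mul_of_nonneg_left h3 (Real.rpow_nonneg hc.le (-(δ / 2)))
      rw [← mul_assoc, ← Real.rpow_add hc, neg_add_cancel, Real.rpow_zero, one_mul] at h4
      simp only; linarith
  rwa [integral_add (integrable_const _) (hL.const_mul _), integral_const, probReal_univ,
    one_smul] at this

/-- **Lyapunov's theorem** for characteristic functions at `1`: the normalised sums of independent
centred variables, whose average variance tends to `v`, behave like `N(0, v)`. -/
theorem tendsto_charFun_of_lyapunov {X : ℕ → Ω → ℝ} (hm : ∀ i, Measurable (X i))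
    (hind : iIndepFun X P) (h0 : ∀ i, ∫ ω, X i ω ∂P = 0)
    (h2 : ∀ i, Integrable (fun ω => X i ω ^ 2) P) {δ : ℝ} (hδ : 0 < δ)
    (hL : ∀ i, Integrable (fun ω => |X i ω| ^ (2 + δ)) P)
    (hlyap : Tendsto (fun m : ℕ => 1 / (m : ℝ) ^ (1 + δ / 2) *
      ∑ i ∈ Finset.range m, ∫ ω, |X i ω| ^ (2 + δ) ∂P) atTop (𝓝 0))
    {v : ℝ} (hv : Tendsto (fun m : ℕ => 1 / (m : ℝ) *
      ∑ i ∈ Finset.range m, ∫ ω, X i ω ^ 2 ∂P) atTop (𝓝 v)) :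
    Tendsto (fun m : ℕ => charFun (P.map fun ω => ∑ i ∈ Finset.range m, X i ω) (1 / √(m : ℝ)))
      atTop (𝓝 (Complex.exp (-(v / 2 : ℝ)))) := by
  set L : ℕ → ℝ := fun m => 1 / (m : ℝ) ^ (1 + δ / 2) *
      ∑ i ∈ Finset.range m, ∫ ω, |X i ω| ^ (2 + δ) ∂P with hLdef
  set A : ℕ → ℝ := fun m => 1 / (m : ℝ) * ∑ i ∈ Finset.range m, ∫ ω, X i ω ^ 2 ∂P with hAdef
  have hgauss : Tendsto (fun m => Complex.exp (-(A m / 2 : ℝ))) atTop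
      (𝓝 (Complex.exp (-(v / 2 : ℝ)))) := by
    have : Continuous fun a : ℝ => Complex.exp (-(a / 2 : ℝ)) := by fun_prop
    exact (this.tendsto v).comp hv
  -- distance to the Gaussian characteristic function, for every truncation level `ε`
  have hbound : ∀ ε : ℝ, 0 < ε → ε ≤ 1 → ∀ m : ℕ, 0 < m →
      ‖charFun (P.map fun ω => ∑ i ∈ Finset.range m, X i ω) (1 / √(m : ℝ)) -
        Complex.exp (-(A m / 2 : ℝ))‖ ≤
      4 * ε * A m + 4 * ε ^ (-δ) * L m + (ε + ε ^ (-(δ / 2)) * L m) * A m := by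
    intro ε hε hε1 m hm0
    have hm' : (0 : ℝ) < m := by exact_mod_cast hm0
    set t : ℝ := 1 / √(m : ℝ) with ht
    have ht2 : t ^ 2 = 1 / m := by rw [ht, div_pow, Real.sq_sqrt hm'.le, one_pow]
    have htL : |t| ^ (2 + δ) = 1 / (m : ℝ) ^ (1 + δ / 2) := by
      rw [abs_of_nonneg (by positivity), ht, Real.div_rpow zero_le_one (Real.sqrt_nonneg _),
        Real.one_rpow, Real.sqrt_eq_rpow, ← Real.rpow_mul hm'.le]
      congr 2; ring
    set V : ℕ → ℝ := fun i => ∫ ω, X i ω ^ 2 ∂P with hV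
    set B : ℕ → ℝ := fun i => ∫ ω, |X i ω| ^ (2 + δ) ∂P with hB
    have hV0 : ∀ i, 0 ≤ V i := fun i => integral_nonneg fun ω => sq_nonneg _
    have hB0 : ∀ i, 0 ≤ B i := fun i => integral_nonneg fun ω => by positivity
    have hLm : ∑ i ∈ Finset.range m, |t| ^ (2 + δ) * B i = L m := by
      rw [← Finset.mul_sum, htL]
    have hAm : ∑ i ∈ Finset.range m, t ^ 2 * V i = A m := by
      rw [← Finset.mul_sum, ht2]
    have hprod : charFun (P.map fun ω => ∑ i ∈ Finset.range m, X i ω) t =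
        ∏ i ∈ Finset.range m, charFun (P.map (X i)) t := by
      rw [(hind.restrict _).charFun_map_fun_finsetSum_eq_prod
        (fun i _ => (hm i).aemeasurable), Finset.prod_apply]
    have hexp : Complex.exp (-(A m / 2 : ℝ)) =
        ∏ i ∈ Finset.range m, ((Real.exp (-(t ^ 2 * V i / 2)) : ℝ) : ℂ) := by
      rw [← Complex.ofReal_prod, ← Real.exp_sum, ← Complex.ofReal_neg, ← Complex.ofReal_exp,
        Finset.sum_neg_distrib, ← Finset.sum_div, hAm]
    rw [hprod, hexp]
    refine (norm_prod_sub_prod_le _ _ _ (fun i _ => ?_) (fun i _ => ?_)).trans ?_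
    · have := Measure.isProbabilityMeasure_map (μ := P) (hm i).aemeasurable
      exact norm_charFun_le_one t
    · rw [Complex.norm_real, Real.norm_eq_abs, Real.abs_exp, Real.exp_le_one_iff]
      have := hV0 i
      have : 0 ≤ t ^ 2 * V i / 2 := by positivity
      linarith
    · have hterm : ∀ i ∈ Finset.range m,
          ‖charFun (P.map (X i)) t - ((Real.exp (-(t ^ 2 * V i / 2)) : ℝ) : ℂ)‖ ≤
          4 * ε * (t ^ 2 * V i) + 4 * ε ^ (-δ) * (|t| ^ (2 + δ) * B i) +
            (ε + ε ^ (-(δ / 2)) * L m) * (t ^ 2 * V i) := by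
        intro i hi
        have k1 := norm_charFun_sub_le (hm i) (h0 i) (h2 i) hδ (hL i) hε hε1 t
        have ha : 0 ≤ t ^ 2 * V i / 2 := by have := hV0 i; positivity
        have k2 := abs_exp_neg_sub_le ha
        have k3 : t ^ 2 * V i ≤ ε + ε ^ (-(δ / 2)) * L m := by
          have := integral_sq_le_of_lyapunov (h2 i) hδ (hL i) (mul_pos hε hm')
          have hBL : |t| ^ (2 + δ) * B i ≤ L m := by
            rw [← hLm]
            exact Finset.single_le_sum (f := fun i => |t| ^ (2 + δ) * B i)
              (fun j _ => mul_nonneg (by positivity) (hB0 j)) hi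
          calc t ^ 2 * V i ≤ t ^ 2 * (ε * m + (ε * m) ^ (-(δ / 2)) * B i) := by gcongr
            _ = ε + ε ^ (-(δ / 2)) * (|t| ^ (2 + δ) * B i) := by
                rw [ht2, htL, Real.mul_rpow hε.le hm'.le, Real.rpow_add hm', Real.rpow_one,
                  Real.rpow_neg hm'.le]
                field_simp
            _ ≤ _ := by gcongr
        have k4 : (t ^ 2 * V i / 2) ^ 2 ≤ (ε + ε ^ (-(δ / 2)) * L m) * (t ^ 2 * V i) := by
          have := mul_le_mul_of_nonneg_right k3 (by have := hV0 i; positivity : 0 ≤ t ^ 2 * V i)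
          nlinarith
        have k5 : ‖((1 - t ^ 2 * V i / 2 : ℝ) : ℂ) -
            ((Real.exp (-(t ^ 2 * V i / 2)) : ℝ) : ℂ)‖ ≤ (t ^ 2 * V i / 2) ^ 2 := by
          rw [← Complex.ofReal_sub, Complex.norm_real, Real.norm_eq_abs, abs_sub_comm]
          exact k2
        have k6 := norm_add_le
          (charFun (P.map (X i)) t - ((1 - t ^ 2 * V i / 2 : ℝ) : ℂ))
          (((1 - t ^ 2 * V i / 2 : ℝ) : ℂ) - ((Real.exp (-(t ^ 2 * V i / 2)) : ℝ) : ℂ))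
        rw [sub_add_sub_cancel] at k6
        linarith
      refine (Finset.sum_le_sum hterm).trans (le_of_eq ?_)
      rw [← Finset.mul_sum] at hAm hLm
      simp only [Finset.sum_add_distrib, ← Finset.mul_sum]
      rw [hAm, hLm]
  have hv0 : 0 ≤ v := ge_of_tendsto' hv fun m => by
    have : ∀ i, 0 ≤ ∫ ω, X i ω ^ 2 ∂P := fun i => integral_nonneg fun ω => sq_nonneg _
    exact mul_nonneg (by positivity) (Finset.sum_nonneg fun i _ => this i)
  have hdiff : Tendsto (fun m : ℕ =>
      charFun (P.map fun ω => ∑ i ∈ Finset.range m, X i ω) (1 / √(m : ℝ)) -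
        Complex.exp (-(A m / 2 : ℝ))) atTop (𝓝 0) := by
    rw [tendsto_zero_iff_norm_tendsto_zero, Metric.tendsto_nhds]
    intro η hη
    obtain ⟨ε, hε, hε1, hεη⟩ : ∃ ε : ℝ, 0 < ε ∧ ε ≤ 1 ∧ 5 * ε * v < η := by
      refine ⟨min 1 (η / (5 * v + 1) / 2), by positivity, min_le_left _ _, ?_⟩
      have : min 1 (η / (5 * v + 1) / 2) ≤ η / (5 * v + 1) / 2 := min_le_right _ _
      calc 5 * min 1 (η / (5 * v + 1) / 2) * v ≤ 5 * (η / (5 * v + 1) / 2) * v := by gcongr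
        _ = η * (5 * v / (2 * (5 * v + 1))) := by field_simp
        _ < η * 1 := by
          gcongr
          rw [div_lt_one (by positivity)]
          linarith
        _ = η := mul_one _
    have hlim : Tendsto (fun m => 4 * ε * A m + 4 * ε ^ (-δ) * L m +
        (ε + ε ^ (-(δ / 2)) * L m) * A m) atTop
        (𝓝 (4 * ε * v + 4 * ε ^ (-δ) * 0 + (ε + ε ^ (-(δ / 2)) * 0) * v)) :=
      ((hv.const_mul _).add (hlyap.const_mul _)).add
        ((tendsto_const_nhds.add (hlyap.const_mul _)).mul hv)
    have hlt : 4 * ε * v + 4 * ε ^ (-δ) * 0 + (ε + ε ^ (-(δ / 2)) * 0) * v < η := by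
      simp only [mul_zero, add_zero]; linarith
    filter_upwards [hlim.eventually_lt_const hlt, eventually_gt_atTop 0] with m h1 h2
    rw [dist_zero_right, norm_norm]
    exact (hbound ε hε hε1 m h2).trans_lt h1
  simpa using hdiff.add hgauss

end

section
variable {Ω : Type*} [MeasurableSpace Ω] {P : Measure Ω} [IsProbabilityMeasure P]

lemma integrable_sq_of_integrable_rpow {X : Ω → ℝ} (hm : Measurable X) {δ : ℝ} (hδ : 0 < δ)
    (hL : Integrable (fun ω => |X ω| ^ (2 + δ)) P) : Integrable (fun ω => X ω ^ 2) P := by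
  refine Integrable.mono' ((integrable_const 1).add hL) (by fun_prop) (ae_of_all _ fun ω => ?_)
  have h0 : 0 ≤ |X ω| ^ (2 + δ) := by positivity
  rw [Real.norm_eq_abs, abs_of_nonneg (sq_nonneg _), Pi.add_apply]
  rcases le_or_gt |X ω| 1 with h | h
  · have : X ω ^ 2 ≤ 1 := by rw [← sq_abs]; exact pow_le_one₀ (abs_nonneg _) h
    linarith
  · have : X ω ^ 2 ≤ |X ω| ^ (2 + δ) := by
      rw [← sq_abs, ← Real.rpow_two]
      exact Real.rpow_le_rpow_of_exponent_le h.le (by linarith)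
    linarith

lemma abs_sum_mul_rpow_le {ι : Type*} [Fintype ι] (t y : ι → ℝ) {q : ℝ} (hq : 0 < q) :
    |∑ p, t p * y p| ^ q ≤ (∑ p, |t p|) ^ q * ∑ p, |y p| ^ q := by
  rcases isEmpty_or_nonempty ι with h | h
  · simp [Real.zero_rpow hq.ne']
  obtain ⟨p₀, hp₀⟩ := Finite.exists_max fun p => |y p|
  have h1 : |∑ p, t p * y p| ≤ (∑ p, |t p|) * |y p₀| := by
    rw [Finset.sum_mul]
    refine (Finset.abs_sum_le_sum_abs _ _).trans (Finset.sum_le_sum fun p _ => ?_)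
    rw [abs_mul]
    exact mul_le_mul_of_nonneg_left (hp₀ p) (abs_nonneg _)
  have h2 : 0 ≤ ∑ p, |t p| := Finset.sum_nonneg fun _ _ => abs_nonneg _
  calc |∑ p, t p * y p| ^ q ≤ ((∑ p, |t p|) * |y p₀|) ^ q := by gcongr
    _ = (∑ p, |t p|) ^ q * |y p₀| ^ q := Real.mul_rpow h2 (abs_nonneg _)
    _ ≤ _ := by
      gcongr
      exact Finset.single_le_sum (f := fun p => |y p| ^ q) (fun p _ => by positivity)
        (Finset.mem_univ p₀)

omit [IsProbabilityMeasure P] in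
lemma integrable_mul_of_integrable_sq {X Y : Ω → ℝ} (hX : Measurable X) (hY : Measurable Y)
    (h1 : Integrable (fun ω => X ω ^ 2) P) (h2 : Integrable (fun ω => Y ω ^ 2) P) :
    Integrable (fun ω => X ω * Y ω) P :=
  ((memLp_two_iff_integrable_sq hX.aestronglyMeasurable).2 h1).integrable_mul
    ((memLp_two_iff_integrable_sq hY.aestronglyMeasurable).2 h2)

/-- **Lyapunov's central limit theorem** in finite dimension, the limit being described by the
limit `C` of the averaged covariance matrices. -/
theorem tendstoInDistribution_of_lyapunov {ι : Type*} [Fintype ι] [DecidableEq ι]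
    {Y : ℕ → Ω → ι → ℝ} (hm : ∀ i, Measurable (Y i)) (hind : iIndepFun Y P)
    (h0 : ∀ i p, ∫ ω, Y i ω p ∂P = 0) {δ : ℝ} (hδ : 0 < δ)
    (hL : ∀ i p, Integrable (fun ω => |Y i ω p| ^ (2 + δ)) P)
    (hlyap : ∀ p, Tendsto (fun m : ℕ => 1 / (m : ℝ) ^ (1 + δ / 2) *
      ∑ i ∈ Finset.range m, ∫ ω, |Y i ω p| ^ (2 + δ) ∂P) atTop (𝓝 0))
    {C : Matrix ι ι ℝ} (hC : ∀ p q, Tendsto (fun m : ℕ => 1 / (m : ℝ) *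
      ∑ i ∈ Finset.range m, ∫ ω, Y i ω p * Y i ω q ∂P) atTop (𝓝 (C p q))) :
    C.PosSemidef ∧ TendstoInDistribution
      (fun (m : ℕ) ω => WithLp.toLp 2 fun p => 1 / √(m : ℝ) * ∑ i ∈ Finset.range m, Y i ω p)
      atTop id (fun _ => P) (multivariateGaussian 0 C) := by
  have hmp : ∀ i p, Measurable fun ω => Y i ω p := fun i p => (measurable_pi_apply p).comp (hm i)
  have hsq : ∀ i p, Integrable (fun ω => Y i ω p ^ 2) P := fun i p =>
    integrable_sq_of_integrable_rpow (hmp i p) hδ (hL i p)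
  have hint : ∀ i p, Integrable (fun ω => Y i ω p) P := fun i p =>
    ((memLp_two_iff_integrable_sq (hmp i p).aestronglyMeasurable).2 (hsq i p)).integrable
      (by norm_num)
  have hmul : ∀ i p q, Integrable (fun ω => Y i ω p * Y i ω q) P := fun i p q =>
    integrable_mul_of_integrable_sq (hmp i p) (hmp i q) (hsq i p) (hsq i q)
  -- linear combinations of the coordinates
  have hXm : ∀ (t : ι → ℝ) i, Measurable fun ω => ∑ p, t p * Y i ω p := fun t i =>
    Finset.measurable_sum _ fun p _ => (hmp i p).const_mul _
  have hX2 : ∀ (t : ι → ℝ) i, (fun ω => (∑ p, t p * Y i ω p) ^ 2) =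
      fun ω => ∑ p, ∑ q, t p * t q * (Y i ω p * Y i ω q) := by
    intro t i; ext ω
    rw [sq, Finset.sum_mul_sum]
    exact Finset.sum_congr rfl fun p _ => Finset.sum_congr rfl fun q _ => by ring
  have hXi2 : ∀ (t : ι → ℝ) i, Integrable (fun ω => (∑ p, t p * Y i ω p) ^ 2) P := by
    intro t i; rw [hX2]
    exact integrable_finsetSum _ fun p _ => integrable_finsetSum _ fun q _ =>
      (hmul i p q).const_mul _
  have hXv : ∀ (t : ι → ℝ), Tendsto (fun m : ℕ => 1 / (m : ℝ) *
      ∑ i ∈ Finset.range m, ∫ ω, (∑ p, t p * Y i ω p) ^ 2 ∂P) atTop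
      (𝓝 (t ⬝ᵥ C *ᵥ t)) := by
    intro t
    have e : ∀ i, ∫ ω, (∑ p, t p * Y i ω p) ^ 2 ∂P =
        ∑ p, ∑ q, t p * t q * ∫ ω, Y i ω p * Y i ω q ∂P := by
      intro i
      rw [hX2, integral_finsetSum _ fun p _ => integrable_finsetSum _ fun q _ =>
        (hmul i p q).const_mul _]
      refine Finset.sum_congr rfl fun p _ => ?_
      rw [integral_finsetSum _ fun q _ => (hmul i p q).const_mul _]
      exact Finset.sum_congr rfl fun q _ => integral_const_mul _ _
    have e2 : t ⬝ᵥ C *ᵥ t = ∑ p, ∑ q, t p * t q * C p q := by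
      simp only [dotProduct, mulVec, Finset.mul_sum]
      exact Finset.sum_congr rfl fun p _ => Finset.sum_congr rfl fun q _ => by ring
    rw [e2]
    refine (tendsto_finsetSum _ fun p _ => tendsto_finsetSum _ fun q _ =>
      (hC p q).const_mul (t p * t q)).congr fun m => ?_
    simp only [e]
    rw [Finset.sum_comm (s := Finset.range m), Finset.mul_sum]
    refine Finset.sum_congr rfl fun p _ => ?_
    rw [Finset.sum_comm (s := Finset.range m), Finset.mul_sum]
    refine Finset.sum_congr rfl fun q _ => ?_
    rw [← Finset.mul_sum]
    ring
  have hCpos : C.PosSemidef := by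
    refine PosSemidef.of_dotProduct_mulVec_nonneg ?_ fun t => ?_
    · ext p q
      simp only [conjTranspose_apply, star_trivial]
      refine tendsto_nhds_unique (hC q p) ((hC p q).congr fun m => ?_)
      simp only [mul_comm]
    · rw [star_trivial]
      refine ge_of_tendsto' (hXv t) fun m => ?_
      exact mul_nonneg (by positivity) (Finset.sum_nonneg fun i _ =>
        integral_nonneg fun ω => sq_nonneg _)
  refine ⟨hCpos, ?_⟩
  have hSm : ∀ m : ℕ, Measurable fun ω =>
      WithLp.toLp 2 fun p => 1 / √(m : ℝ) * ∑ i ∈ Finset.range m, Y i ω p := by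
    intro m
    refine (by fun_prop : Measurable (WithLp.toLp 2 : (ι → ℝ) → _)).comp ?_
    exact measurable_pi_lambda _ fun p => (Finset.measurable_sum _ fun i _ => hmp i p).const_mul _
  refine ⟨fun m => (hSm m).aemeasurable, aemeasurable_id, ?_⟩
  refine ProbabilityMeasure.tendsto_iff_tendsto_charFun.2 fun t => ?_
  have hlim : charFun (Measure.map id (multivariateGaussian 0 C)) t =
      Complex.exp (-((t.ofLp ⬝ᵥ C *ᵥ t.ofLp) / 2 : ℝ)) := by
    rw [Measure.map_id, charFun_multivariateGaussian hCpos]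
    congr 1
    simp
  have hcf : ∀ m : ℕ, charFun (P.map fun ω =>
        WithLp.toLp 2 fun p => 1 / √(m : ℝ) * ∑ i ∈ Finset.range m, Y i ω p) t =
      charFun (P.map fun ω => ∑ i ∈ Finset.range m, ∑ p, t p * Y i ω p) (1 / √(m : ℝ)) := by
    intro m
    rw [charFun_apply, charFun_apply_real, integral_map (hSm m).aemeasurable (by fun_prop),
      integral_map (Finset.measurable_sum _ fun i _ => hXm t i).aemeasurable (by fun_prop)]
    congr 1; ext ω; congr 2
    rw [PiLp.inner_apply, ← Complex.ofReal_mul]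
    congr 1
    simp only [RCLike.inner_apply, conj_trivial, Finset.mul_sum]
    rw [Finset.sum_comm]
    exact Finset.sum_congr rfl fun i _ => Finset.sum_congr rfl fun p _ => by ring
  have hlyapt : Tendsto (fun m : ℕ => 1 / (m : ℝ) ^ (1 + δ / 2) *
      ∑ i ∈ Finset.range m, ∫ ω, |∑ p, t p * Y i ω p| ^ (2 + δ) ∂P) atTop (𝓝 0) := by
    have hb : Tendsto (fun m : ℕ => (∑ p, |t p|) ^ (2 + δ) * ∑ p, (1 / (m : ℝ) ^ (1 + δ / 2) *
        ∑ i ∈ Finset.range m, ∫ ω, |Y i ω p| ^ (2 + δ) ∂P)) atTop (𝓝 0) := by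
      have := (tendsto_finsetSum Finset.univ fun p _ => hlyap p).const_mul
        ((∑ p, |t p|) ^ (2 + δ))
      simpa using this
    refine squeeze_zero (fun m => mul_nonneg (by positivity) (Finset.sum_nonneg fun i _ =>
      integral_nonneg fun ω => by positivity)) (fun m => ?_) hb
    rw [← Finset.mul_sum, Finset.sum_comm, mul_left_comm]
    refine mul_le_mul_of_nonneg_left ?_ (by positivity)
    rw [Finset.mul_sum]
    refine Finset.sum_le_sum fun i _ => ?_
    rw [← integral_finsetSum _ fun p _ => hL i p, ← integral_const_mul]
    refine integral_mono_of_nonneg (ae_of_all _ fun ω => by positivity)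
      ((integrable_finsetSum _ fun p _ => hL i p).const_mul _) (ae_of_all _ fun ω => ?_)
    exact abs_sum_mul_rpow_le _ _ (by linarith)
  have hXL : ∀ i, Integrable (fun ω => |∑ p, t p * Y i ω p| ^ (2 + δ)) P := fun i => by
    refine Integrable.mono' ((integrable_finsetSum Finset.univ fun p _ => hL i p).const_mul
      ((∑ p, |t p|) ^ (2 + δ))) ?_ (ae_of_all _ fun ω => ?_)
    · exact ((hXm t i).abs.pow_const _).aestronglyMeasurable
    · rw [Real.norm_eq_abs, abs_of_nonneg (by positivity)]
      exact abs_sum_mul_rpow_le _ _ (by linarith)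
  have hX0 : ∀ i, ∫ ω, ∑ p, t p * Y i ω p ∂P = 0 := fun i => by
    rw [integral_finsetSum _ fun p _ => (hint i p).const_mul _]
    exact Finset.sum_eq_zero fun p _ => by rw [integral_const_mul, h0, mul_zero]
  have hXind : iIndepFun (fun i ω => ∑ p, t p * Y i ω p) P :=
    hind.comp (fun _ y => ∑ p, t p * y p) fun _ => by fun_prop
  have key := tendsto_charFun_of_lyapunov (hXm t) hXind hX0 (hXi2 t) hδ hXL hlyapt (hXv t)
  change Tendsto (fun m : ℕ => charFun (P.map fun ω =>
    WithLp.toLp 2 fun p => 1 / √(m : ℝ) * ∑ i ∈ Finset.range m, Y i ω p) t) atTop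
    (𝓝 (charFun (Measure.map id (multivariateGaussian 0 C)) t))
  rw [hlim]
  exact key.congr fun m => (hcf m).symm

end

/-! ### Convergence in probability as convergence along a filter -/

section
variable {Ω : Type*} [MeasurableSpace Ω]

/-- The filter of events that hold with probability tending to one: a set of pairs `(m, ω)` belongs
to it when the probability that `(m, ω)` lies outside tends to zero with `m`. Convergence in
probability is `Tendsto` along this filter, so that deterministic limit arguments apply. -/
def inProb (P : Measure Ω) : Filter (ℕ × Ω) where
  sets := {A | Tendsto (fun m => P {ω | (m, ω) ∉ A}) atTop (𝓝 0)}
  univ_sets := by simp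
  sets_of_superset {A B} hA hAB := tendsto_of_tendsto_of_tendsto_of_le_of_le tendsto_const_nhds hA
    (fun _ => zero_le) fun _ => measure_mono fun _ h1 h2 => h1 (hAB h2)
  inter_sets {A B} hA hB := by
    refine tendsto_of_tendsto_of_tendsto_of_le_of_le tendsto_const_nhds
      (by simpa using Tendsto.add hA hB) (fun _ => zero_le) fun m => ?_
    refine (measure_mono fun ω h => ?_).trans (measure_union_le _ _)
    by_contra h'
    simp only [Set.mem_union, Set.mem_ofPred_eq, not_or, not_not] at h'
    exact h ⟨h'.1, h'.2⟩

variable {P : Measure Ω}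

lemma eventually_inProb {p : ℕ × Ω → Prop} :
    (∀ᶠ x in inProb P, p x) ↔ Tendsto (fun m => P {ω | ¬ p (m, ω)}) atTop (𝓝 0) := Iff.rfl

lemma tendsto_fst_inProb : Tendsto Prod.fst (inProb P) atTop := by
  refine tendsto_atTop.2 fun N => eventually_inProb.2 ?_
  refine tendsto_const_nhds.congr' ?_
  filter_upwards [eventually_ge_atTop N] with m hm
  simp [hm]

lemma tendstoInMeasure_zero_iff_inProb {E : Type*} [SeminormedAddCommGroup E] {f : ℕ → Ω → E} :
    TendstoInMeasure P f atTop 0 ↔ Tendsto (fun x : ℕ × Ω => f x.1 x.2) (inProb P) (𝓝 0) := by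
  rw [tendstoInMeasure_iff_norm, Metric.tendsto_nhds]
  refine forall_congr' fun ε => imp_congr_right fun _ => ?_
  rw [eventually_inProb]
  simp

lemma tendsto_inProb_of_integral_sq [IsFiniteMeasure P] {f : ℕ → Ω → ℝ}
    (hf : ∀ m, Integrable (fun ω => f m ω ^ 2) P)
    (h : Tendsto (fun m => ∫ ω, f m ω ^ 2 ∂P) atTop (𝓝 0)) :
    Tendsto (fun x : ℕ × Ω => f x.1 x.2) (inProb P) (𝓝 0) := by
  rw [Metric.tendsto_nhds]
  intro ε hε
  rw [eventually_inProb]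
  have hlim : Tendsto (fun m => ENNReal.ofReal ((∫ ω, f m ω ^ 2 ∂P) / ε ^ 2)) atTop (𝓝 0) := by
    have := ENNReal.tendsto_ofReal (h.div_const (ε ^ 2))
    simpa using this
  refine tendsto_of_tendsto_of_tendsto_of_le_of_le tendsto_const_nhds hlim (fun _ => zero_le)
    fun m => ?_
  have := mul_meas_ge_le_integral_of_nonneg (ae_of_all P fun ω => sq_nonneg (f m ω)) (hf m) (ε ^ 2)
  have h2 : {ω | ¬ dist (f m ω) 0 < ε} ⊆ {ω | ε ^ 2 ≤ f m ω ^ 2} := fun ω hω => by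
    simp only [dist_zero_right, Real.norm_eq_abs, not_lt, Set.mem_ofPred_eq] at hω ⊢
    rw [← sq_abs (f m ω)]
    gcongr
  refine (measure_mono h2).trans ?_
  rw [← ofReal_measureReal]
  refine ENNReal.ofReal_le_ofReal ?_
  rw [le_div_iff₀ (by positivity)]
  linarith

/-- A sequence bounded in `L²` times a sequence tending to zero in probability. -/
lemma tendsto_inProb_mul_of_bounded_sq [IsFiniteMeasure P] {f : ℕ → Ω → ℝ} {g : ℕ × Ω → ℝ} {B : ℝ}
    (hf : ∀ m, Integrable (fun ω => f m ω ^ 2) P) (h : ∀ m, ∫ ω, f m ω ^ 2 ∂P ≤ B)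
    (hg : Tendsto g (inProb P) (𝓝 0)) :
    Tendsto (fun x : ℕ × Ω => f x.1 x.2 * g x) (inProb P) (𝓝 0) := by
  rw [Metric.tendsto_nhds]
  intro ε hε
  rw [eventually_inProb, ENNReal.tendsto_nhds_zero]
  intro η hη
  -- a level `M` that `f` exceeds with small probability
  obtain ⟨M, hM, hMη⟩ : ∃ M : ℝ, 0 < M ∧ ENNReal.ofReal (B / M ^ 2) ≤ η / 2 := by
    have hlim : Tendsto (fun M : ℝ => ENNReal.ofReal (B / M ^ 2)) atTop (𝓝 0) := by
      have := ENNReal.tendsto_ofReal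
        (tendsto_const_nhds (x := B) |>.div_atTop (tendsto_pow_atTop (α := ℝ) two_ne_zero))
      simpa using this
    have h2 : (0 : ENNReal) < η / 2 := ENNReal.half_pos hη.ne'
    obtain ⟨M, h3, h4⟩ := ((hlim.eventually (ge_mem_nhds h2)).and (eventually_gt_atTop 0)).exists
    exact ⟨M, h4, h3⟩
  have hgM := (Metric.tendsto_nhds.1 hg) (ε / M) (by positivity)
  rw [eventually_inProb, ENNReal.tendsto_nhds_zero] at hgM
  filter_upwards [hgM (η / 2) (ENNReal.half_pos hη.ne')] with m hm
  have h2 : {ω | ¬ dist (f m ω * g (m, ω)) 0 < ε} ⊆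
      {ω | M ^ 2 ≤ f m ω ^ 2} ∪ {ω | ¬ dist (g (m, ω)) 0 < ε / M} := fun ω hω => by
    by_contra hc
    simp only [dist_zero_right, Real.norm_eq_abs, not_lt, Set.mem_ofPred_eq, Set.mem_union, not_or,
      not_le] at hω hc
    have h3 : |f m ω| < M := abs_lt_of_sq_lt_sq hc.1 hM.le
    have h4 : |f m ω * g (m, ω)| < ε := by
      rw [abs_mul]
      calc |f m ω| * |g (m, ω)| ≤ M * |g (m, ω)| := by gcongr
        _ < M * (ε / M) := by gcongr; exact hc.2
        _ = ε := by field_simp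
    linarith
  refine ((measure_mono h2).trans (measure_union_le _ _)).trans ?_
  rw [← ENNReal.add_halves η]
  refine add_le_add ((?_ : _ ≤ _).trans hMη) hm
  rw [← ofReal_measureReal]
  refine ENNReal.ofReal_le_ofReal ?_
  rw [le_div_iff₀ (by positivity)]
  have := mul_meas_ge_le_integral_of_nonneg (ae_of_all P fun ω => sq_nonneg (f m ω)) (hf m) (M ^ 2)
  linarith [h m]

lemma tendsto_inProb_div_fst [IsFiniteMeasure P] {k : Ω → ℝ} (hk : Measurable k) :
    Tendsto (fun x : ℕ × Ω => k x.2 / x.1) (inProb P) (𝓝 0) := by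
  refine tendstoInMeasure_zero_iff_inProb (f := fun m ω => k ω / (m : ℝ)).1 ?_
  refine tendstoInMeasure_of_tendsto_ae (fun m => (hk.div_const _).aestronglyMeasurable)
    (ae_of_all _ fun ω => ?_)
  exact tendsto_const_nhds.div_atTop tendsto_natCast_atTop_atTop

/-- Averages of nonnegative terms against weights that become uniformly small tend to zero. -/
lemma tendsto_weighted_average {α : Type*} {l : Filter α} {N : α → ℕ} (hN : Tendsto N l atTop)
    {w k : ℕ → α → ℝ} (hw : ∀ ε > 0, ∃ i₀, ∀ᶠ x in l, ∀ i ≥ i₀, |w i x| ≤ ε)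
    (hw' : ∀ i, ∃ C, ∀ᶠ x in l, |w i x| ≤ C) (hk : ∀ i x, 0 ≤ k i x)
    {B : ℝ} (hB : ∀ᶠ x in l, 1 / (N x : ℝ) * ∑ i ∈ Finset.range (N x), k i x ≤ B)
    (hk0 : ∀ i, Tendsto (fun x => k i x / (N x : ℝ)) l (𝓝 0)) :
    Tendsto (fun x => 1 / (N x : ℝ) * ∑ i ∈ Finset.range (N x), w i x * k i x) l (𝓝 0) := by
  rw [Metric.tendsto_nhds]
  intro η hη
  set ε := η / (2 * (|B| + 1)) with hε
  have hε0 : 0 < ε := by positivity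
  obtain ⟨i₀, hi₀⟩ := hw ε hε0
  choose C hC using hw'
  have hhead : Tendsto (fun x => ∑ i ∈ Finset.range i₀, C i * (k i x / (N x : ℝ))) l (𝓝 0) := by
    have := tendsto_finsetSum (Finset.range i₀) fun i _ => (hk0 i).const_mul (C i)
    simpa using this
  have hCall : ∀ᶠ x in l, ∀ i ∈ Finset.range i₀, |w i x| ≤ C i :=
    (Finset.eventually_all _).2 fun i _ => hC i
  filter_upwards [hi₀, hCall, hB, hN.eventually_ge_atTop i₀,
    hhead.eventually_lt_const (half_pos hη)] with x h1 h2 h3 h4 h5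
  rw [dist_zero_right, Real.norm_eq_abs, abs_mul, abs_of_nonneg (by positivity)]
  have h6 : |∑ i ∈ Finset.range (N x), w i x * k i x| ≤
      ∑ i ∈ Finset.range i₀, C i * k i x + ε * ∑ i ∈ Finset.range (N x), k i x := by
    rw [← Finset.sum_range_add_sum_Ico _ h4]
    refine (abs_add_le _ _).trans (add_le_add ?_ ?_)
    · refine (Finset.abs_sum_le_sum_abs _ _).trans (Finset.sum_le_sum fun i hi => ?_)
      rw [abs_mul, abs_of_nonneg (hk i x)]
      exact mul_le_mul_of_nonneg_right (h2 i hi) (hk i x)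
    · rw [Finset.mul_sum]
      refine (Finset.abs_sum_le_sum_abs _ _).trans ?_
      refine (Finset.sum_le_sum fun i hi => (?_ : _ ≤ ε * k i x)).trans
        (Finset.sum_le_sum_of_subset_of_nonneg ?_ fun i _ _ => mul_nonneg hε0.le (hk i x))
      · rw [abs_mul, abs_of_nonneg (hk i x)]
        exact mul_le_mul_of_nonneg_right (h1 i (Finset.mem_Ico.1 hi).1) (hk i x)
      · intro i hi
        exact Finset.mem_range.2 (Finset.mem_Ico.1 hi).2
  have h7 : 1 / (N x : ℝ) * ∑ i ∈ Finset.range i₀, C i * k i x < η / 2 := by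
    rw [Finset.mul_sum]
    refine lt_of_eq_of_lt (Finset.sum_congr rfl fun i _ => ?_) h5
    ring
  calc 1 / (N x : ℝ) * |∑ i ∈ Finset.range (N x), w i x * k i x|
      ≤ 1 / (N x : ℝ) * (∑ i ∈ Finset.range i₀, C i * k i x +
          ε * ∑ i ∈ Finset.range (N x), k i x) := by gcongr
    _ = 1 / (N x : ℝ) * ∑ i ∈ Finset.range i₀, C i * k i x +
          ε * (1 / (N x : ℝ) * ∑ i ∈ Finset.range (N x), k i x) := by ring
    _ ≤ 1 / (N x : ℝ) * ∑ i ∈ Finset.range i₀, C i * k i x + ε * |B| := by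
        gcongr; exact h3.trans (le_abs_self B)
    _ < η / 2 + η / 2 := by
        refine add_lt_add h7 ?_
        rw [hε, div_mul_eq_mul_div, div_lt_iff₀ (by positivity)]
        nlinarith [abs_nonneg B]
    _ = η := add_halves η

/-- Second moment of a linear combination of independent centred variables. -/
lemma integral_sq_sum_of_indep [IsProbabilityMeasure P] {ξ : ℕ → Ω → ℝ}
    (hm : ∀ i, Measurable (ξ i)) (hind : iIndepFun ξ P) (h0 : ∀ i, ∫ ω, ξ i ω ∂P = 0)
    (h2 : ∀ i, Integrable (fun ω => ξ i ω ^ 2) P) (c : ℕ → ℝ) (m : ℕ) :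
    Integrable (fun ω => (∑ i ∈ Finset.range m, c i * ξ i ω) ^ 2) P ∧
    ∫ ω, (∑ i ∈ Finset.range m, c i * ξ i ω) ^ 2 ∂P =
      ∑ i ∈ Finset.range m, c i ^ 2 * ∫ ω, ξ i ω ^ 2 ∂P := by
  have hL : ∀ i, MemLp (fun ω => c i * ξ i ω) 2 P := fun i =>
    ((memLp_two_iff_integrable_sq (hm i).aestronglyMeasurable).2 (h2 i)).const_mul _
  have hsm : Measurable fun ω => ∑ i ∈ Finset.range m, c i * ξ i ω :=
    Finset.measurable_sum _ fun i _ => (hm i).const_mul _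
  have hS : MemLp (fun ω => ∑ i ∈ Finset.range m, c i * ξ i ω) 2 P :=
    memLp_finsetSum _ fun i _ => hL i
  refine ⟨(memLp_two_iff_integrable_sq hsm.aestronglyMeasurable).1 hS, ?_⟩
  have hind' : iIndepFun (fun i ω => c i * ξ i ω) P :=
    hind.comp (fun i y => c i * y) fun _ => by fun_prop
  have hvar := IndepFun.variance_sum (s := Finset.range m) (fun i _ => hL i)
    fun i _ j _ hij => hind'.indepFun hij
  have hz : ∀ i, ∫ ω, c i * ξ i ω ∂P = 0 := fun i => by rw [integral_const_mul, h0, mul_zero]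
  have e : (∑ i ∈ Finset.range m, fun ω => c i * ξ i ω) =
      fun ω => ∑ i ∈ Finset.range m, c i * ξ i ω := by ext ω; simp
  rw [e, variance_of_integral_eq_zero hsm.aemeasurable] at hvar
  · rw [hvar]
    refine Finset.sum_congr rfl fun i _ => ?_
    rw [variance_of_integral_eq_zero ((hm i).const_mul _).aemeasurable (hz i),
      ← integral_const_mul]
    simp only [mul_pow]
  · rw [integral_finsetSum _ fun i _ => (hL i).integrable (by norm_num)]
    exact Finset.sum_eq_zero fun i _ => hz i

/-- Normalised sums of independent centred variables with bounded average variance are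
asymptotically insensitive to vanishing perturbations of their coefficients. -/
lemma tendsto_inProb_sum_of_tendsto_zero [IsProbabilityMeasure P] {ξ : ℕ → Ω → ℝ}
    (hm : ∀ i, Measurable (ξ i)) (hind : iIndepFun ξ P) (h0 : ∀ i, ∫ ω, ξ i ω ∂P = 0)
    (h2 : ∀ i, Integrable (fun ω => ξ i ω ^ 2) P) {v : ℝ}
    (hv : Tendsto (fun m : ℕ => 1 / (m : ℝ) * ∑ i ∈ Finset.range m, ∫ ω, ξ i ω ^ 2 ∂P) atTop (𝓝 v))
    {c : ℕ → ℝ} (hc : Tendsto c atTop (𝓝 0)) :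
    Tendsto (fun x : ℕ × Ω => 1 / √(x.1 : ℝ) * ∑ i ∈ Finset.range x.1, c i * ξ i x.2)
      (inProb P) (𝓝 0) := by
  have hnn : ∀ i, 0 ≤ ∫ ω, ξ i ω ^ 2 ∂P := fun i => integral_nonneg fun ω => sq_nonneg _
  have key := integral_sq_sum_of_indep hm hind h0 h2 c
  refine tendsto_inProb_of_integral_sq
    (f := fun m ω => 1 / √(m : ℝ) * ∑ i ∈ Finset.range m, c i * ξ i ω) (fun m => ?_) ?_
  · simp only [mul_pow]
    exact (key m).1.const_mul _
  · have e : ∀ m : ℕ, ∫ ω, (1 / √(m : ℝ) * ∑ i ∈ Finset.range m, c i * ξ i ω) ^ 2 ∂P =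
        1 / (m : ℝ) * ∑ i ∈ Finset.range m, c i ^ 2 * ∫ ω, ξ i ω ^ 2 ∂P := fun m => by
      simp only [mul_pow]
      rw [integral_const_mul, (key m).2, div_pow, Real.sq_sqrt (Nat.cast_nonneg m), one_pow]
    simp only [e]
    refine tendsto_weighted_average (l := atTop) (N := fun m => m) tendsto_id
      (w := fun i _ => c i ^ 2) (k := fun i _ => ∫ ω, ξ i ω ^ 2 ∂P) ?_
      (fun i => ⟨|c i ^ 2|, Eventually.of_forall fun _ => le_rfl⟩) (fun i _ => hnn i)
      (hv.eventually_le_const (lt_add_one v))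
      fun i => tendsto_const_nhds.div_atTop tendsto_natCast_atTop_atTop
    intro ε hε
    have : Tendsto (fun i => c i ^ 2) atTop (𝓝 0) := by simpa using hc.pow 2
    obtain ⟨i₀, hi₀⟩ := eventually_atTop.1 (this.eventually (Metric.closedBall_mem_nhds 0 hε))
    refine ⟨i₀, Eventually.of_forall fun _ i hi => ?_⟩
    simpa using hi₀ i hi

end

/-! ### Quadratic forms and inverses of positive definite matrices -/

section
variable {ι κ : Type*} [Fintype ι] [Fintype κ]

lemma mulVec_dotProduct_eq (A : Matrix ι κ ℝ) (x : κ → ℝ) (y : ι → ℝ) :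
    (A *ᵥ x) ⬝ᵥ y = x ⬝ᵥ Aᵀ *ᵥ y := by
  rw [dotProduct_mulVec, vecMul_transpose]

lemma dotProduct_symm_mulVec {A : Matrix ι ι ℝ} (hA : Aᵀ = A) (x y : ι → ℝ) :
    x ⬝ᵥ A *ᵥ y = y ⬝ᵥ A *ᵥ x := by
  rw [← hA, ← mulVec_dotProduct_eq, hA, dotProduct_comm]

lemma dotProduct_transpose_mul_mul_mulVec (B : Matrix κ ι ℝ) (A : Matrix κ κ ℝ) (v : ι → ℝ) :
    v ⬝ᵥ (Bᵀ * A * B) *ᵥ v = (B *ᵥ v) ⬝ᵥ A *ᵥ (B *ᵥ v) := by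
  rw [mulVec_dotProduct_eq, mulVec_mulVec, mulVec_mulVec, Matrix.mul_assoc]

omit [Fintype ι] in
lemma _root_.Matrix.PosSemidef.transpose_eq {A : Matrix ι ι ℝ} (hA : A.PosSemidef) : Aᵀ = A := by
  have := hA.isHermitian.eq
  rwa [conjTranspose_eq_transpose_of_trivial] at this

lemma _root_.Matrix.PosSemidef.quad_nonneg {A : Matrix ι ι ℝ} (hA : A.PosSemidef) (v : ι → ℝ) :
    0 ≤ v ⬝ᵥ A *ᵥ v := by
  simpa using hA.dotProduct_mulVec_nonneg v

lemma _root_.Matrix.PosDef.quad_pos {A : Matrix ι ι ℝ} (hA : A.PosDef) {v : ι → ℝ} (hv : v ≠ 0) :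
    0 < v ⬝ᵥ A *ᵥ v := by
  simpa using hA.dotProduct_mulVec_pos hv

lemma exists_eq_transpose_mul_self {A : Matrix ι ι ℝ} (hA : A.PosSemidef) :
    ∃ B : Matrix ι ι ℝ, A = Bᵀ * B := by
  classical
  open scoped MatrixOrder in
  obtain ⟨B, hB⟩ := CStarAlgebra.nonneg_iff_eq_star_mul_self.mp hA.nonneg
  exact ⟨B, by rw [hB, star_eq_conjTranspose, conjTranspose_eq_transpose_of_trivial]⟩

lemma dotProduct_transpose_mul_self_mulVec (B : Matrix κ ι ℝ) (v : ι → ℝ) :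
    v ⬝ᵥ (Bᵀ * B) *ᵥ v = (B *ᵥ v) ⬝ᵥ (B *ᵥ v) := by
  rw [mulVec_dotProduct_eq, mulVec_mulVec]

variable [DecidableEq ι]

lemma mulVec_inv_mulVec {N : Matrix ι ι ℝ} (hN : N.PosDef) (y : ι → ℝ) :
    N *ᵥ (N⁻¹ *ᵥ y) = y := by
  rw [mulVec_mulVec, mul_nonsing_inv _ ((isUnit_iff_isUnit_det _).1 hN.isUnit), one_mulVec]

lemma inv_transpose_eq {N : Matrix ι ι ℝ} (hN : N.PosDef) : (N⁻¹)ᵀ = N⁻¹ :=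
  hN.inv.posSemidef.transpose_eq

lemma quad_inv_mulVec {N : Matrix ι ι ℝ} (hN : N.PosDef) (y : ι → ℝ) :
    (N⁻¹ *ᵥ y) ⬝ᵥ N *ᵥ (N⁻¹ *ᵥ y) = y ⬝ᵥ N⁻¹ *ᵥ y := by
  rw [mulVec_inv_mulVec hN, dotProduct_comm]

/-- The dual description of the form of the inverse matrix: `yᵀN⁻¹y = max_l (2lᵀy - lᵀNl)`, the
maximum being attained at `l = N⁻¹y`. -/
lemma dual_le_quad_inv {N : Matrix ι ι ℝ} (hN : N.PosDef) (y l : ι → ℝ) :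
    2 * (l ⬝ᵥ y) - l ⬝ᵥ N *ᵥ l ≤ y ⬝ᵥ N⁻¹ *ᵥ y := by
  have h := hN.posSemidef.quad_nonneg (l - N⁻¹ *ᵥ y)
  rw [mulVec_sub, dotProduct_sub, sub_dotProduct, sub_dotProduct, quad_inv_mulVec hN,
    mulVec_inv_mulVec hN, dotProduct_symm_mulVec hN.posSemidef.transpose_eq (N⁻¹ *ᵥ y) l,
    mulVec_inv_mulVec hN] at h
  linarith

lemma sq_dotProduct_le {N : Matrix ι ι ℝ} (hN : N.PosDef) (l y : ι → ℝ) :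
    (l ⬝ᵥ y) ^ 2 ≤ (l ⬝ᵥ N *ᵥ l) * (y ⬝ᵥ N⁻¹ *ᵥ y) := by
  rcases eq_or_ne l 0 with rfl | hl
  · simp
  have h0 := hN.quad_pos hl
  have h := dual_le_quad_inv hN y (((l ⬝ᵥ y) / (l ⬝ᵥ N *ᵥ l)) • l)
  simp only [mulVec_smul, dotProduct_smul, smul_dotProduct, smul_eq_mul] at h
  have e : 2 * ((l ⬝ᵥ y) / (l ⬝ᵥ N *ᵥ l) * (l ⬝ᵥ y)) -
      (l ⬝ᵥ y) / (l ⬝ᵥ N *ᵥ l) * ((l ⬝ᵥ y) / (l ⬝ᵥ N *ᵥ l) * (l ⬝ᵥ N *ᵥ l)) =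
      (l ⬝ᵥ y) ^ 2 / (l ⬝ᵥ N *ᵥ l) := by
    field_simp
    ring
  rw [e, div_le_iff₀ h0] at h
  linarith

lemma quad_inv_le_of_quad_le {N N' : Matrix ι ι ℝ} (hN : N.PosDef) (hN' : N'.PosDef) {c : ℝ}
    (hc : 0 < c) (h : ∀ v, v ⬝ᵥ N *ᵥ v ≤ c * (v ⬝ᵥ N' *ᵥ v)) (y : ι → ℝ) :
    c⁻¹ * (y ⬝ᵥ N'⁻¹ *ᵥ y) ≤ y ⬝ᵥ N⁻¹ *ᵥ y := by
  have h1 := dual_le_quad_inv hN y (c⁻¹ • (N'⁻¹ *ᵥ y))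
  have h2 := h (c⁻¹ • (N'⁻¹ *ᵥ y))
  simp only [mulVec_smul, dotProduct_smul, smul_dotProduct, smul_eq_mul,
    quad_inv_mulVec hN'] at h1 h2
  rw [dotProduct_comm (N'⁻¹ *ᵥ y) y] at h1
  have e : c * (c⁻¹ * (c⁻¹ * (y ⬝ᵥ N'⁻¹ *ᵥ y))) = c⁻¹ * (y ⬝ᵥ N'⁻¹ *ᵥ y) := by
    field_simp
  rw [e] at h2
  linarith

omit [DecidableEq ι] in
lemma trace_transpose_mul_self_mul (R : Matrix κ ι ℝ) (G : Matrix ι ι ℝ) :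
    (Rᵀ * R * G).trace = ∑ k, R k ⬝ᵥ G *ᵥ R k := by
  rw [Matrix.mul_assoc, Matrix.trace_mul_comm, Matrix.trace]
  refine Finset.sum_congr rfl fun k _ => ?_
  rw [diag_apply, Matrix.mul_assoc, Matrix.mul_apply]
  rfl

omit [DecidableEq ι] in
lemma trace_mul_le_of_quad_le {M A B : Matrix ι ι ℝ} (hM : M.PosSemidef)
    (h : ∀ v, v ⬝ᵥ A *ᵥ v ≤ v ⬝ᵥ B *ᵥ v) : (M * A).trace ≤ (M * B).trace := by
  obtain ⟨R, rfl⟩ := exists_eq_transpose_mul_self hM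
  rw [trace_transpose_mul_self_mul, trace_transpose_mul_self_mul]
  exact Finset.sum_le_sum fun k _ => h _

omit [DecidableEq ι] in
lemma trace_mul_transpose_mul_self (M : Matrix ι ι ℝ) (H : Matrix κ ι ℝ) :
    (M * (Hᵀ * H)).trace = ∑ k, H k ⬝ᵥ M *ᵥ H k := by
  rw [Matrix.trace_mul_comm, trace_transpose_mul_self_mul]

/-- A positive semidefinite matrix is dominated by `tr(N⁻¹B) N`. -/
lemma quad_le_trace_inv_mul {N B : Matrix ι ι ℝ} (hN : N.PosDef) (hB : B.PosSemidef) (v : ι → ℝ) :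
    v ⬝ᵥ B *ᵥ v ≤ (N⁻¹ * B).trace * (v ⬝ᵥ N *ᵥ v) := by
  obtain ⟨H, rfl⟩ := exists_eq_transpose_mul_self hB
  rw [dotProduct_transpose_mul_self_mulVec, trace_mul_transpose_mul_self, Finset.sum_mul]
  refine Finset.sum_le_sum fun k _ => ?_
  have := sq_dotProduct_le hN v (H k)
  rw [dotProduct_comm v (H k)] at this
  calc (H *ᵥ v) k * (H *ᵥ v) k = (H k ⬝ᵥ v) ^ 2 := by rw [sq]; rfl
    _ ≤ _ := by linarith

omit [DecidableEq ι] in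
lemma mulVec_dotProduct_self_le (A : Matrix κ ι ℝ) (v : ι → ℝ) :
    (A *ᵥ v) ⬝ᵥ (A *ᵥ v) ≤ (∑ i, ∑ j, A i j ^ 2) * (v ⬝ᵥ v) := by
  rw [Finset.sum_mul]
  refine Finset.sum_le_sum fun i _ => ?_
  have := Finset.sum_mul_sq_le_sq_mul_sq Finset.univ (A i) v
  calc (A *ᵥ v) i * (A *ᵥ v) i = (∑ j, A i j * v j) ^ 2 := by rw [sq]; rfl
    _ ≤ _ := this
    _ = _ := by simp only [dotProduct, sq]

omit [DecidableEq ι] in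
lemma abs_quad_le (A : Matrix ι ι ℝ) (v : ι → ℝ) :
    |v ⬝ᵥ A *ᵥ v| ≤ (∑ i, ∑ j, |A i j|) * (v ⬝ᵥ v) := by
  have h : ∀ i, v i * v i ≤ v ⬝ᵥ v := fun i =>
    Finset.single_le_sum (f := fun i => v i * v i) (fun i _ => mul_self_nonneg _)
      (Finset.mem_univ i)
  have e : v ⬝ᵥ A *ᵥ v = ∑ i, ∑ j, A i j * (v i * v j) := by
    simp only [dotProduct, mulVec, Finset.mul_sum]
    exact Finset.sum_congr rfl fun i _ => Finset.sum_congr rfl fun j _ => by ring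
  rw [e, Finset.sum_mul]
  refine (Finset.abs_sum_le_sum_abs _ _).trans (Finset.sum_le_sum fun i _ => ?_)
  rw [Finset.sum_mul]
  refine (Finset.abs_sum_le_sum_abs _ _).trans (Finset.sum_le_sum fun j _ => ?_)
  rw [abs_mul]
  refine mul_le_mul_of_nonneg_left ?_ (abs_nonneg _)
  rw [abs_le]
  constructor <;> nlinarith [h i, h j, sq_nonneg (v i + v j), sq_nonneg (v i - v j)]

omit [DecidableEq ι] in
lemma _root_.Matrix.PosDef.exists_pos_mul_le_quad {A : Matrix ι ι ℝ} (hA : A.PosDef) :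
    ∃ c > 0, ∀ v : ι → ℝ, c * (v ⬝ᵥ v) ≤ v ⬝ᵥ A *ᵥ v := by
  classical
  obtain ⟨B, hB⟩ := exists_eq_transpose_mul_self hA.posSemidef
  have hu : IsUnit B.det := by
    have := (isUnit_iff_isUnit_det _).1 hA.isUnit
    rw [hB, det_mul, det_transpose] at this
    exact isUnit_of_mul_isUnit_left this
  set F := ∑ i, ∑ j, (B⁻¹ i j) ^ 2 with hF
  have hF0 : 0 ≤ F := Finset.sum_nonneg fun i _ => Finset.sum_nonneg fun j _ => sq_nonneg _
  refine ⟨(F + 1)⁻¹, by positivity, fun v => ?_⟩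
  have h := mulVec_dotProduct_self_le B⁻¹ (B *ᵥ v)
  rw [mulVec_mulVec, nonsing_inv_mul _ hu, one_mulVec, ← hF,
    ← dotProduct_transpose_mul_self_mulVec, ← hB] at h
  have h0 := hA.posSemidef.quad_nonneg v
  rw [inv_mul_le_iff₀ (by positivity)]
  linarith

omit [DecidableEq ι] in
/-- Entrywise convergence to a positive definite limit is convergence of the quadratic forms up to
a factor tending to one, uniformly in the argument. -/
lemma eventually_quad_between {α : Type*} {l : Filter α} {A : α → Matrix ι ι ℝ}
    {A₀ : Matrix ι ι ℝ} (hA₀ : A₀.PosDef) (h : Tendsto A l (𝓝 A₀)) {η : ℝ} (hη : 0 < η) :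
    ∀ᶠ x in l, ∀ v, (1 - η) * (v ⬝ᵥ A₀ *ᵥ v) ≤ v ⬝ᵥ A x *ᵥ v ∧
      v ⬝ᵥ A x *ᵥ v ≤ (1 + η) * (v ⬝ᵥ A₀ *ᵥ v) := by
  obtain ⟨c, hc, hcv⟩ := hA₀.exists_pos_mul_le_quad
  have hcont : Continuous fun B : Matrix ι ι ℝ => ∑ i, ∑ j, |(B - A₀) i j| := by fun_prop
  have hlim := (hcont.tendsto A₀).comp h
  simp only [sub_self, Matrix.zero_apply, abs_zero, Finset.sum_const_zero] at hlim
  filter_upwards [hlim.eventually_lt_const (mul_pos hη hc)] with x hx v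
  have h1 := abs_quad_le (A x - A₀) v
  have hv : 0 ≤ v ⬝ᵥ v := Finset.sum_nonneg fun i _ => mul_self_nonneg _
  have h2 : |v ⬝ᵥ (A x - A₀) *ᵥ v| ≤ η * (v ⬝ᵥ A₀ *ᵥ v) := by
    refine h1.trans ((mul_le_mul_of_nonneg_right hx.le hv).trans ?_)
    rw [mul_assoc]
    exact mul_le_mul_of_nonneg_left (hcv v) hη.le
  rw [sub_mulVec, dotProduct_sub, abs_le] at h2
  constructor <;> linarith [h2.1, h2.2]

end

/-! ### Elimination of the corrections from the least squares problem -/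

section
variable {n d : ℕ}

/-- The inclusion of the coordinates in `J`, as a matrix. -/
def incl (J : Finset (Col n d)) : Matrix (Col n d) J ℝ :=
  (1 : Matrix (Col n d) (Col n d) ℝ).submatrix id Subtype.val

/-- Extension of a matrix on `J` by zero to all columns. -/
def extend (J : Finset (Col n d)) (A : Matrix J J ℝ) : Matrix (Col n d) (Col n d) ℝ :=
  incl J * A * (incl J)ᵀ

/-- The matrix `Zᵀ S Z`. -/
def gram (S : Matrix (Col n d) (Col n d) ℝ) (X : Matrix (Fin n) (Fin d) ℝ) :
    Matrix (Fin d) (Fin d) ℝ :=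
  (Z X)ᵀ * S * Z X

/-- The matrix `[I, X₀]`; the true rows are `[I, X₀]ᵀ a₀ᵢ`. -/
def truth (X₀ : Matrix (Fin n) (Fin d) ℝ) : Matrix (Fin n) (Col n d) ℝ := Matrix.fromCols 1 X₀

/-- `Z_J` has independent columns. -/
def Regular (J : Finset (Col n d)) (X : Matrix (Fin n) (Fin d) ℝ) : Prop :=
  Function.Injective (rowsIn J (Z X)).mulVec

/-- The reduced objective function `∑ᵢ cᵢᵀ Z (Zᵀ Sᵢ Z)⁻¹ Zᵀ cᵢ`. -/
noncomputable def objective (S : ℕ → Matrix (Col n d) (Col n d) ℝ) (c : ℕ → Col n d → ℝ) (m : ℕ)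
    (X : Matrix (Fin n) (Fin d) ℝ) : ℝ :=
  ∑ i ∈ Finset.range m, ((Z X)ᵀ *ᵥ c i) ⬝ᵥ (gram (S i) X)⁻¹ *ᵥ ((Z X)ᵀ *ᵥ c i)

lemma incl_transpose_mul {κ : Type*} (J : Finset (Col n d)) (M : Matrix (Col n d) κ ℝ) :
    (incl J)ᵀ * M = M.submatrix Subtype.val id := by
  rw [incl, transpose_submatrix, transpose_one]
  ext i j
  simp [Matrix.mul_apply, Matrix.one_apply]

lemma incl_mulVec_apply (J : Finset (Col n d)) (x : J → ℝ) (j : Col n d) :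
    (incl J *ᵥ x) j = if h : j ∈ J then x ⟨j, h⟩ else 0 := by
  simp only [incl, mulVec, dotProduct, submatrix_apply, id_eq, Matrix.one_apply]
  split_ifs with h
  · rw [Finset.sum_eq_single ⟨j, h⟩]
    · simp
    · intro b _ hb
      rw [if_neg, zero_mul]
      rintro rfl
      exact hb rfl
    · simp
  · refine Finset.sum_eq_zero fun b _ => ?_
    rw [if_neg, zero_mul]
    rintro rfl
    exact h b.2

lemma incl_transpose_mulVec (J : Finset (Col n d)) (x : Col n d → ℝ) :
    (incl J)ᵀ *ᵥ x = fun j : J => x j := by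
  ext j
  simp [incl, mulVec, dotProduct, Matrix.one_apply]

lemma extend_apply (J : Finset (Col n d)) (A : Matrix J J ℝ) (p q : Col n d) :
    extend J A p q = if h : p ∈ J ∧ q ∈ J then A ⟨p, h.1⟩ ⟨q, h.2⟩ else 0 := by
  have e : extend J A p q = (incl J *ᵥ fun a => (incl J *ᵥ fun b => A a b) q) p := by
    rw [extend, Matrix.mul_assoc]
    simp only [Matrix.mul_apply, mulVec, dotProduct, transpose_apply]
    exact Finset.sum_congr rfl fun a _ => congrArg _ (Finset.sum_congr rfl fun b _ => mul_comm _ _)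
  rw [e, incl_mulVec_apply]
  by_cases hp : p ∈ J <;> by_cases hq : q ∈ J <;> simp [incl_mulVec_apply, hp, hq]

lemma gram_extend (J : Finset (Col n d)) (A : Matrix J J ℝ) (X : Matrix (Fin n) (Fin d) ℝ) :
    gram (extend J A) X = (rowsIn J (Z X))ᵀ * A * rowsIn J (Z X) := by
  rw [gram, extend, rowsIn, ← incl_transpose_mul, transpose_mul, transpose_transpose]
  simp only [Matrix.mul_assoc]

lemma quad_extend (J : Finset (Col n d)) (A : Matrix J J ℝ) (v : Col n d → ℝ) :
    v ⬝ᵥ extend J A *ᵥ v = (fun j : J => v j) ⬝ᵥ A *ᵥ fun j : J => v j := by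
  have := dotProduct_transpose_mul_mul_mulVec (incl J)ᵀ A v
  rwa [transpose_transpose, incl_transpose_mulVec] at this

lemma quad_gram (S : Matrix (Col n d) (Col n d) ℝ) (X : Matrix (Fin n) (Fin d) ℝ)
    (v : Fin d → ℝ) : v ⬝ᵥ gram S X *ᵥ v = (Z X *ᵥ v) ⬝ᵥ S *ᵥ (Z X *ᵥ v) :=
  dotProduct_transpose_mul_mul_mulVec _ _ _

lemma gram_posDef {J : Finset (Col n d)} {A : Matrix J J ℝ} (hA : A.PosDef)
    {X : Matrix (Fin n) (Fin d) ℝ} (hX : Regular J X) : (gram (extend J A) X).PosDef := by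
  have := hA.conjTranspose_mul_mul_same hX
  rwa [conjTranspose_eq_transpose_of_trivial, ← gram_extend] at this

lemma extend_transpose {J : Finset (Col n d)} {A : Matrix J J ℝ} (hA : Aᵀ = A) :
    (extend J A)ᵀ = extend J A := by
  rw [extend, transpose_mul, transpose_mul, transpose_transpose, hA, Matrix.mul_assoc]

lemma truth_mul_Z (X₀ X : Matrix (Fin n) (Fin d) ℝ) : truth X₀ * Z X = X - X₀ := by
  rw [truth, Z, fromCols_mul_fromRows]
  simp [sub_eq_add_neg]

lemma Pa_mul_truth_transpose (X₀ : Matrix (Fin n) (Fin d) ℝ) : Pa n d * (truth X₀)ᵀ = 1 := by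
  rw [Pa, truth, transpose_fromCols, fromCols_mul_fromRows]
  simp

lemma Pa_mul (S : Matrix (Col n d) (Col n d) ℝ) :
    Pa n d * S = Matrix.fromCols S.toBlocks₁₁ S.toBlocks₁₂ := by
  conv_lhs => rw [← fromBlocks_toBlocks S, Pa, ← fromRows_fromCols_eq_fromBlocks,
    fromCols_mul_fromRows]
  simp

lemma Z_add (X H : Matrix (Fin n) (Fin d) ℝ) : Z (X + H) = Z X + (Pa n d)ᵀ * H := by
  rw [Z, Z, Pa, transpose_fromCols, fromRows_mul]
  ext i j
  rcases i with i | i <;> simp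

lemma regular_iff_rank (J : Finset (Col n d)) (X : Matrix (Fin n) (Fin d) ℝ) :
    (rowsIn J (Z X)).rank = d ↔ Regular J X := by
  rw [Regular, ← coe_mulVecLin, ← LinearMap.ker_eq_bot, ← Submodule.finrank_eq_zero, Matrix.rank]
  have := LinearMap.finrank_range_add_finrank_ker (rowsIn J (Z X)).mulVecLin
  rw [Module.finrank_fin_fun] at this
  omega

lemma regular_of_gram_det_ne_zero {J : Finset (Col n d)} {A : Matrix J J ℝ}
    {X : Matrix (Fin n) (Fin d) ℝ} (h : (gram (extend J A) X).det ≠ 0) : Regular J X := by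
  refine (injective_iff_map_eq_zero (rowsIn J (Z X)).mulVecLin).2 fun v hv => ?_
  by_contra hv0
  refine h (exists_mulVec_eq_zero_iff.1 ⟨v, hv0, ?_⟩)
  rw [gram_extend, ← mulVec_mulVec]
  simp only [mulVecLin_apply] at hv
  rw [hv, mulVec_zero]

section
variable {m : ℕ} {J : Finset (Col n d)}

open scoped MatrixOrder in
lemma norm_sq_inv_sqrt_mulVec {A : Matrix J J ℝ} (hA : A.PosDef) (x : J → ℝ) :
    ‖WithLp.toLp 2 ((CFC.sqrt A)⁻¹ *ᵥ x)‖ ^ 2 = x ⬝ᵥ A⁻¹ *ᵥ x := by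
  have hs : (CFC.sqrt A).PosSemidef := (CFC.sqrt_nonneg A).posSemidef
  have ht : ((CFC.sqrt A)⁻¹)ᵀ = (CFC.sqrt A)⁻¹ := by
    rw [transpose_nonsing_inv, hs.transpose_eq]
  rw [EuclideanSpace.real_norm_sq_eq]
  have e : ∑ i, ((CFC.sqrt A)⁻¹ *ᵥ x) i ^ 2 = ((CFC.sqrt A)⁻¹ *ᵥ x) ⬝ᵥ ((CFC.sqrt A)⁻¹ *ᵥ x) := by
    simp only [dotProduct, sq]
  change ∑ i, ((CFC.sqrt A)⁻¹ *ᵥ x) i ^ 2 = _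
  rw [e, ← dotProduct_transpose_mul_self_mulVec, ht, ← Matrix.mul_inv_rev,
    CFC.sqrt_mul_sqrt_self A hA.posSemidef.nonneg]

lemma cost_eq {Sig : ℕ → Matrix J J ℝ} (hSig : ∀ i, (Sig i).PosDef)
    (ΔC : Matrix (Fin m) (Col n d) ℝ) :
    cost Sig ΔC = ∑ i : Fin m, (fun j : J => ΔC i j) ⬝ᵥ (Sig i)⁻¹ *ᵥ fun j : J => ΔC i j :=
  Finset.sum_congr rfl fun i _ => norm_sq_inv_sqrt_mulVec (hSig i) _

lemma eqn_iff (D : Matrix (Fin m) (Col n d) ℝ) (X : Matrix (Fin n) (Fin d) ℝ) :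
    D.toCols₁ * X = D.toCols₂ ↔ ∀ i, (Z X)ᵀ *ᵥ D i = 0 := by
  have e : D * Z X = D.toCols₁ * X - D.toCols₂ := by
    conv_lhs => rw [← fromCols_toCols D, Z, fromCols_mul_fromRows]
    simp [sub_eq_add_neg]
  rw [← sub_eq_zero, ← e]
  constructor
  · intro h i
    have : (D * Z X) i = 0 := by rw [h]; rfl
    rw [mulVec_transpose]
    exact this
  · intro h
    ext i j
    have := congr_fun (h i) j
    rw [mulVec_transpose] at this
    exact this

lemma Z_transpose_mulVec_of_errorFree {x : Col n d → ℝ} (hx : ∀ j ∉ J, x j = 0)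
    (X : Matrix (Fin n) (Fin d) ℝ) :
    (Z X)ᵀ *ᵥ x = (rowsIn J (Z X))ᵀ *ᵥ fun j : J => x j := by
  have e : x = incl J *ᵥ fun j : J => x j := by
    ext j
    rw [incl_mulVec_apply]
    split_ifs with h
    · rfl
    · exact hx j h
  conv_lhs => rw [e]
  rw [mulVec_mulVec, rowsIn, ← incl_transpose_mul, transpose_mul, transpose_transpose]

/-- The reduced objective bounds the cost of feasible corrections from below. -/
lemma objective_le_cost {Sig : ℕ → Matrix J J ℝ} (hSig : ∀ i, (Sig i).PosDef) {c : ℕ → Col n d → ℝ}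
    {X : Matrix (Fin n) (Fin d) ℝ} {ΔC : Matrix (Fin m) (Col n d) ℝ}
    (h : Feasible J (Matrix.of fun i : Fin m => c i) X ΔC) :
    objective (fun i => extend J (Sig i)) c m X ≤ cost Sig ΔC := by
  have hX := (regular_iff_rank J X).1 h.rank_eq
  rw [objective, cost_eq hSig, ← Fin.sum_univ_eq_sum_range
    (fun i => ((Z X)ᵀ *ᵥ c i) ⬝ᵥ (gram (extend J (Sig i)) X)⁻¹ *ᵥ ((Z X)ᵀ *ᵥ c i))]
  refine Finset.sum_le_sum fun i _ => ?_
  have h1 := (eqn_iff _ X).1 h.eqn i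
  have h2 : (Z X)ᵀ *ᵥ c i = (rowsIn J (Z X))ᵀ *ᵥ fun j : J => ΔC i j := by
    rw [← Z_transpose_mulVec_of_errorFree (h.errorFree i)]
    have h3 : (Z X)ᵀ *ᵥ (c i - ΔC i) = 0 := h1
    rwa [mulVec_sub, sub_eq_zero] at h3
  set y := (Z X)ᵀ *ᵥ c i with hy
  have hN := gram_posDef (hSig i) hX
  set l := (gram (extend J (Sig i)) X)⁻¹ *ᵥ y with hl
  have key := dual_le_quad_inv (hSig i) (fun j : J => ΔC i j) (rowsIn J (Z X) *ᵥ l)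
  rw [mulVec_dotProduct_eq, ← h2, ← dotProduct_transpose_mul_mul_mulVec, ← gram_extend, hl,
    quad_inv_mulVec hN, dotProduct_comm] at key
  linarith

/-- The reduced objective is the cost of suitable feasible corrections. -/
lemma exists_feasible_cost_eq {Sig : ℕ → Matrix J J ℝ} (hSig : ∀ i, (Sig i).PosDef)
    (c : ℕ → Col n d → ℝ) {X : Matrix (Fin n) (Fin d) ℝ} (hX : Regular J X) :
    ∃ ΔC, Feasible J (Matrix.of fun i : Fin m => c i) X ΔC ∧
      cost Sig ΔC = objective (fun i => extend J (Sig i)) c m X := by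
  set l : ℕ → Fin d → ℝ := fun i => (gram (extend J (Sig i)) X)⁻¹ *ᵥ ((Z X)ᵀ *ᵥ c i) with hl
  set x : ℕ → J → ℝ := fun i => Sig i *ᵥ (rowsIn J (Z X) *ᵥ l i) with hx
  have hxJ : ∀ i, (fun j : J => (incl J *ᵥ x i) j) = x i := fun i => by
    ext j; rw [incl_mulVec_apply, dif_pos j.2]
  refine ⟨Matrix.of fun i : Fin m => incl J *ᵥ x i, ⟨?_, ?_, (regular_iff_rank J X).2 hX⟩, ?_⟩
  · refine (eqn_iff _ X).2 fun i => ?_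
    change (Z X)ᵀ *ᵥ (c i - incl J *ᵥ x i) = 0
    rw [mulVec_sub, Z_transpose_mulVec_of_errorFree (J := J) (x := incl J *ᵥ x i)
      (fun j hj => by rw [incl_mulVec_apply, dif_neg hj]), hxJ, hx]
    simp only
    rw [mulVec_mulVec, mulVec_mulVec, ← gram_extend, hl]
    simp only
    rw [mulVec_inv_mulVec (gram_posDef (hSig i) hX), sub_self]
  · intro i j hj
    rw [of_apply, incl_mulVec_apply, dif_neg hj]
  · rw [objective, cost_eq hSig, ← Fin.sum_univ_eq_sum_range
      (fun i => ((Z X)ᵀ *ᵥ c i) ⬝ᵥ (gram (extend J (Sig i)) X)⁻¹ *ᵥ ((Z X)ᵀ *ᵥ c i))]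
    refine Finset.sum_congr rfl fun i _ => ?_
    simp only [of_apply]
    rw [hxJ, hx]
    simp only
    have hu : (Sig i)⁻¹ *ᵥ (Sig i *ᵥ (rowsIn J (Z X) *ᵥ l i)) = rowsIn J (Z X) *ᵥ l i := by
      rw [mulVec_mulVec, nonsing_inv_mul _ ((isUnit_iff_isUnit_det _).1 (hSig i).isUnit),
        one_mulVec]
    rw [hu, dotProduct_comm, ← dotProduct_transpose_mul_mul_mulVec, ← gram_extend,
      quad_inv_mulVec (gram_posDef (hSig i) hX)]

/-- Solutions of the least squares problem are the minimisers of the reduced objective. -/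
lemma solves_iff {Sig : ℕ → Matrix J J ℝ} (hSig : ∀ i, (Sig i).PosDef) (c : ℕ → Col n d → ℝ)
    (X : Matrix (Fin n) (Fin d) ℝ) :
    Solves Sig (Matrix.of fun i : Fin m => c i) X ↔ Regular J X ∧ ∀ X', Regular J X' →
      objective (fun i => extend J (Sig i)) c m X ≤
        objective (fun i => extend J (Sig i)) c m X' := by
  constructor
  · rintro ⟨ΔC, hf, hmin⟩
    refine ⟨(regular_iff_rank J X).1 hf.rank_eq, fun X' hX' => ?_⟩
    obtain ⟨ΔC', hf', hc'⟩ := exists_feasible_cost_eq (m := m) hSig c hX'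
    exact (objective_le_cost hSig hf).trans ((hmin X' ΔC' hf').trans_eq hc')
  · rintro ⟨hX, hmin⟩
    obtain ⟨ΔC, hf, hc⟩ := exists_feasible_cost_eq (m := m) hSig c hX
    refine ⟨ΔC, hf, fun X' ΔC' hf' => ?_⟩
    rw [hc]
    exact (hmin X' ((regular_iff_rank J X').1 hf'.rank_eq)).trans (objective_le_cost hSig hf')

end
end

/-! ### Consistency -/

section

/-- Averages of terms dominated by nonnegative ones with weights that become uniformly small. -/
lemma tendsto_average_of_abs_le {α : Type*} {l : Filter α} {N : α → ℕ} (hN : Tendsto N l atTop)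
    {w k f : ℕ → α → ℝ} (hw : ∀ ε > 0, ∃ i₀, ∀ᶠ x in l, ∀ i ≥ i₀, |w i x| ≤ ε)
    (hw' : ∀ i, ∃ C, ∀ᶠ x in l, |w i x| ≤ C) (hk : ∀ i x, 0 ≤ k i x)
    {B : ℝ} (hB : ∀ᶠ x in l, 1 / (N x : ℝ) * ∑ i ∈ Finset.range (N x), k i x ≤ B)
    (hk0 : ∀ i, Tendsto (fun x => k i x / (N x : ℝ)) l (𝓝 0))
    (hf : ∀ i x, |f i x| ≤ w i x * k i x) :
    Tendsto (fun x => 1 / (N x : ℝ) * ∑ i ∈ Finset.range (N x), f i x) l (𝓝 0) := by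
  refine squeeze_zero_norm (fun x => ?_) (tendsto_weighted_average hN hw hw' hk hB hk0)
  rw [Real.norm_eq_abs, abs_mul, abs_of_nonneg (by positivity : (0 : ℝ) ≤ 1 / (N x : ℝ))]
  gcongr
  exact (Finset.abs_sum_le_sum_abs _ _).trans (Finset.sum_le_sum fun i _ => hf i x)

lemma tendsto_matrix_inv {α ι : Type*} [Fintype ι] [DecidableEq ι] {l : Filter α}
    {A : α → Matrix ι ι ℝ} {A₀ : Matrix ι ι ℝ} (h : Tendsto A l (𝓝 A₀)) (h0 : A₀.det ≠ 0) :
    Tendsto (fun x => (A x)⁻¹) l (𝓝 A₀⁻¹) := by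
  simp only [Matrix.inv_def, Ring.inverse_eq_inv']
  have h1 := ((continuous_id.matrix_det).tendsto A₀).comp h
  have h2 := ((continuous_id.matrix_adjugate).tendsto A₀).comp h
  exact (h1.inv₀ h0).smul h2

variable {n d : ℕ}

lemma dotProduct_inv_gram_eq_trace (c : Col n d → ℝ) (X : Matrix (Fin n) (Fin d) ℝ)
    (M : Matrix (Fin d) (Fin d) ℝ) :
    ((Z X)ᵀ *ᵥ c) ⬝ᵥ M *ᵥ ((Z X)ᵀ *ᵥ c) = (M * ((Z X)ᵀ * vecMulVec c c * Z X)).trace := by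
  rw [mul_vecMulVec, vecMulVec_mul, mul_vecMulVec, trace_vecMulVec, mulVec_transpose,
    dotProduct_comm]

/-- The limit `[I, X₀]ᵀ V [I, X₀] + σ² S_∞` of the averages of `cᵢcᵢᵀ`. -/
def momentLimit (V : Matrix (Fin n) (Fin n) ℝ) (X₀ : Matrix (Fin n) (Fin d) ℝ) (σ : ℝ)
    (S : Matrix (Col n d) (Col n d) ℝ) : Matrix (Col n d) (Col n d) ℝ :=
  (truth X₀)ᵀ * V * truth X₀ + σ ^ 2 • S

variable {J : Finset (Col n d)}

lemma momentLimit_posDef {V : Matrix (Fin n) (Fin n) ℝ} (hV : V.PosDef)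
    {X₀ : Matrix (Fin n) (Fin d) ℝ} (hX₀ : Regular J X₀) {σ : ℝ} (hσ : 0 < σ)
    {A : Matrix J J ℝ} (hA : A.PosDef) : (momentLimit V X₀ σ (extend J A)).PosDef := by
  have hq : ∀ v, v ⬝ᵥ momentLimit V X₀ σ (extend J A) *ᵥ v =
      (truth X₀ *ᵥ v) ⬝ᵥ V *ᵥ (truth X₀ *ᵥ v) +
        σ ^ 2 * ((fun j : J => v j) ⬝ᵥ A *ᵥ fun j : J => v j) := fun v => by
    rw [momentLimit, add_mulVec, dotProduct_add, dotProduct_transpose_mul_mul_mulVec,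
      smul_mulVec, dotProduct_smul, quad_extend, smul_eq_mul]
  refine .of_dotProduct_mulVec_pos ?_ fun v hv => ?_
  · rw [IsHermitian, conjTranspose_eq_transpose_of_trivial, momentLimit, transpose_add,
      transpose_smul, extend_transpose hA.posSemidef.transpose_eq, transpose_mul, transpose_mul,
      transpose_transpose, hV.posSemidef.transpose_eq, Matrix.mul_assoc]
  · rw [star_trivial, hq]
    have h1 := hV.posSemidef.quad_nonneg (truth X₀ *ᵥ v)
    have h2 := hA.posSemidef.quad_nonneg fun j : J => v j
    by_cases hJ : (fun j : J => v j) = 0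
    · -- a vector vanishing on `J` and annihilated by `[I, X₀]` is `Z₀ b` with `(Z₀)_J b = 0`
      have ht : truth X₀ *ᵥ v ≠ 0 := fun ht => hv <| by
        set b : Fin d → ℝ := fun k => - v (Sum.inr k) with hb
        have hvb : v = Z X₀ *ᵥ b := by
          ext j
          rcases j with j | j
          · have h3 := congr_fun ht j
            rw [truth, fromCols_mulVec, one_mulVec] at h3
            rw [Z, fromRows_mulVec, Sum.elim_inl]
            have : b = - (v ∘ Sum.inr) := rfl
            rw [this, mulVec_neg, Pi.neg_apply]
            simp only [Pi.add_apply, Function.comp_apply, Pi.zero_apply] at h3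
            linarith
          · simp [Z, hb, neg_mulVec]
        have h4 : rowsIn J (Z X₀) *ᵥ b = rowsIn J (Z X₀) *ᵥ 0 := by
          rw [mulVec_zero, ← hJ, hvb]
          rfl
        rw [hvb, hX₀ h4, mulVec_zero]
      have := hV.quad_pos ht
      positivity
    · have := hA.quad_pos hJ
      positivity

/-- The limiting objective exceeds its value `σ² d` at `X₀` by a quadratic form in `X - X₀`. -/
lemma trace_inv_gram_mul_momentLimit (V : Matrix (Fin n) (Fin n) ℝ)
    (X₀ X : Matrix (Fin n) (Fin d) ℝ) (σ : ℝ) {A : Matrix J J ℝ} (hA : A.PosDef)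
    (hX : Regular J X) :
    ((gram (extend J A) X)⁻¹ * ((Z X)ᵀ * momentLimit V X₀ σ (extend J A) * Z X)).trace =
      σ ^ 2 * d + ((gram (extend J A) X)⁻¹ * ((X - X₀)ᵀ * V * (X - X₀))).trace := by
  have e : (Z X)ᵀ * momentLimit V X₀ σ (extend J A) * Z X =
      (X - X₀)ᵀ * V * (X - X₀) + σ ^ 2 • gram (extend J A) X := by
    rw [momentLimit, ← truth_mul_Z X₀ X, transpose_mul, gram]
    simp only [Matrix.mul_add, Matrix.add_mul, Matrix.mul_assoc, Matrix.mul_smul, Matrix.smul_mul]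
  rw [e, Matrix.mul_add, trace_add, Matrix.mul_smul, nonsing_inv_mul _
    ((isUnit_iff_isUnit_det _).1 (gram_posDef hA hX).isUnit), trace_smul, trace_one]
  simp
  ring

/-- Lower bound for the reduced objective, in terms of the moments of the later rows. -/
lemma le_objective {Sig : ℕ → Matrix J J ℝ} (hSig : ∀ i, (Sig i).PosDef) {A : Matrix J J ℝ}
    (hA : A.PosDef) {c : ℕ → Col n d → ℝ} {m i₀ : ℕ} (hm : i₀ ≤ m) {η : ℝ} (hη : 0 < η)
    (hS : ∀ i ≥ i₀, ∀ v, v ⬝ᵥ Sig i *ᵥ v ≤ (1 + η) * (v ⬝ᵥ A *ᵥ v))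
    {K : Matrix (Col n d) (Col n d) ℝ}
    (hK : ∀ v, (1 - η) * (v ⬝ᵥ K *ᵥ v) ≤
      v ⬝ᵥ ((1 / (m : ℝ)) • ∑ i ∈ Finset.Ico i₀ m, vecMulVec (c i) (c i)) *ᵥ v)
    {X : Matrix (Fin n) (Fin d) ℝ} (hX : Regular J X) :
    (1 - η) * ((gram (extend J A) X)⁻¹ * ((Z X)ᵀ * K * Z X)).trace ≤
      (1 + η) * (1 / (m : ℝ) * objective (fun i => extend J (Sig i)) c m X) := by
  set M := (gram (extend J A) X)⁻¹ with hM
  have hNA := gram_posDef hA hX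
  have h1 : ∀ i ≥ i₀, (M * ((Z X)ᵀ * vecMulVec (c i) (c i) * Z X)).trace ≤
      (1 + η) * (((Z X)ᵀ *ᵥ c i) ⬝ᵥ (gram (extend J (Sig i)) X)⁻¹ *ᵥ ((Z X)ᵀ *ᵥ c i)) := by
    intro i hi
    rw [← dotProduct_inv_gram_eq_trace, hM]
    have hη1 : 0 < 1 + η := by linarith
    have := quad_inv_le_of_quad_le (gram_posDef (hSig i) hX) hNA hη1
      (fun v => by rw [quad_gram, quad_gram, quad_extend, quad_extend]; exact hS i hi _)
      ((Z X)ᵀ *ᵥ c i)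
    rwa [inv_mul_le_iff₀ hη1] at this
  have h2 : ∑ i ∈ Finset.Ico i₀ m, (M * ((Z X)ᵀ * vecMulVec (c i) (c i) * Z X)).trace ≤
      (1 + η) * objective (fun i => extend J (Sig i)) c m X := by
    rw [objective, ← Finset.sum_range_add_sum_Ico _ hm, mul_add, Finset.mul_sum (Finset.Ico i₀ m)]
    refine (Finset.sum_le_sum fun i hi => h1 i (Finset.mem_Ico.1 hi).1).trans
      (le_add_of_nonneg_left ?_)
    refine mul_nonneg (by linarith) (Finset.sum_nonneg fun i _ => ?_)
    exact (gram_posDef (hSig i) hX).inv.posSemidef.quad_nonneg _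
  have h3 := trace_mul_le_of_quad_le hNA.inv.posSemidef
    (A := (1 - η) • ((Z X)ᵀ * K * Z X))
    (B := (Z X)ᵀ * ((1 / (m : ℝ)) • ∑ i ∈ Finset.Ico i₀ m, vecMulVec (c i) (c i)) * Z X)
    (fun v => by
      rw [smul_mulVec, dotProduct_smul, dotProduct_transpose_mul_mul_mulVec,
        dotProduct_transpose_mul_mul_mulVec, smul_eq_mul]
      exact hK _)
  rw [← hM, Matrix.mul_smul, trace_smul, smul_eq_mul] at h3
  refine h3.trans ?_
  have e : (M * ((Z X)ᵀ * ((1 / (m : ℝ)) • ∑ i ∈ Finset.Ico i₀ m, vecMulVec (c i) (c i)) *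
      Z X)).trace =
      1 / (m : ℝ) * ∑ i ∈ Finset.Ico i₀ m, (M * ((Z X)ᵀ * vecMulVec (c i) (c i) * Z X)).trace := by
    rw [Matrix.mul_smul, Matrix.smul_mul, Matrix.mul_smul, trace_smul, Matrix.mul_sum,
      Matrix.sum_mul, Matrix.mul_sum, trace_sum, smul_eq_mul]
  rw [e, mul_left_comm (1 + η)]
  exact mul_le_mul_of_nonneg_left h2 (by positivity)

/-- Closeness of `X` to `X₀` from a small excess of the limiting objective. -/
lemma sub_entry_sq_le {V : Matrix (Fin n) (Fin n) ℝ} (hV : V.PosDef) (X₀ : Matrix (Fin n) (Fin d) ℝ)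
    {A : Matrix J J ℝ} (hA : A.PosDef) {ε : ℝ} (hε : 0 < ε) :
    ∃ ρ > 0, ∀ X, Regular J X →
      ((gram (extend J A) X)⁻¹ * ((X - X₀)ᵀ * V * (X - X₀))).trace ≤ ρ →
      ∀ p q, |X p q - X₀ p q| ≤ ε := by
  obtain ⟨a, ha, haV⟩ := hV.exists_pos_mul_le_quad
  set F := ∑ p, ∑ q, |extend J A p q| with hF
  set G := ∑ p, ∑ q, X₀ p q ^ 2 with hG
  have hF0 : 0 ≤ F := Finset.sum_nonneg fun _ _ => Finset.sum_nonneg fun _ _ => abs_nonneg _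
  have hG0 : 0 ≤ G := Finset.sum_nonneg fun _ _ => Finset.sum_nonneg fun _ _ => sq_nonneg _
  refine ⟨a * min 1 (ε ^ 2) / (4 * (F + 1) * (2 * G + 1)), by positivity, fun X hX h p q => ?_⟩
  set ρ := a * min 1 (ε ^ 2) / (4 * (F + 1) * (2 * G + 1)) with hρ
  have hρ0 : 0 ≤ ρ := by positivity
  set e : Fin d → ℝ := Pi.single q 1 with he
  have hN := gram_posDef hA hX
  have hsd : ((X - X₀)ᵀ * V * (X - X₀)).PosSemidef := by
    have := hV.posSemidef.conjTranspose_mul_mul_same (X - X₀)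
    rwa [conjTranspose_eq_transpose_of_trivial] at this
  have h1 := quad_le_trace_inv_mul hN hsd e
  have hgn := hN.posSemidef.quad_nonneg e
  have h2 := h1.trans (mul_le_mul_of_nonneg_right h hgn)
  rw [dotProduct_transpose_mul_mul_mulVec, quad_gram] at h2
  have h3 := haV ((X - X₀) *ᵥ e)
  have h4 := (le_abs_self _).trans (abs_quad_le (extend J A) (Z X *ᵥ e))
  set s := ((X - X₀) *ᵥ e) ⬝ᵥ ((X - X₀) *ᵥ e) with hs
  have hs0 : 0 ≤ s := Finset.sum_nonneg fun i _ => mul_self_nonneg _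
  have hee : e ⬝ᵥ e = 1 := by simp [he]
  have h5 : (Z X *ᵥ e) ⬝ᵥ (Z X *ᵥ e) ≤ 2 * s + (2 * G + 1) := by
    have hX0 := mulVec_dotProduct_self_le X₀ e
    rw [hee, mul_one, ← hG] at hX0
    have hsplit : (Z X *ᵥ e) ⬝ᵥ (Z X *ᵥ e) = (X *ᵥ e) ⬝ᵥ (X *ᵥ e) + e ⬝ᵥ e := by
      rw [Z, fromRows_mulVec, neg_mulVec, one_mulVec]
      simp only [dotProduct, Fintype.sum_sum_type, Sum.elim_inl, Sum.elim_inr, Pi.neg_apply,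
        neg_mul_neg]
    rw [hsplit, hee]
    have hXe : X *ᵥ e = (X - X₀) *ᵥ e + X₀ *ᵥ e := by rw [← add_mulVec, sub_add_cancel]
    have h6 : (X *ᵥ e) ⬝ᵥ (X *ᵥ e) ≤ 2 * s + 2 * ((X₀ *ᵥ e) ⬝ᵥ (X₀ *ᵥ e)) := by
      rw [hXe, hs]
      simp only [dotProduct, Finset.mul_sum, ← Finset.sum_add_distrib, Pi.add_apply]
      refine Finset.sum_le_sum fun i _ => ?_
      nlinarith [sq_nonneg (((X - X₀) *ᵥ e) i - (X₀ *ᵥ e) i)]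
    linarith
  rw [← hF] at h4
  have h6 : a * s ≤ ρ * (F * (2 * s + (2 * G + 1))) := by
    refine h3.trans (h2.trans (mul_le_mul_of_nonneg_left (h4.trans ?_) hρ0))
    exact mul_le_mul_of_nonneg_left h5 hF0
  have h7 : ρ * (4 * (F + 1) * (2 * G + 1)) = a * min 1 (ε ^ 2) := by
    rw [hρ]; field_simp
  have hmin1 : min 1 (ε ^ 2) ≤ 1 := min_le_left _ _
  have hmin2 : min 1 (ε ^ 2) ≤ ε ^ 2 := min_le_right _ _
  have hρF : 4 * (ρ * F) ≤ a := by
    have h71 : 4 * (ρ * F) ≤ ρ * (4 * (F + 1) * (2 * G + 1)) := by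
      nlinarith [mul_nonneg hρ0 hF0, mul_nonneg hρ0 hG0, mul_nonneg (mul_nonneg hρ0 hF0) hG0]
    nlinarith
  have hρF2 : 4 * (ρ * F * (2 * G + 1)) ≤ a * ε ^ 2 := by
    have h71 : 4 * (ρ * F * (2 * G + 1)) ≤ ρ * (4 * (F + 1) * (2 * G + 1)) := by
      nlinarith [mul_nonneg hρ0 hF0, mul_nonneg hρ0 hG0, mul_nonneg (mul_nonneg hρ0 hF0) hG0]
    nlinarith
  have h8 : s ≤ ε ^ 2 := by
    have h9 : 2 * (ρ * F) * s ≤ a / 2 * s := mul_le_mul_of_nonneg_right (by linarith) hs0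
    have h10 : a * s ≤ a * ε ^ 2 := by nlinarith
    exact le_of_mul_le_mul_left h10 ha
  have h9 : (X p q - X₀ p q) ^ 2 ≤ s := by
    have e1 : ((X - X₀) *ᵥ e) p = X p q - X₀ p q := by simp [he]
    rw [← e1, sq, hs]
    exact Finset.single_le_sum (f := fun i => ((X - X₀) *ᵥ e) i * ((X - X₀) *ᵥ e) i)
      (fun i _ => mul_self_nonneg _) (Finset.mem_univ p)
  exact abs_le_of_sq_le_sq (h9.trans h8) hε.le

end

section
variable {n d : ℕ} {J : Finset (Col n d)} {α : Type*}

/-- The law of large numbers for the observed rows `cᵢ`, along a filter `l` on sample points `x`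
with sample sizes `N x`: the averages of `cᵢcᵢᵀ` converge to `[I, X₀]ᵀ V [I, X₀] + σ² S_∞`, single
rows are negligible, and the covariance structure `Σᵢ → Σ_∞` and the true parameter `X₀` are
nondegenerate. -/
structure RowLLN (l : Filter α) (N : α → ℕ) (c : ℕ → α → Col n d → ℝ) (Sig : ℕ → Matrix J J ℝ)
    (SigInf : Matrix J J ℝ) (V : Matrix (Fin n) (Fin n) ℝ) (X₀ : Matrix (Fin n) (Fin d) ℝ)
    (σ : ℝ) : Prop where
  size : Tendsto N l atTop
  sig_posDef : ∀ i, (Sig i).PosDef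
  sigInf_posDef : SigInf.PosDef
  sig_tendsto : Tendsto Sig atTop (𝓝 SigInf)
  V_posDef : V.PosDef
  regular : Regular J X₀
  sigma_pos : 0 < σ
  moment : Tendsto (fun x => (1 / (N x : ℝ)) •
    ∑ i ∈ Finset.range (N x), vecMulVec (c i x) (c i x)) l
    (𝓝 (momentLimit V X₀ σ (extend J SigInf)))
  head : ∀ i, Tendsto (fun x => (c i x ⬝ᵥ c i x) / (N x : ℝ)) l (𝓝 0)

variable {l : Filter α} {N : α → ℕ} {c : ℕ → α → Col n d → ℝ} {Sig : ℕ → Matrix J J ℝ}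
  {SigInf : Matrix J J ℝ} {V : Matrix (Fin n) (Fin n) ℝ} {X₀ : Matrix (Fin n) (Fin d) ℝ} {σ : ℝ}

lemma continuous_extend (J : Finset (Col n d)) : Continuous (extend J) := by
  unfold extend
  fun_prop

lemma continuous_gram_left (X : Matrix (Fin n) (Fin d) ℝ) :
    Continuous fun S : Matrix (Col n d) (Col n d) ℝ => gram S X := by
  unfold gram
  fun_prop

lemma continuous_Z : Continuous (Z : Matrix (Fin n) (Fin d) ℝ → Matrix (Col n d) (Fin d) ℝ) := by
  refine continuous_pi fun i => continuous_pi fun j => ?_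
  rcases i with i | i
  · simp only [Z, fromRows_apply_inl]
    fun_prop
  · simp only [Z, fromRows_apply_inr]
    fun_prop

lemma continuous_gram_right (S : Matrix (Col n d) (Col n d) ℝ) :
    Continuous fun X : Matrix (Fin n) (Fin d) ℝ => gram S X := by
  have := continuous_Z (n := n) (d := d)
  unfold gram
  fun_prop

lemma eventually_regular {X : Matrix (Fin n) (Fin d) ℝ} (hX : Regular J X) :
    ∀ᶠ X' in 𝓝 X, Regular J X' := by
  have h1 : Continuous fun X : Matrix (Fin n) (Fin d) ℝ =>
      (gram (extend J (1 : Matrix J J ℝ)) X).det := (continuous_gram_right _).matrix_det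
  exact (h1.continuousAt.eventually_ne (gram_posDef PosDef.one hX).det_pos.ne').mono
    fun X' => regular_of_gram_det_ne_zero

lemma dotProduct_self_nonneg {ι : Type*} [Fintype ι] (v : ι → ℝ) : 0 ≤ v ⬝ᵥ v :=
  Finset.sum_nonneg fun _ _ => mul_self_nonneg _

lemma abs_mul_le_dotProduct_self {ι : Type*} [Fintype ι] (v : ι → ℝ) (p q : ι) :
    |v p * v q| ≤ v ⬝ᵥ v := by
  have hs : ∀ r, v r * v r ≤ v ⬝ᵥ v := fun r =>
    Finset.single_le_sum (f := fun r => v r * v r) (fun _ _ => mul_self_nonneg _)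
      (Finset.mem_univ r)
  rw [abs_le]
  constructor <;> nlinarith [hs p, hs q, sq_nonneg (v p + v q), sq_nonneg (v p - v q)]

namespace RowLLN
variable (h : RowLLN l N c Sig SigInf V X₀ σ)
include h

lemma exists_bound : ∃ B, ∀ᶠ x in l,
    1 / (N x : ℝ) * ∑ i ∈ Finset.range (N x), c i x ⬝ᵥ c i x ≤ B := by
  have h1 := ((continuous_id.matrix_trace).tendsto _).comp h.moment
  refine ⟨_, (h1.eventually_le_const (lt_add_one _)).mono fun x hx => le_trans (le_of_eq ?_) hx⟩
  simp only [Function.comp_apply, id_eq, trace_smul, trace_sum, trace_vecMulVec, smul_eq_mul]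

lemma extend_tendsto : Tendsto (fun i => extend J (Sig i)) atTop (𝓝 (extend J SigInf)) :=
  ((continuous_extend J).tendsto SigInf).comp h.sig_tendsto

lemma tendsto_objective_truth : Tendsto (fun x => 1 / (N x : ℝ) *
    objective (fun i => extend J (Sig i)) (fun i => c i x) (N x) X₀) l (𝓝 (σ ^ 2 * d)) := by
  set Si := extend J SigInf with hS
  set B : Matrix (Fin d) (Fin d) ℝ → Matrix (Col n d) (Col n d) ℝ := fun M => Z X₀ * M * (Z X₀)ᵀ
    with hB
  have hBq : ∀ M v, ((Z X₀)ᵀ *ᵥ v) ⬝ᵥ M *ᵥ ((Z X₀)ᵀ *ᵥ v) = v ⬝ᵥ B M *ᵥ v := fun M v => by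
    rw [← dotProduct_transpose_mul_mul_mulVec, transpose_transpose]
  set M : ℕ → Matrix (Fin d) (Fin d) ℝ := fun i => (gram (extend J (Sig i)) X₀)⁻¹ with hM
  set Mi := (gram Si X₀)⁻¹ with hMi_def
  have hNi := gram_posDef h.sigInf_posDef h.regular
  have hMlim : Tendsto M atTop (𝓝 Mi) :=
    tendsto_matrix_inv (((continuous_gram_left X₀).tendsto _).comp h.extend_tendsto)
      (hNi.det_pos.ne')
  set w : ℕ → ℝ := fun i => ∑ p, ∑ q, |(B (M i) - B Mi) p q| with hw
  have hwlim : Tendsto w atTop (𝓝 0) := by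
    have hc : Continuous fun M' => ∑ p, ∑ q, |(B M' - B Mi) p q| := by
      simp only [hB]
      fun_prop
    have e0 : ∑ p, ∑ q, |(B Mi - B Mi) p q| = 0 := by
      rw [sub_self]
      simp only [Matrix.zero_apply, abs_zero, Finset.sum_const_zero]
    have := (hc.tendsto Mi).comp hMlim
    rwa [e0] at this
  obtain ⟨K, hK⟩ := h.exists_bound
  have hdiff := tendsto_average_of_abs_le h.size (w := fun i _ => w i)
    (k := fun i x => c i x ⬝ᵥ c i x) (f := fun i x => c i x ⬝ᵥ (B (M i) - B Mi) *ᵥ c i x)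
    (fun ε hε => by
      obtain ⟨i₀, hi₀⟩ := eventually_atTop.1 (hwlim.eventually (Metric.closedBall_mem_nhds 0 hε))
      exact ⟨i₀, Eventually.of_forall fun _ i hi => by simpa using hi₀ i hi⟩)
    (fun i => ⟨|w i|, Eventually.of_forall fun _ => le_rfl⟩)
    (fun i x => dotProduct_self_nonneg _) hK h.head
    (fun i x => abs_quad_le _ _)
  have hmain : Tendsto (fun x => (Mi * ((Z X₀)ᵀ * ((1 / (N x : ℝ)) •
      ∑ i ∈ Finset.range (N x), vecMulVec (c i x) (c i x)) * Z X₀)).trace) l (𝓝 (σ ^ 2 * d)) := by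
    have hc : Continuous fun K : Matrix (Col n d) (Col n d) ℝ =>
        (Mi * ((Z X₀)ᵀ * K * Z X₀)).trace := by fun_prop
    have := (hc.tendsto _).comp h.moment
    rwa [hMi_def, trace_inv_gram_mul_momentLimit V X₀ X₀ σ h.sigInf_posDef h.regular, sub_self,
      Matrix.mul_zero, Matrix.mul_zero, trace_zero, add_zero] at this
  have hsum := hdiff.add hmain
  rw [zero_add] at hsum
  refine hsum.congr fun x => ?_
  rw [Matrix.mul_smul, Matrix.smul_mul, Matrix.mul_smul, trace_smul, Matrix.mul_sum,
    Matrix.sum_mul, Matrix.mul_sum, trace_sum, smul_eq_mul, ← mul_add, ← Finset.sum_add_distrib,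
    objective]
  congr 1
  refine Finset.sum_congr rfl fun i _ => ?_
  rw [← dotProduct_inv_gram_eq_trace, hBq, hBq, sub_mulVec, dotProduct_sub, sub_add_cancel]

lemma tendsto_tail (i₀ : ℕ) : Tendsto (fun x => (1 / (N x : ℝ)) •
    ∑ i ∈ Finset.Ico i₀ (N x), vecMulVec (c i x) (c i x)) l
    (𝓝 (momentLimit V X₀ σ (extend J SigInf))) := by
  have h1 : Tendsto (fun x => (1 / (N x : ℝ)) •
      ∑ i ∈ Finset.range i₀, vecMulVec (c i x) (c i x)) l (𝓝 0) := by
    refine tendsto_pi_nhds.2 fun p => tendsto_pi_nhds.2 fun q => ?_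
    have h2 : Tendsto (fun x => ∑ i ∈ Finset.range i₀, (c i x ⬝ᵥ c i x) / (N x : ℝ)) l (𝓝 0) := by
      simpa using tendsto_finsetSum (Finset.range i₀) fun i _ => h.head i
    refine squeeze_zero_norm (fun x => ?_) h2
    rw [Matrix.smul_apply, Matrix.sum_apply, smul_eq_mul, Finset.mul_sum]
    refine (norm_sum_le _ _).trans (Finset.sum_le_sum fun i _ => ?_)
    rw [Real.norm_eq_abs, abs_mul, abs_of_nonneg (by positivity : (0 : ℝ) ≤ 1 / (N x : ℝ)),
      one_div_mul_eq_div, vecMulVec_apply]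
    gcongr
    exact abs_mul_le_dotProduct_self _ p q
  have h2 := h.moment.sub h1
  rw [sub_zero] at h2
  refine h2.congr' ?_
  filter_upwards [h.size.eventually_ge_atTop i₀] with x hx
  rw [← smul_sub, ← Finset.sum_range_add_sum_Ico _ hx, add_sub_cancel_left]

/-- **Consistency**: eventually, every parameter that does at least as well as the true one is close
to it. -/
theorem eventually_abs_sub_le {ε : ℝ} (hε : 0 < ε) : ∀ᶠ x in l, ∀ X, Regular J X →
    objective (fun i => extend J (Sig i)) (fun i => c i x) (N x) X ≤
      objective (fun i => extend J (Sig i)) (fun i => c i x) (N x) X₀ →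
    ∀ p q, |X p q - X₀ p q| ≤ ε := by
  obtain ⟨ρ, hρ, hρX⟩ := sub_entry_sq_le h.V_posDef X₀ h.sigInf_posDef hε
  obtain ⟨η, hη, hη1, hηρ⟩ : ∃ η : ℝ, 0 < η ∧ η < 1 ∧
      (1 + η) * (σ ^ 2 * d + η) ≤ (1 - η) * (σ ^ 2 * d + ρ) := by
    have hlim : Tendsto (fun η : ℝ => (1 - η) * (σ ^ 2 * d + ρ) - (1 + η) * (σ ^ 2 * d + η))
        (𝓝[>] 0) (𝓝 ((1 - 0) * (σ ^ 2 * d + ρ) - (1 + 0) * (σ ^ 2 * d + 0))) := by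
      refine Tendsto.mono_left (Continuous.tendsto ?_ 0) nhdsWithin_le_nhds
      fun_prop
    have h1 := hlim.eventually_const_lt (u := 0) (by linarith)
    have h2 : ∀ᶠ η : ℝ in 𝓝[>] 0, η < 1 :=
      (eventually_lt_nhds zero_lt_one).filter_mono nhdsWithin_le_nhds
    obtain ⟨η, h3, h4, h5⟩ := (h1.and (h2.and self_mem_nhdsWithin)).exists
    exact ⟨η, h5, h4, by linarith⟩
  obtain ⟨i₀, hi₀⟩ := eventually_atTop.1
    (eventually_quad_between h.sigInf_posDef h.sig_tendsto hη)
  have hKpos := momentLimit_posDef h.V_posDef h.regular h.sigma_pos h.sigInf_posDef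
  filter_upwards [h.size.eventually_ge_atTop i₀,
    eventually_quad_between hKpos (h.tendsto_tail i₀) hη,
    h.tendsto_objective_truth.eventually_le_const (lt_add_of_pos_right _ hη)] with x h1 h2 h3
    X hX hle
  refine hρX X hX ?_
  have key := le_objective h.sig_posDef h.sigInf_posDef h1 hη (fun i hi v => (hi₀ i hi v).2)
    (fun v => (h2 v).1) hX
  rw [trace_inv_gram_mul_momentLimit V X₀ X σ h.sigInf_posDef hX] at key
  have h4 : 1 / (N x : ℝ) * objective (fun i => extend J (Sig i)) (fun i => c i x) (N x) X ≤
      σ ^ 2 * d + η := (mul_le_mul_of_nonneg_left hle (by positivity)).trans h3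
  have h5 := key.trans ((mul_le_mul_of_nonneg_left h4 (by linarith)).trans hηρ)
  have h6 := le_of_mul_le_mul_left h5 (by linarith)
  linarith

omit h in
lemma regular_near (hX₀ : Regular J X₀) :
    ∃ ε > 0, ∀ X : Matrix (Fin n) (Fin d) ℝ, (∀ p q, |X p q - X₀ p q| ≤ ε) → Regular J X := by
  -- the topology of matrices is that of functions of two indices, which carry the sup distance
  have h1 : ∀ᶠ X in @nhds (Fin n → Fin d → ℝ) _ X₀, Regular J X := eventually_regular hX₀
  obtain ⟨ε, hε, hball⟩ := Metric.nhds_basis_closedBall.eventually_iff.1 h1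
  refine ⟨ε, hε, fun X hX => hball ?_⟩
  exact Metric.mem_closedBall.2
    ((dist_pi_le_iff hε.le).2 fun p => (dist_pi_le_iff hε.le).2 fun q => hX p q)

omit h in
lemma continuousAt_objective_term {A : Matrix J J ℝ} (hA : A.PosDef) (y : Col n d → ℝ)
    {X : Matrix (Fin n) (Fin d) ℝ} (hX : Regular J X) :
    ContinuousAt (fun X => ((Z X)ᵀ *ᵥ y) ⬝ᵥ (gram (extend J A) X)⁻¹ *ᵥ ((Z X)ᵀ *ᵥ y)) X := by
  have hZ : Continuous fun X : Matrix (Fin n) (Fin d) ℝ => (Z X)ᵀ *ᵥ y :=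
    continuous_Z.matrix_transpose.matrix_mulVec continuous_const
  have hinv : ContinuousAt (fun X => (gram (extend J A) X)⁻¹) X :=
    tendsto_matrix_inv ((continuous_gram_right _).tendsto X) (gram_posDef hA hX).det_pos.ne'
  have hcont : Continuous fun p : (Fin d → ℝ) × Matrix (Fin d) (Fin d) ℝ =>
      p.1 ⬝ᵥ p.2 *ᵥ p.1 :=
    Continuous.dotProduct continuous_fst (continuous_snd.matrix_mulVec continuous_fst)
  exact ContinuousAt.comp (f := fun X => ((Z X)ᵀ *ᵥ y, (gram (extend J A) X)⁻¹))
    hcont.continuousAt (hZ.continuousAt.prodMk hinv)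

omit h in
lemma continuousOn_objective (hSig : ∀ i, (Sig i).PosDef) (c : ℕ → Col n d → ℝ) (m : ℕ)
    {s : Set (Matrix (Fin n) (Fin d) ℝ)} (hs : ∀ X ∈ s, Regular J X) :
    ContinuousOn (objective (fun i => extend J (Sig i)) c m) s := fun X hX =>
  ContinuousAt.continuousWithinAt (tendsto_finsetSum (Finset.range m) fun i _ =>
    continuousAt_objective_term (hSig i) (c i) (hs X hX))

/-- A minimiser of the objective exists eventually. -/
theorem eventually_exists_minimiser : ∀ᶠ x in l, ∃ X, Regular J X ∧ ∀ X', Regular J X' →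
    objective (fun i => extend J (Sig i)) (fun i => c i x) (N x) X ≤
      objective (fun i => extend J (Sig i)) (fun i => c i x) (N x) X' := by
  obtain ⟨ε, hε, hreg⟩ := regular_near h.regular
  filter_upwards [h.eventually_abs_sub_le hε] with x hx
  let s : Set (Matrix (Fin n) (Fin d) ℝ) := {X | ∀ p q, |X p q - X₀ p q| ≤ ε}
  have hsc : IsCompact s := by
    have e : s = Set.pi Set.univ fun p : Fin n => Set.pi Set.univ fun q : Fin d =>
        Set.Icc (X₀ p q - ε) (X₀ p q + ε) := by
      refine Set.Subset.antisymm (fun X hX p _ q _ => ?_) fun X hX p q => ?_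
      · have := abs_le.1 (hX p q)
        exact ⟨by linarith, by linarith⟩
      · have := hX p trivial q trivial
        exact abs_le.2 ⟨by linarith [this.1], by linarith [this.2]⟩
    have hc : IsCompact (Set.pi Set.univ fun p : Fin n => Set.pi Set.univ fun q : Fin d =>
        Set.Icc (X₀ p q - ε) (X₀ p q + ε)) :=
      isCompact_univ_pi fun p => isCompact_univ_pi fun q => isCompact_Icc
    rw [e]
    exact hc
  have h0 : X₀ ∈ s := fun p q => by simp [hε.le]
  obtain ⟨X, hXs, hXmin⟩ := hsc.exists_isMinOn ⟨X₀, h0⟩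
    (continuousOn_objective h.sig_posDef (fun i => c i x) (N x) fun X hX => hreg X hX)
  refine ⟨X, hreg X hXs, fun X' hX' => ?_⟩
  rcases le_total (objective (fun i => extend J (Sig i)) (fun i => c i x) (N x) X')
    (objective (fun i => extend J (Sig i)) (fun i => c i x) (N x) X₀) with h1 | h1
  · exact hXmin (hx X' hX' h1)
  · exact (hXmin h0).trans h1

end RowLLN
end

/-! ### The score -/

section
variable {n d : ℕ} {J : Finset (Col n d)}

/-- The left factor `P_a - P_a S Z (Zᵀ S Z)⁻¹ Zᵀ` of the score. -/
noncomputable def scoreLeft (S : Matrix (Col n d) (Col n d) ℝ) (X : Matrix (Fin n) (Fin d) ℝ) :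
    Matrix (Fin n) (Col n d) ℝ :=
  Pa n d - Pa n d * S * Z X * (gram S X)⁻¹ * (Z X)ᵀ

/-- The right factor `Z (Zᵀ S Z)⁻¹` of the score. -/
noncomputable def scoreRight (S : Matrix (Col n d) (Col n d) ℝ) (X : Matrix (Fin n) (Fin d) ℝ) :
    Matrix (Col n d) (Fin d) ℝ :=
  Z X * (gram S X)⁻¹

/-- The score: half the gradient in `X` of `trace ((Zᵀ S Z)⁻¹ Zᵀ K Z)`. -/
noncomputable def score (S : Matrix (Col n d) (Col n d) ℝ) (X : Matrix (Fin n) (Fin d) ℝ)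
    (K : Matrix (Col n d) (Col n d) ℝ) : Matrix (Fin n) (Fin d) ℝ :=
  scoreLeft S X * K * scoreRight S X

lemma score_sub (S : Matrix (Col n d) (Col n d) ℝ) (X : Matrix (Fin n) (Fin d) ℝ)
    (K L : Matrix (Col n d) (Col n d) ℝ) : score S X (K - L) = score S X K - score S X L := by
  simp only [score, Matrix.mul_sub, Matrix.sub_mul]

lemma score_add (S : Matrix (Col n d) (Col n d) ℝ) (X : Matrix (Fin n) (Fin d) ℝ)
    (K L : Matrix (Col n d) (Col n d) ℝ) : score S X (K + L) = score S X K + score S X L := by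
  simp only [score, Matrix.mul_add, Matrix.add_mul]

lemma score_smul (S : Matrix (Col n d) (Col n d) ℝ) (X : Matrix (Fin n) (Fin d) ℝ) (r : ℝ)
    (K : Matrix (Col n d) (Col n d) ℝ) : score S X (r • K) = r • score S X K := by
  simp only [score, Matrix.mul_smul, Matrix.smul_mul]

lemma score_apply (S : Matrix (Col n d) (Col n d) ℝ) (X : Matrix (Fin n) (Fin d) ℝ)
    (K : Matrix (Col n d) (Col n d) ℝ) (k : Fin n) (j : Fin d) :
    score S X K k j = ∑ p, ∑ q, scoreLeft S X k p * scoreRight S X q j * K p q := by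
  rw [score, Matrix.mul_assoc, Matrix.mul_apply]
  refine Finset.sum_congr rfl fun p _ => ?_
  rw [Matrix.mul_apply, Finset.mul_sum]
  exact Finset.sum_congr rfl fun q _ => by ring

/-- The score is unbiased for the error covariance. -/
lemma score_self {S : Matrix (Col n d) (Col n d) ℝ} {X : Matrix (Fin n) (Fin d) ℝ}
    (h : (gram S X).det ≠ 0) : score S X S = 0 := by
  have e : gram S X * (gram S X)⁻¹ = 1 := mul_nonsing_inv _ h.isUnit
  have e2 : (Z X)ᵀ * S * (Z X * (gram S X)⁻¹) = 1 := by
    rw [← Matrix.mul_assoc]; exact e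
  rw [score, scoreLeft, scoreRight, Matrix.sub_mul, Matrix.sub_mul]
  rw [Matrix.mul_assoc _ (Z X)ᵀ S, Matrix.mul_assoc _ ((Z X)ᵀ * S), e2, Matrix.mul_one,
    ← Matrix.mul_assoc, sub_self]

lemma scoreLeft_mul_truth_transpose (S : Matrix (Col n d) (Col n d) ℝ)
    (X X₀ : Matrix (Fin n) (Fin d) ℝ) : scoreLeft S X * (truth X₀)ᵀ =
      1 - Pa n d * S * Z X * (gram S X)⁻¹ * (X - X₀)ᵀ := by
  rw [scoreLeft, Matrix.sub_mul, Pa_mul_truth_transpose, Matrix.mul_assoc _ (Z X)ᵀ,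
    ← transpose_mul, truth_mul_Z]

lemma truth_mul_scoreRight (S : Matrix (Col n d) (Col n d) ℝ)
    (X X₀ : Matrix (Fin n) (Fin d) ℝ) : truth X₀ * scoreRight S X =
      (X - X₀) * (gram S X)⁻¹ := by
  rw [scoreRight, ← Matrix.mul_assoc, truth_mul_Z]

/-- The score of the limiting moment matrix, which vanishes at `X₀`. -/
lemma score_momentLimit (V : Matrix (Fin n) (Fin n) ℝ) (X₀ X : Matrix (Fin n) (Fin d) ℝ) (σ : ℝ)
    {S : Matrix (Col n d) (Col n d) ℝ} (h : (gram S X).det ≠ 0) :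
    score S X (momentLimit V X₀ σ S) =
      (1 - Pa n d * S * Z X * (gram S X)⁻¹ * (X - X₀)ᵀ) * V * ((X - X₀) * (gram S X)⁻¹) := by
  rw [momentLimit, score_add, score_smul, score_self h, smul_zero, add_zero, score,
    ← scoreLeft_mul_truth_transpose, ← truth_mul_scoreRight]
  simp only [Matrix.mul_assoc]

/-- At the true parameter, the score of an observed row `[I, X₀]ᵀ a + e` is linear in the pair
`(a eᵀ, e eᵀ - s S)`. -/
lemma score_truth {S : Matrix (Col n d) (Col n d) ℝ} {X₀ : Matrix (Fin n) (Fin d) ℝ}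
    (h : (gram S X₀).det ≠ 0) (a : Fin n → ℝ) (e : Col n d → ℝ) (s : ℝ) :
    score S X₀ (vecMulVec ((truth X₀)ᵀ *ᵥ a + e) ((truth X₀)ᵀ *ᵥ a + e)) =
      vecMulVec a e * scoreRight S X₀ +
        scoreLeft S X₀ * (vecMulVec e e - s • S) * scoreRight S X₀ := by
  have h1 : scoreLeft S X₀ *ᵥ ((truth X₀)ᵀ *ᵥ a) = a := by
    rw [mulVec_mulVec, scoreLeft_mul_truth_transpose, sub_self, transpose_zero, Matrix.mul_zero,
      sub_zero, one_mulVec]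
  have h2 : ((truth X₀)ᵀ *ᵥ a) ᵥ* scoreRight S X₀ = 0 := by
    rw [mulVec_transpose, vecMul_vecMul, truth_mul_scoreRight, sub_self, Matrix.zero_mul,
      vecMul_zero]
  have h3 : scoreLeft S X₀ * (vecMulVec e e - s • S) * scoreRight S X₀ =
      score S X₀ (vecMulVec e e) := by
    have := score_sub S X₀ (vecMulVec e e) (s • S)
    rw [score_smul, score_self h, smul_zero, sub_zero] at this
    exact this
  rw [h3, score, score, mul_vecMulVec, vecMulVec_mul, mul_vecMulVec, vecMulVec_mul, vecMulVec_mul,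
    mulVec_add, add_vecMul, h1, h2, zero_add, add_vecMulVec]

/-- `Γ` is the linear form of `score_truth`, up to the factor `Zᵀ S Z`. -/
lemma Gam_mul_inv (S : Matrix (Col n d) (Col n d) ℝ)
    (g : Matrix (Fin n) (Col n d) ℝ × Matrix (Col n d) (Col n d) ℝ)
    (X : Matrix (Fin n) (Fin d) ℝ) :
    Gam S g X * (gram S X)⁻¹ =
      g.1 * scoreRight S X + scoreLeft S X * g.2 * scoreRight S X := by
  rw [Gam, ← Pa_mul, scoreLeft, scoreRight, ← gram]
  simp only [Matrix.sub_mul, Matrix.add_mul, Matrix.mul_assoc]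
  abel

end

section
variable {E ι κ τ : Type*} [NormedAddCommGroup E] [NormedSpace ℝ E]

lemma contDiffAt_entry_mul [Fintype κ] {F : E → Matrix ι κ ℝ} {G : E → Matrix κ τ ℝ} {x : E}
    (hF : ∀ i j, ContDiffAt ℝ 1 (fun y => F y i j) x)
    (hG : ∀ i j, ContDiffAt ℝ 1 (fun y => G y i j) x) (i : ι) (j : τ) :
    ContDiffAt ℝ 1 (fun y => (F y * G y) i j) x := by
  simp only [Matrix.mul_apply]
  exact ContDiffAt.sum fun k _ => (hF i k).mul (hG k j)

lemma contDiffAt_det [Fintype ι] [DecidableEq ι] {F : E → Matrix ι ι ℝ} {x : E}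
    (hF : ∀ i j, ContDiffAt ℝ 1 (fun y => F y i j) x) :
    ContDiffAt ℝ 1 (fun y => (F y).det) x := by
  simp only [Matrix.det_apply']
  exact ContDiffAt.sum fun s _ => contDiffAt_const.mul (contDiffAt_prod fun i _ => hF _ _)

lemma contDiffAt_entry_inv [Fintype ι] [DecidableEq ι] {F : E → Matrix ι ι ℝ} {x : E}
    (hF : ∀ i j, ContDiffAt ℝ 1 (fun y => F y i j) x) (h0 : (F x).det ≠ 0) (i j : ι) :
    ContDiffAt ℝ 1 (fun y => (F y)⁻¹ i j) x := by
  simp only [Matrix.inv_def, Ring.inverse_eq_inv', Matrix.smul_apply, smul_eq_mul,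
    Matrix.adjugate_apply]
  refine ((contDiffAt_det hF).inv h0).mul (contDiffAt_det fun a b => ?_)
  by_cases hab : a = j
  · subst hab
    simp only [updateRow_self]
    exact contDiffAt_const
  · simp only [updateRow_ne hab]
    exact hF a b

end

section
variable {n d : ℕ}

/-- The coefficients of the score are differentiable in `X` at `X₀`, uniformly for covariance
structures near `S₀`. -/
lemma exists_score_coeff_deriv {S₀ : Matrix (Col n d) (Col n d) ℝ} {X₀ : Matrix (Fin n) (Fin d) ℝ}
    (h : (gram S₀ X₀).det ≠ 0) (k : Fin n) (p q : Col n d) (j : Fin d) :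
    ∃ L : (Fin n → Fin d → ℝ) →L[ℝ] ℝ, ∀ ε > 0,
      ∃ U ∈ 𝓝 S₀, ∀ᶠ X in 𝓝 X₀, ∀ S ∈ U,
        |scoreLeft S X k p * scoreRight S X q j - scoreLeft S X₀ k p * scoreRight S X₀ q j
          - L (fun a b => X a b - X₀ a b)| ≤ ε * ‖fun a b => X a b - X₀ a b‖ := by
  let s : (Col n d → Col n d → ℝ) × (Fin n → Fin d → ℝ) → Matrix (Col n d) (Col n d) ℝ :=
    fun y => Matrix.of y.1
  let x : (Col n d → Col n d → ℝ) × (Fin n → Fin d → ℝ) → Matrix (Fin n) (Fin d) ℝ :=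
    fun y => Matrix.of y.2
  let y₀ : (Col n d → Col n d → ℝ) × (Fin n → Fin d → ℝ) := (fun a b => S₀ a b, fun a b => X₀ a b)
  have hs : ∀ a b, ContDiffAt ℝ 1 (fun y => s y a b) y₀ := fun a b => by
    simp only [s, Matrix.of_apply]
    fun_prop
  have hZ : ∀ a b, ContDiffAt ℝ 1 (fun y => Z (x y) a b) y₀ := fun a b => by
    rcases a with a | a
    · simp only [Z, fromRows_apply_inl, x, Matrix.of_apply]
      fun_prop
    · simp only [Z, fromRows_apply_inr]
      exact contDiffAt_const
  have hZt : ∀ a b, ContDiffAt ℝ 1 (fun y => (Z (x y))ᵀ a b) y₀ := fun a b => hZ b a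
  have hM : ∀ a b, ContDiffAt ℝ 1 (fun y => (gram (s y) (x y))⁻¹ a b) y₀ :=
    contDiffAt_entry_inv (contDiffAt_entry_mul (contDiffAt_entry_mul hZt hs) hZ) h
  have hP : ∀ a b, ContDiffAt ℝ 1
      (fun _ : (Col n d → Col n d → ℝ) × (Fin n → Fin d → ℝ) => Pa n d a b) y₀ :=
    fun a b => contDiffAt_const
  have hR : ContDiffAt ℝ 1 (fun y => scoreRight (s y) (x y) q j) y₀ :=
    contDiffAt_entry_mul hZ hM q j
  have hL : ContDiffAt ℝ 1 (fun y => scoreLeft (s y) (x y) k p) y₀ :=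
    (hP k p).sub (contDiffAt_entry_mul (contDiffAt_entry_mul (contDiffAt_entry_mul
      (contDiffAt_entry_mul hP hs) hZ) hM) hZt k p)
  obtain ⟨f', hf'⟩ : ∃ f', HasStrictFDerivAt
      (fun y => scoreLeft (s y) (x y) k p * scoreRight (s y) (x y) q j) f' y₀ :=
    ⟨_, (hL.mul hR).hasStrictFDerivAt one_ne_zero⟩
  refine ⟨f'.comp (ContinuousLinearMap.inr ℝ _ _), fun ε hε => ?_⟩
  have h1 := (hasStrictFDerivAt_iff_isLittleO.1 hf').def hε
  have hc : Tendsto (fun z : (Col n d → Col n d → ℝ) × (Fin n → Fin d → ℝ) =>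
      ((z.1, z.2), (z.1, fun a b => X₀ a b))) (𝓝 y₀) (𝓝 (y₀, y₀)) :=
    Continuous.tendsto' (by fun_prop) _ _ rfl
  have h2 := hc.eventually h1
  rw [nhds_prod_eq, eventually_prod_iff] at h2
  obtain ⟨pa, ha, pb, hb, hab⟩ := h2
  have h3 : ∀ (S : Col n d → Col n d → ℝ) (X : Fin n → Fin d → ℝ), pa S → pb X →
      |scoreLeft (Matrix.of S) (Matrix.of X) k p * scoreRight (Matrix.of S) (Matrix.of X) q j -
        scoreLeft (Matrix.of S) X₀ k p * scoreRight (Matrix.of S) X₀ q j -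
          f' (0, fun a b => X a b - X₀ a b)| ≤ ε * ‖fun a b => X a b - X₀ a b‖ := by
    intro S X hS hX
    have h4 := hab hS hX
    have e : (((S, X), (S, fun a b => X₀ a b)) :
        ((Col n d → Col n d → ℝ) × (Fin n → Fin d → ℝ)) × _).1 -
        (((S, X), (S, fun a b => X₀ a b)) :
        ((Col n d → Col n d → ℝ) × (Fin n → Fin d → ℝ)) × _).2 =
        ((0 : Col n d → Col n d → ℝ), fun a b => X a b - X₀ a b) :=
      Prod.ext (sub_self S) rfl
    have e2 : ‖((0 : Col n d → Col n d → ℝ), fun a b => X a b - X₀ a b)‖ =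
        ‖fun a b => X a b - X₀ a b‖ := by
      rw [Prod.norm_def, norm_zero]
      exact max_eq_right (norm_nonneg _)
    rw [e, e2] at h4
    exact h4
  exact ⟨{S | pa S}, ha, hb.mono fun X hX S hS => h3 S X hS hX⟩

end

/-! ### The score equation -/

section
variable {n d : ℕ} {J : Finset (Col n d)}

/-- The increment of the quadratic form `y · N⁻¹ y`, without second order terms to be estimated. -/
lemma dotProduct_inv_mulVec_sub {N N' : Matrix (Fin d) (Fin d) ℝ} (hN : N.det ≠ 0)
    (hN' : N'.det ≠ 0) (hs' : N'ᵀ = N') (y y' : Fin d → ℝ) :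
    y' ⬝ᵥ N'⁻¹ *ᵥ y' - y ⬝ᵥ N⁻¹ *ᵥ y =
      (N'⁻¹ *ᵥ y') ⬝ᵥ (y' - y) + (N⁻¹ *ᵥ y) ⬝ᵥ (y' - y) -
        (N'⁻¹ *ᵥ y') ⬝ᵥ (N' - N) *ᵥ (N⁻¹ *ᵥ y) := by
  have h1 : N *ᵥ (N⁻¹ *ᵥ y) = y := by
    rw [mulVec_mulVec, mul_nonsing_inv _ hN.isUnit, one_mulVec]
  have h2 : N' *ᵥ (N'⁻¹ *ᵥ y') = y' := by
    rw [mulVec_mulVec, mul_nonsing_inv _ hN'.isUnit, one_mulVec]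
  rw [sub_mulVec, h1, dotProduct_sub, dotProduct_sub, dotProduct_sub]
  have h3 : (N'⁻¹ *ᵥ y') ⬝ᵥ N' *ᵥ (N⁻¹ *ᵥ y) = y' ⬝ᵥ N⁻¹ *ᵥ y := by
    rw [dotProduct_mulVec, ← mulVec_transpose, hs', h2]
  rw [h3, dotProduct_comm y', dotProduct_comm y, dotProduct_comm y']
  ring

lemma gram_add_smul {S : Matrix (Col n d) (Col n d) ℝ} (X H : Matrix (Fin n) (Fin d) ℝ) (t : ℝ) :
    gram S (X + t • H) - gram S X = t • (Hᵀ * (Pa n d * S * Z X) + (Z X)ᵀ * S * (Pa n d)ᵀ * H +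
      t • (Hᵀ * (Pa n d * S * (Pa n d)ᵀ * H))) := by
  rw [gram, gram, Z_add, transpose_add, transpose_mul, transpose_transpose]
  simp only [transpose_smul, Matrix.add_mul, Matrix.mul_add, Matrix.smul_mul, Matrix.mul_smul,
    smul_add, Matrix.mul_assoc]
  abel

lemma continuousAt_multiplier {A : Matrix J J ℝ} (hA : A.PosDef) (y : Col n d → ℝ)
    {X : Matrix (Fin n) (Fin d) ℝ} (hX : Regular J X) :
    ContinuousAt (fun X => (gram (extend J A) X)⁻¹ *ᵥ ((Z X)ᵀ *ᵥ y)) X := by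
  have hZ : Continuous fun X : Matrix (Fin n) (Fin d) ℝ => (Z X)ᵀ *ᵥ y :=
    continuous_Z.matrix_transpose.matrix_mulVec continuous_const
  have hinv : ContinuousAt (fun X => (gram (extend J A) X)⁻¹) X :=
    tendsto_matrix_inv ((continuous_gram_right _).tendsto X) (gram_posDef hA hX).det_pos.ne'
  have hcont : Continuous fun p : Matrix (Fin d) (Fin d) ℝ × (Fin d → ℝ) => p.1 *ᵥ p.2 :=
    continuous_fst.matrix_mulVec continuous_snd
  exact ContinuousAt.comp (f := fun X => ((gram (extend J A) X)⁻¹, (Z X)ᵀ *ᵥ y))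
    hcont.continuousAt (hinv.prodMk hZ.continuousAt)

/-- The limit of the difference quotients of the form `y · N⁻¹ y` along a line. -/
lemma tendsto_increment {v : ℝ → Fin d → ℝ} {u : Fin d → ℝ} (hv : Tendsto v (𝓝 0) (𝓝 u))
    (h : Fin d → ℝ) (Q R : Matrix (Fin d) (Fin d) ℝ) :
    Tendsto (fun t => v t ⬝ᵥ h + u ⬝ᵥ h - v t ⬝ᵥ (Q + t • R) *ᵥ u) (𝓝 0)
      (𝓝 (u ⬝ᵥ h + u ⬝ᵥ h - u ⬝ᵥ Q *ᵥ u)) := by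
  have h3 : Continuous fun p : (Fin d → ℝ) × ℝ =>
      p.1 ⬝ᵥ h + u ⬝ᵥ h - p.1 ⬝ᵥ (Q + p.2 • R) *ᵥ u := by fun_prop
  have h4 : Tendsto (fun t : ℝ => (v t, t)) (𝓝 0) (𝓝 (u, 0)) := hv.prodMk_nhds tendsto_id
  have h5 := (h3.tendsto (u, 0)).comp h4
  simp only [zero_smul, add_zero] at h5
  exact h5

/-- The directional derivative of a summand of the objective is given by the score. -/
lemma hasDerivAt_objective_term {A : Matrix J J ℝ} (hA : A.PosDef) (c : Col n d → ℝ)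
    {X : Matrix (Fin n) (Fin d) ℝ} (hX : Regular J X) (H : Matrix (Fin n) (Fin d) ℝ) :
    HasDerivAt (fun t : ℝ => ((Z (X + t • H))ᵀ *ᵥ c) ⬝ᵥ
        (gram (extend J A) (X + t • H))⁻¹ *ᵥ ((Z (X + t • H))ᵀ *ᵥ c))
      (2 * ((H *ᵥ ((gram (extend J A) X)⁻¹ *ᵥ ((Z X)ᵀ *ᵥ c))) ⬝ᵥ
        (scoreLeft (extend J A) X *ᵥ c))) 0 := by
  have hSs : (extend J A)ᵀ = extend J A := extend_transpose hA.posSemidef.transpose_eq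
  have hp := gram_posDef hA hX
  have hpathT : Tendsto (fun t : ℝ => X + t • H) (𝓝 0) (𝓝 X) := by
    have hpath : Continuous fun t : ℝ => X + t • H := by fun_prop
    have := hpath.tendsto 0
    rwa [zero_smul, add_zero] at this
  have hreg := hpathT.eventually (eventually_regular hX)
  have hvT := (continuousAt_multiplier hA c hX).tendsto.comp hpathT
  have hpd : ∀ᶠ t in 𝓝 (0 : ℝ), (gram (extend J A) (X + t • H)).PosDef :=
    hreg.mono fun t ht => gram_posDef hA ht
  generalize extend J A = S at *
  set u := (gram S X)⁻¹ *ᵥ ((Z X)ᵀ *ᵥ c) with hu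
  set h : Fin d → ℝ := Hᵀ *ᵥ (Pa n d *ᵥ c) with hh
  have hlim := tendsto_increment hvT h
    (Hᵀ * (Pa n d * S * Z X) + (Z X)ᵀ * S * (Pa n d)ᵀ * H) (Hᵀ * (Pa n d * S * (Pa n d)ᵀ * H))
  have e1 : u ⬝ᵥ h = (H *ᵥ u) ⬝ᵥ (Pa n d *ᵥ c) := by
    rw [hh, dotProduct_mulVec, vecMul_transpose]
  have e2 : scoreLeft S X *ᵥ c = Pa n d *ᵥ c - (Pa n d * S * Z X) *ᵥ u := by
    rw [scoreLeft, sub_mulVec, hu]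
    simp only [mulVec_mulVec, Matrix.mul_assoc]
  have e3 : u ⬝ᵥ (Hᵀ * (Pa n d * S * Z X)) *ᵥ u = (H *ᵥ u) ⬝ᵥ ((Pa n d * S * Z X) *ᵥ u) := by
    rw [← mulVec_mulVec, dotProduct_mulVec, vecMul_transpose]
  have e4 : (Z X)ᵀ * S * (Pa n d)ᵀ * H = (Hᵀ * (Pa n d * S * Z X))ᵀ := by
    simp only [transpose_mul, transpose_transpose, hSs, Matrix.mul_assoc]
  have e5 : u ⬝ᵥ ((Z X)ᵀ * S * (Pa n d)ᵀ * H) *ᵥ u =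
      (H *ᵥ u) ⬝ᵥ ((Pa n d * S * Z X) *ᵥ u) := by
    rw [e4, mulVec_transpose, dotProduct_comm, ← dotProduct_mulVec, e3]
  have e6 : u ⬝ᵥ h + u ⬝ᵥ h - u ⬝ᵥ (Hᵀ * (Pa n d * S * Z X) + (Z X)ᵀ * S * (Pa n d)ᵀ * H) *ᵥ u =
      2 * ((H *ᵥ u) ⬝ᵥ (scoreLeft S X *ᵥ c)) := by
    rw [add_mulVec, dotProduct_add, e1, e2, e3, e5, dotProduct_sub]
    ring
  rw [e6] at hlim
  rw [hasDerivAt_iff_tendsto_slope_zero]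
  refine (hlim.mono_left nhdsWithin_le_nhds).congr' ?_
  filter_upwards [hpd.filter_mono nhdsWithin_le_nhds, self_mem_nhdsWithin] with t ht ht0
  have ht0' : t ≠ 0 := ht0
  have hy : (Z (X + t • H))ᵀ *ᵥ c - (Z X)ᵀ *ᵥ c = t • h := by
    rw [Z_add, transpose_add, add_mulVec, add_sub_cancel_left, transpose_mul,
      transpose_transpose, transpose_smul, ← mulVec_mulVec, smul_mulVec]
  simp only [Function.comp_apply, zero_add, zero_smul, add_zero]
  rw [dotProduct_inv_mulVec_sub hp.det_pos.ne' ht.det_pos.ne' ht.posSemidef.transpose_eq, hy,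
    gram_add_smul, smul_mulVec, dotProduct_smul, dotProduct_smul, dotProduct_smul]
  simp only [smul_eq_mul]
  field_simp
  rw [hu]

/-- The score vanishes at a minimiser of the objective. -/
theorem sum_score_eq_zero {Sig : ℕ → Matrix J J ℝ} (hSig : ∀ i, (Sig i).PosDef)
    (c : ℕ → Col n d → ℝ) (m : ℕ) {X : Matrix (Fin n) (Fin d) ℝ} (hX : Regular J X)
    (hmin : ∀ X', Regular J X' → objective (fun i => extend J (Sig i)) c m X ≤
      objective (fun i => extend J (Sig i)) c m X') :
    ∑ i ∈ Finset.range m, score (extend J (Sig i)) X (vecMulVec (c i) (c i)) = 0 := by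
  ext k j
  have hder := HasDerivAt.fun_sum fun i (_ : i ∈ Finset.range m) =>
    hasDerivAt_objective_term (hSig i) (c i) hX (Matrix.single k j 1)
  have hpathT : Tendsto (fun t : ℝ => X + t • Matrix.single k j 1) (𝓝 0) (𝓝 X) := by
    have hpath : Continuous fun t : ℝ => X + t • Matrix.single k j (1 : ℝ) := by fun_prop
    have := hpath.tendsto 0
    rwa [zero_smul, add_zero] at this
  have hloc : IsLocalMin (fun t : ℝ => objective (fun i => extend J (Sig i)) c m
      (X + t • Matrix.single k j 1)) 0 := by
    filter_upwards [hpathT.eventually (eventually_regular hX)] with t ht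
    rw [zero_smul, add_zero]
    exact hmin _ ht
  have h0 := hloc.hasDerivAt_eq_zero hder
  rw [← Finset.mul_sum] at h0
  rw [Matrix.sum_apply, Matrix.zero_apply,
    ← (mul_eq_zero.1 h0).resolve_left two_ne_zero]
  refine Finset.sum_congr rfl fun i _ => ?_
  have hM := inv_transpose_eq (gram_posDef (hSig i) hX)
  have e1 : c i ᵥ* scoreRight (extend J (Sig i)) X =
      (gram (extend J (Sig i)) X)⁻¹ *ᵥ ((Z X)ᵀ *ᵥ c i) := by
    rw [scoreRight, ← mulVec_transpose, transpose_mul, hM, ← mulVec_mulVec]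
  have e2 : ∀ u : Fin d → ℝ, Matrix.single k j (1 : ℝ) *ᵥ u = Pi.single k (u j) := fun u => by
    rw [single_mulVec, one_mul]; rfl
  rw [score, mul_vecMulVec, vecMulVec_mul, e1, vecMulVec_apply, e2, single_dotProduct, mul_comm]

end

/-! ### Asymptotic expansion of a consistent zero of the score -/

section
variable {n d : ℕ} {J : Finset (Col n d)} {α : Type*}
variable {l : Filter α} {N : α → ℕ} {c : ℕ → α → Col n d → ℝ} {Sig : ℕ → Matrix J J ℝ}
  {SigInf : Matrix J J ℝ} {V : Matrix (Fin n) (Fin n) ℝ} {X₀ : Matrix (Fin n) (Fin d) ℝ} {σ : ℝ}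

/-- The deviation `X - X₀` as an element of the normed space of functions of two indices. -/
def dev (X₀ X : Matrix (Fin n) (Fin d) ℝ) : Fin n → Fin d → ℝ := fun a b => X a b - X₀ a b

lemma abs_sub_le_norm_dev (X₀ X : Matrix (Fin n) (Fin d) ℝ) (a : Fin n) (b : Fin d) :
    |(X - X₀) a b| ≤ ‖dev X₀ X‖ :=
  (norm_le_pi_norm (dev X₀ X a) b).trans (norm_le_pi_norm (dev X₀ X) a)

lemma isBigO_sub_entry (Xh : α → Matrix (Fin n) (Fin d) ℝ) (a : Fin n) (b : Fin d) :
    (fun x => (Xh x - X₀) a b) =O[l] fun x => ‖dev X₀ (Xh x)‖ :=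
  Asymptotics.isBigO_of_le _ fun x => by
    rw [norm_norm]; exact abs_sub_le_norm_dev X₀ (Xh x) a b

/-- An approximation up to an error that is negligible relative to the scale itself is one up to an
error negligible relative to the approximant. -/
lemma isLittleO_one_add_norm {F : Type*} [NormedAddCommGroup F] {Y U : α → F}
    (h : (fun x => Y x + U x) =o[l] fun x => 1 + ‖Y x‖) :
    (fun x => Y x + U x) =o[l] fun x => 1 + ‖U x‖ := by
  refine h.trans_isBigO (Asymptotics.IsBigO.of_bound 3 ?_)
  filter_upwards [h.def (c := 1 / 2) (by norm_num)] with x hx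
  have h0 : ∀ z : F, ‖1 + ‖z‖‖ = 1 + ‖z‖ := fun z => by
    rw [Real.norm_eq_abs, abs_of_nonneg (by positivity)]
  rw [h0] at hx
  rw [h0, h0]
  have h1 : ‖Y x‖ ≤ ‖Y x + U x‖ + ‖U x‖ := by
    simpa using norm_sub_le (Y x + U x) (U x)
  linarith [norm_nonneg (U x)]

namespace RowLLN
variable (h : RowLLN l N c Sig SigInf V X₀ σ)
include h

/-- Replacing `Σᵢ` by `Σ_∞` in the increments of the score is negligible relative to the deviation
of the parameter. -/
lemma isLittleO_coeff {Xh : α → Matrix (Fin n) (Fin d) ℝ} (hX : Tendsto Xh l (𝓝 X₀))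
    (k : Fin n) (p q : Col n d) (j : Fin d) :
    ∃ L : (Fin n → Fin d → ℝ) →L[ℝ] ℝ,
      (fun x => scoreLeft (extend J SigInf) (Xh x) k p * scoreRight (extend J SigInf) (Xh x) q j -
        scoreLeft (extend J SigInf) X₀ k p * scoreRight (extend J SigInf) X₀ q j -
          L (dev X₀ (Xh x))) =o[l] (fun x => ‖dev X₀ (Xh x)‖) ∧
      (fun x => 1 / (N x : ℝ) * ∑ i ∈ Finset.range (N x),
        (scoreLeft (extend J (Sig i)) (Xh x) k p * scoreRight (extend J (Sig i)) (Xh x) q j -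
        scoreLeft (extend J (Sig i)) X₀ k p * scoreRight (extend J (Sig i)) X₀ q j -
          L (dev X₀ (Xh x))) * (c i x p * c i x q)) =o[l] (fun x => ‖dev X₀ (Xh x)‖) := by
  obtain ⟨L, hL⟩ := exists_score_coeff_deriv
    (gram_posDef h.sigInf_posDef h.regular).det_pos.ne' k p q j
  refine ⟨L, ?_, ?_⟩
  · refine Asymptotics.isLittleO_iff.2 fun ε hε => ?_
    obtain ⟨U, hU, hev⟩ := hL ε hε
    refine (hX.eventually hev).mono fun x hx => ?_
    rw [norm_norm]
    exact hx _ (mem_of_mem_nhds hU)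
  set w : ℕ → α → ℝ := fun i x =>
    scoreLeft (extend J (Sig i)) (Xh x) k p * scoreRight (extend J (Sig i)) (Xh x) q j -
      scoreLeft (extend J (Sig i)) X₀ k p * scoreRight (extend J (Sig i)) X₀ q j -
      L (dev X₀ (Xh x)) with hw
  obtain ⟨K, hK⟩ := h.exists_bound
  have hT := tendsto_average_of_abs_le h.size (w := fun i x => |w i x| / ‖dev X₀ (Xh x)‖)
    (k := fun i x => c i x ⬝ᵥ c i x)
    (f := fun i x => w i x / ‖dev X₀ (Xh x)‖ * (c i x p * c i x q))
    (fun ε hε => by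
      obtain ⟨U, hU, hev⟩ := hL ε hε
      obtain ⟨i₀, hi₀⟩ := eventually_atTop.1 (h.extend_tendsto.eventually hU)
      refine ⟨i₀, (hX.eventually hev).mono fun x hx i hi => ?_⟩
      rw [abs_div, abs_abs, abs_norm]
      exact div_le_of_le_mul₀ (norm_nonneg _) hε.le (hx _ (hi₀ i hi)))
    (fun i => by
      obtain ⟨Li, hLi⟩ := exists_score_coeff_deriv
        (gram_posDef (h.sig_posDef i) h.regular).det_pos.ne' k p q j
      obtain ⟨U, hU, hev⟩ := hLi 1 one_pos
      refine ⟨1 + ‖Li‖ + ‖L‖, (hX.eventually hev).mono fun x hx => ?_⟩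
      rw [abs_div, abs_abs, abs_norm]
      refine div_le_of_le_mul₀ (norm_nonneg _) (by positivity) ?_
      have h1 := hx _ (mem_of_mem_nhds hU)
      have h2 := Li.le_opNorm (dev X₀ (Xh x))
      have h3 := L.le_opNorm (dev X₀ (Xh x))
      have h4 : w i x = (scoreLeft (extend J (Sig i)) (Xh x) k p *
          scoreRight (extend J (Sig i)) (Xh x) q j -
          scoreLeft (extend J (Sig i)) X₀ k p * scoreRight (extend J (Sig i)) X₀ q j -
          Li (dev X₀ (Xh x))) + Li (dev X₀ (Xh x)) - L (dev X₀ (Xh x)) := by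
        rw [hw]; ring
      rw [h4, add_mul, add_mul]
      refine (abs_sub _ _).trans (add_le_add ((abs_add_le _ _).trans (add_le_add h1 h2)) h3))
    (fun i x => dotProduct_self_nonneg _) hK h.head
    (fun i x => by
      rw [abs_mul, abs_div, abs_norm]
      exact mul_le_mul_of_nonneg_left (abs_mul_le_dotProduct_self _ _ _) (by positivity))
  refine (Asymptotics.isLittleO_iff_tendsto fun x hx => ?_).2 (hT.congr fun x => ?_)
  · have hD : dev X₀ (Xh x) = 0 := norm_eq_zero.1 hx
    have hXX : Xh x = X₀ := by
      ext a b
      exact sub_eq_zero.1 (congrFun (congrFun hD a) b)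
    rw [hXX] at hD
    simp [hXX, hD]
  · rw [mul_div_assoc, Finset.sum_div]
    congr 1
    exact Finset.sum_congr rfl fun i _ => by ring

/-- The averaged increment of the score is `V (X - X₀) (Z₀ᵀ S_∞ Z₀)⁻¹` to first order. -/
lemma isLittleO_score_increment {Xh : α → Matrix (Fin n) (Fin d) ℝ} (hX : Tendsto Xh l (𝓝 X₀))
    (k : Fin n) (j : Fin d) :
    (fun x => 1 / (N x : ℝ) * ∑ i ∈ Finset.range (N x),
        (score (extend J (Sig i)) (Xh x) (vecMulVec (c i x) (c i x)) k j -
          score (extend J (Sig i)) X₀ (vecMulVec (c i x) (c i x)) k j) -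
      (V * (Xh x - X₀) * (gram (extend J SigInf) X₀)⁻¹) k j) =o[l]
      fun x => ‖dev X₀ (Xh x)‖ := by
  set K := momentLimit V X₀ σ (extend J SigInf) with hK
  set S := extend J SigInf with hS
  have hN₀ := gram_posDef h.sigInf_posDef h.regular
  choose L hL1 hL2 using fun p q => h.isLittleO_coeff hX k p q j
  -- the limit of the averages
  have hKd : ∀ p q, Tendsto (fun x => 1 / (N x : ℝ) * ∑ i ∈ Finset.range (N x),
      c i x p * c i x q - K p q) l (𝓝 0) := fun p q => by
    have h1 := tendsto_pi_nhds.1 (tendsto_pi_nhds.1 h.moment p) q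
    have h2 := h1.sub_const (K p q)
    rw [sub_self] at h2
    refine h2.congr fun x => ?_
    rw [Matrix.smul_apply, Matrix.sum_apply, smul_eq_mul]
    simp only [vecMulVec_apply]
  have hA : (fun x => 1 / (N x : ℝ) * ∑ i ∈ Finset.range (N x),
        (score (extend J (Sig i)) (Xh x) (vecMulVec (c i x) (c i x)) k j -
          score (extend J (Sig i)) X₀ (vecMulVec (c i x) (c i x)) k j) -
      (score S (Xh x) K k j - score S X₀ K k j)) =o[l] fun x => ‖dev X₀ (Xh x)‖ := by
    have h1 : (fun x => ∑ p, ∑ q, (1 / (N x : ℝ) * ∑ i ∈ Finset.range (N x),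
        (scoreLeft (extend J (Sig i)) (Xh x) k p * scoreRight (extend J (Sig i)) (Xh x) q j -
        scoreLeft (extend J (Sig i)) X₀ k p * scoreRight (extend J (Sig i)) X₀ q j -
          L p q (dev X₀ (Xh x))) * (c i x p * c i x q) +
        L p q (dev X₀ (Xh x)) * (1 / (N x : ℝ) * ∑ i ∈ Finset.range (N x),
          c i x p * c i x q - K p q) -
        (scoreLeft S (Xh x) k p * scoreRight S (Xh x) q j -
          scoreLeft S X₀ k p * scoreRight S X₀ q j - L p q (dev X₀ (Xh x))) * K p q)) =o[l]
        fun x => ‖dev X₀ (Xh x)‖ := by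
      refine Asymptotics.IsLittleO.fun_sum fun p _ => Asymptotics.IsLittleO.fun_sum fun q _ =>
        ((hL2 p q).add ?_).sub ?_
      · have h2 : (fun x => L p q (dev X₀ (Xh x))) =O[l] fun x => ‖dev X₀ (Xh x)‖ :=
          ((L p q).isBigO_comp _ l).norm_right
        simpa using h2.mul_isLittleO ((Asymptotics.isLittleO_one_iff ℝ).2 (hKd p q))
      · simpa using (hL1 p q).mul_isBigO (Asymptotics.isBigO_refl (fun _ : α => K p q) l |>.trans
          (Asymptotics.isBigO_const_const (K p q) (one_ne_zero (α := ℝ)) l))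
    refine h1.congr_left fun x => ?_
    have e : ∀ i, score (extend J (Sig i)) (Xh x) (vecMulVec (c i x) (c i x)) k j -
          score (extend J (Sig i)) X₀ (vecMulVec (c i x) (c i x)) k j =
        ∑ p, ∑ q, (scoreLeft (extend J (Sig i)) (Xh x) k p *
          scoreRight (extend J (Sig i)) (Xh x) q j -
        scoreLeft (extend J (Sig i)) X₀ k p * scoreRight (extend J (Sig i)) X₀ q j) *
          (c i x p * c i x q) := fun i => by
      rw [score_apply, score_apply]
      simp only [← Finset.sum_sub_distrib, vecMulVec_apply, sub_mul]
    simp only [e]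
    have hswap : ∀ f : ℕ → Col n d → Col n d → ℝ, ∑ i ∈ Finset.range (N x), ∑ p, ∑ q, f i p q =
        ∑ p, ∑ q, ∑ i ∈ Finset.range (N x), f i p q := fun f => by
      rw [Finset.sum_comm]
      exact Finset.sum_congr rfl fun p _ => Finset.sum_comm
    rw [score_apply, score_apply, hswap, Finset.mul_sum, ← Finset.sum_sub_distrib,
      ← Finset.sum_sub_distrib]
    refine Finset.sum_congr rfl fun p _ => ?_
    rw [Finset.mul_sum, ← Finset.sum_sub_distrib, ← Finset.sum_sub_distrib]
    refine Finset.sum_congr rfl fun q _ => ?_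
    have e3 : ∑ i ∈ Finset.range (N x),
        (scoreLeft (extend J (Sig i)) (Xh x) k p * scoreRight (extend J (Sig i)) (Xh x) q j -
        scoreLeft (extend J (Sig i)) X₀ k p * scoreRight (extend J (Sig i)) X₀ q j -
          L p q (dev X₀ (Xh x))) * (c i x p * c i x q) =
        ∑ i ∈ Finset.range (N x),
        (scoreLeft (extend J (Sig i)) (Xh x) k p * scoreRight (extend J (Sig i)) (Xh x) q j -
        scoreLeft (extend J (Sig i)) X₀ k p * scoreRight (extend J (Sig i)) X₀ q j) *
          (c i x p * c i x q) - L p q (dev X₀ (Xh x)) * ∑ i ∈ Finset.range (N x),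
          c i x p * c i x q := by
      rw [Finset.mul_sum, ← Finset.sum_sub_distrib]
      exact Finset.sum_congr rfl fun i _ => by ring
    rw [e3]
    ring
  have hNt : Tendsto (fun x => gram S (Xh x)) l (𝓝 (gram S X₀)) :=
    ((continuous_gram_right S).tendsto X₀).comp hX
  have hMt : Tendsto (fun x => (gram S (Xh x))⁻¹) l (𝓝 (gram S X₀)⁻¹) :=
    tendsto_matrix_inv hNt hN₀.det_pos.ne'
  have hB : (fun x => score S (Xh x) K k j - score S X₀ K k j -
      (V * (Xh x - X₀) * (gram S X₀)⁻¹) k j) =o[l] fun x => ‖dev X₀ (Xh x)‖ := by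
    set Q : α → Matrix (Fin n) (Fin n) ℝ := fun x =>
      (1 - Pa n d * S * Z (Xh x) * (gram S (Xh x))⁻¹ * (Xh x - X₀)ᵀ) * V with hQ
    have hQt : Tendsto Q l (𝓝 V) := by
      have hc : Continuous fun y : Matrix (Fin n) (Fin d) ℝ × Matrix (Fin d) (Fin d) ℝ =>
          (1 - Pa n d * S * Z y.1 * y.2 * (y.1 - X₀)ᵀ) * V := by
        have := continuous_Z (n := n) (d := d)
        fun_prop
      have h2 : Tendsto (fun x => (Xh x, (gram S (Xh x))⁻¹)) l (𝓝 (X₀, (gram S X₀)⁻¹)) :=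
        hX.prodMk_nhds hMt
      have h3 := (hc.tendsto (X₀, (gram S X₀)⁻¹)).comp h2
      simp only [sub_self, transpose_zero, Matrix.mul_zero, sub_zero, Matrix.one_mul] at h3
      exact h3
    have h1 : (fun x => ∑ b, (∑ a, (Xh x - X₀) a b * (Q x k a * (gram S (Xh x))⁻¹ b j -
        V k a * (gram S X₀)⁻¹ b j))) =o[l] fun x => ‖dev X₀ (Xh x)‖ := by
      refine Asymptotics.IsLittleO.fun_sum fun b _ => Asymptotics.IsLittleO.fun_sum fun a _ => ?_
      have h2 : Tendsto (fun x => Q x k a * (gram S (Xh x))⁻¹ b j -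
        V k a * (gram S X₀)⁻¹ b j) l (𝓝 0) := by
        have h3 := (tendsto_pi_nhds.1 (tendsto_pi_nhds.1 hQt k) a).mul
          (tendsto_pi_nhds.1 (tendsto_pi_nhds.1 hMt b) j)
        simpa using h3.sub_const (V k a * (gram S X₀)⁻¹ b j)
      simpa using (isBigO_sub_entry Xh a b).mul_isLittleO ((Asymptotics.isLittleO_one_iff ℝ).2 h2)
    refine h1.congr' ?_ EventuallyEq.rfl
    have hdet : ∀ᶠ x in l, (gram S (Xh x)).det ≠ 0 :=
      ((continuous_id.matrix_det.tendsto (gram S X₀)).comp hNt).eventually_ne hN₀.det_pos.ne'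
    filter_upwards [hdet] with x hx
    rw [hK, score_momentLimit V X₀ (Xh x) σ hx, score_momentLimit V X₀ X₀ σ hN₀.det_pos.ne',
      sub_self X₀, Matrix.zero_mul, Matrix.mul_zero, Matrix.zero_apply, sub_zero,
      ← Matrix.mul_assoc]
    change _ = (Q x * (Xh x - X₀) * (gram S (Xh x))⁻¹) k j - _
    rw [Matrix.mul_apply, Matrix.mul_apply, ← Finset.sum_sub_distrib]
    refine Finset.sum_congr rfl fun b _ => ?_
    rw [Matrix.mul_apply, Matrix.mul_apply, Finset.sum_mul, Finset.sum_mul,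
      ← Finset.sum_sub_distrib]
    exact Finset.sum_congr rfl fun a _ => by ring
  refine (hA.add hB).congr_left fun x => ?_
  ring

/-- **Asymptotic expansion** of a consistent zero of the score. -/
theorem isLittleO_expansion {Xh : α → Matrix (Fin n) (Fin d) ℝ} (hX : Tendsto Xh l (𝓝 X₀))
    (hscore : ∀ᶠ x in l, ∑ i ∈ Finset.range (N x),
      score (extend J (Sig i)) (Xh x) (vecMulVec (c i x) (c i x)) = 0)
    {G : α → Matrix (Fin n) (Fin d) ℝ}
    (hG : Tendsto (fun x => (1 / √(N x : ℝ)) • ∑ i ∈ Finset.range (N x),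
      score (extend J (Sig i)) X₀ (vecMulVec (c i x) (c i x)) -
        G x * (gram (extend J SigInf) X₀)⁻¹) l (𝓝 0)) :
    (fun x a b => √(N x : ℝ) * (Xh x a b - X₀ a b) + (V⁻¹ * G x) a b) =o[l]
      fun x => 1 + ‖fun a b => (V⁻¹ * G x) a b‖ := by
  set S := extend J SigInf with hS
  have hN₀ := gram_posDef h.sigInf_posDef h.regular
  have hVu : V.det ≠ 0 := h.V_posDef.det_pos.ne'
  let Y : α → Fin n → Fin d → ℝ := fun x a b => √(N x : ℝ) * (Xh x a b - X₀ a b)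
  let U : α → Fin n → Fin d → ℝ := fun x a b => (V⁻¹ * G x) a b
  have hYn : ∀ x, ‖Y x‖ = √(N x : ℝ) * ‖dev X₀ (Xh x)‖ := fun x => by
    have : Y x = √(N x : ℝ) • dev X₀ (Xh x) := rfl
    rw [this, norm_smul, Real.norm_of_nonneg (Real.sqrt_nonneg _)]
  have key : ∀ k j, (fun x => (V * (√(N x : ℝ) • (Xh x - X₀)) * (gram S X₀)⁻¹ +
      G x * (gram S X₀)⁻¹) k j) =o[l] fun x => 1 + ‖Y x‖ := by
    intro k j
    have h1 : (fun x => √(N x : ℝ) * (1 / (N x : ℝ) * ∑ i ∈ Finset.range (N x),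
        (score (extend J (Sig i)) (Xh x) (vecMulVec (c i x) (c i x)) k j -
          score (extend J (Sig i)) X₀ (vecMulVec (c i x) (c i x)) k j) -
      (V * (Xh x - X₀) * (gram S X₀)⁻¹) k j)) =o[l] fun x => 1 + ‖Y x‖ := by
      refine ((Asymptotics.isBigO_refl (fun x => √(N x : ℝ)) l).mul_isLittleO
        (h.isLittleO_score_increment hX k j)).trans_isBigO ?_
      refine Asymptotics.isBigO_of_le _ fun x => ?_
      rw [← hYn, norm_norm, Real.norm_of_nonneg (by positivity)]
      linarith
    have h2 : (fun x => ((1 / √(N x : ℝ)) • ∑ i ∈ Finset.range (N x),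
      score (extend J (Sig i)) X₀ (vecMulVec (c i x) (c i x)) -
        G x * (gram S X₀)⁻¹) k j) =o[l] fun x => 1 + ‖Y x‖ := by
      refine ((Asymptotics.isLittleO_one_iff ℝ).2
        (tendsto_pi_nhds.1 (tendsto_pi_nhds.1 hG k) j)).trans_isBigO ?_
      refine Asymptotics.isBigO_of_le _ fun x => ?_
      rw [norm_one, Real.norm_of_nonneg (by positivity)]
      linarith [norm_nonneg (Y x)]
    refine (h1.add h2).neg_left.congr' ?_ EventuallyEq.rfl
    filter_upwards [hscore, h.size.eventually_gt_atTop 0] with x hx hx0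
    have hx1 := congrFun (congrFun hx k) j
    rw [Matrix.sum_apply, Matrix.zero_apply] at hx1
    have hs : √(N x : ℝ) * (1 / (N x : ℝ)) = 1 / √(N x : ℝ) := by
      have h3 : (0 : ℝ) < N x := by exact_mod_cast hx0
      have h4 := Real.mul_self_sqrt h3.le
      have h5 := Real.sqrt_pos.2 h3
      field_simp
      nlinarith
    rw [Finset.sum_sub_distrib, hx1, zero_sub, mul_sub, ← mul_assoc, hs, Matrix.add_apply,
      Matrix.sub_apply, Matrix.smul_apply, Matrix.sum_apply, Matrix.mul_smul, Matrix.smul_mul,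
      Matrix.smul_apply, smul_eq_mul, smul_eq_mul]
    ring
  refine isLittleO_one_add_norm (Y := Y) (U := U) ?_
  refine Asymptotics.isLittleO_pi.2 fun a => Asymptotics.isLittleO_pi.2 fun b => ?_
  have h3 : (fun x => ∑ j, (∑ k, V⁻¹ a k * (V * (√(N x : ℝ) • (Xh x - X₀)) * (gram S X₀)⁻¹ +
      G x * (gram S X₀)⁻¹) k j) * gram S X₀ j b) =o[l] fun x => 1 + ‖Y x‖ := by
    refine Asymptotics.IsLittleO.fun_sum fun j _ => ?_
    have h4 : (fun x => ∑ k, V⁻¹ a k * (V * (√(N x : ℝ) • (Xh x - X₀)) * (gram S X₀)⁻¹ +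
      G x * (gram S X₀)⁻¹) k j) =o[l] fun x => 1 + ‖Y x‖ :=
      Asymptotics.IsLittleO.fun_sum fun k _ => (key k j).const_mul_left _
    simpa only [mul_comm] using h4.const_mul_left (gram S X₀ j b)
  refine h3.congr_left fun x => ?_
  have e : V⁻¹ * (V * (√(N x : ℝ) • (Xh x - X₀)) * (gram S X₀)⁻¹ +
      G x * (gram S X₀)⁻¹) * gram S X₀ = √(N x : ℝ) • (Xh x - X₀) + V⁻¹ * G x := by
    rw [← Matrix.add_mul, ← Matrix.mul_assoc, Matrix.mul_assoc _ (gram S X₀)⁻¹,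
      nonsing_inv_mul _ hN₀.det_pos.ne'.isUnit, Matrix.mul_one,
      Matrix.mul_add, nonsing_inv_mul_cancel_left _ _ hVu.isUnit]
  have e2 := congrFun (congrFun e a) b
  rw [Matrix.mul_apply] at e2
  refine Eq.trans (Finset.sum_congr rfl fun j _ => ?_) e2
  rw [← Matrix.mul_apply]

end RowLLN
end

/-! ### Moments of the errors -/

section
variable {n d : ℕ} {Ω : Type*} [MeasurableSpace Ω] {P : Measure Ω}

/-- The index set of the entries of a pair of matrices `(Γ₁, Γ₂)`. -/
abbrev Idx (n d : ℕ) : Type := (Fin n × Col n d) ⊕ (Col n d × Col n d)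

/-- The entries of `(a eᵀ, e eᵀ - s)`. -/
def pairVec (a : Fin n → ℝ) (e : Col n d → ℝ) (s : Matrix (Col n d) (Col n d) ℝ) : Idx n d → ℝ :=
  Sum.elim (fun x => a x.1 * e x.2) fun x => e x.1 * e x.2 - s x.1 x.2

/-- Assumptions on the errors, for all columns at once: independent centred rows with covariances
`σ² Sᵢ`, `Sᵢ → S_∞`, bounded moments of order `4 + 2δ`, vanishing third moments and converging
averaged fourth moments. -/
structure ErrorModel (P : Measure Ω) (err : ℕ → Ω → Col n d → ℝ)
    (S : ℕ → Matrix (Col n d) (Col n d) ℝ) (SInf : Matrix (Col n d) (Col n d) ℝ) (σ δ B : ℝ)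
    (μ : Col n d → Col n d → Col n d → Col n d → ℝ) : Prop where
  meas : ∀ i, Measurable (err i)
  indep : iIndepFun err P
  mean : ∀ i j, ∫ ω, err i ω j ∂P = 0
  delta_pos : 0 < δ
  moment_integrable : ∀ i j, Integrable (fun ω => |err i ω j| ^ (4 + 2 * δ)) P
  moment_le : ∀ i j, ∫ ω, |err i ω j| ^ (4 + 2 * δ) ∂P ≤ B
  second : ∀ i p q, ∫ ω, err i ω p * err i ω q ∂P = σ ^ 2 * S i p q
  S_tendsto : Tendsto S atTop (𝓝 SInf)
  third : ∀ i p q s, ∫ ω, err i ω p * err i ω q * err i ω s ∂P = 0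
  fourth : ∀ p q s u, Tendsto (fun m : ℕ => 1 / (m : ℝ) * ∑ i ∈ Finset.range m,
    ∫ ω, err i ω p * err i ω q * err i ω s * err i ω u ∂P) atTop (𝓝 (μ p q s u))

/-- The covariance matrix of the Gaussian limit of the normalized sums of
`(a₀ᵢ c̃ᵢᵀ, c̃ᵢ c̃ᵢᵀ - σ² Sᵢ)`. -/
def limitCov (V : Matrix (Fin n) (Fin n) ℝ) (SInf : Matrix (Col n d) (Col n d) ℝ) (σ : ℝ)
    (μ : Col n d → Col n d → Col n d → Col n d → ℝ) : Matrix (Idx n d) (Idx n d) ℝ :=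
  Matrix.fromBlocks (Matrix.of fun x y => V x.1 y.1 * (σ ^ 2 * SInf x.2 y.2)) 0 0
    (Matrix.of fun x y => μ x.1 x.2 y.1 y.2 - σ ^ 2 * SInf x.1 x.2 * (σ ^ 2 * SInf y.1 y.2))

lemma abs_mul_rpow_le (x y δ : ℝ) :
    |x * y| ^ (2 + δ) ≤ |x| ^ (4 + 2 * δ) + |y| ^ (4 + 2 * δ) := by
  obtain ⟨r, hr⟩ : ∃ r, r = 2 + δ := ⟨_, rfl⟩
  have e1 : 4 + 2 * δ = r * 2 := by rw [hr]; ring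
  rw [e1, ← hr]
  have e : ∀ z : ℝ, |z| ^ (r * 2) = (|z| ^ r) ^ 2 := fun z => by
    exact_mod_cast Real.rpow_mul_natCast (abs_nonneg z) r 2
  rw [abs_mul, Real.mul_rpow (abs_nonneg _) (abs_nonneg _), e, e]
  nlinarith [sq_nonneg (|x| ^ r - |y| ^ r), sq_nonneg (|x| ^ r), sq_nonneg (|y| ^ r)]

lemma abs_sub_rpow_le (x s : ℝ) {r : ℝ} (hr : 0 < r) :
    |x - s| ^ r ≤ 2 ^ r * (|x| ^ r + |s| ^ r) := by
  have h0 := abs_sub x s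
  have hx : 0 ≤ |x| ^ r := by positivity
  have hs : 0 ≤ |s| ^ r := by positivity
  have h2 : (0 : ℝ) ≤ 2 ^ r := by positivity
  rcases le_total |x| |s| with h | h
  · calc |x - s| ^ r ≤ (2 * |s|) ^ r :=
        Real.rpow_le_rpow (abs_nonneg _) (by linarith) hr.le
      _ = 2 ^ r * |s| ^ r := Real.mul_rpow (by norm_num) (abs_nonneg _)
      _ ≤ _ := by gcongr; linarith
  · calc |x - s| ^ r ≤ (2 * |x|) ^ r :=
        Real.rpow_le_rpow (abs_nonneg _) (by linarith) hr.le
      _ = 2 ^ r * |x| ^ r := Real.mul_rpow (by norm_num) (abs_nonneg _)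
      _ ≤ _ := by gcongr; linarith

lemma le_one_add_rpow {t r : ℝ} (ht : 0 ≤ t) (hr : 1 ≤ r) : t ≤ 1 + t ^ r := by
  rcases le_total t 1 with h | h
  · have : 0 ≤ t ^ r := by positivity
    linarith
  · have := Real.rpow_le_rpow_of_exponent_le h hr
    rw [Real.rpow_one] at this
    linarith

lemma abs_rpow_le_one_add (x δ : ℝ) : |x| ^ (2 + δ) ≤ 1 + |x| ^ (4 + 2 * δ) := by
  have h1 := le_one_add_rpow (t := |x| ^ (2 + δ)) (r := 2) (by positivity) (by norm_num)
  rw [← Real.rpow_mul (abs_nonneg _)] at h1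
  have e : 4 + 2 * δ = (2 + δ) * 2 := by ring
  rwa [e]

lemma measurable_pairVec (a : Fin n → ℝ) (s : Matrix (Col n d) (Col n d) ℝ) :
    Measurable fun e : Col n d → ℝ => pairVec a e s := by
  refine measurable_pi_lambda _ fun x => ?_
  rcases x with x | x
  · simp only [pairVec, Sum.elim_inl]
    fun_prop
  · simp only [pairVec, Sum.elim_inr]
    fun_prop

namespace ErrorModel
variable {err : ℕ → Ω → Col n d → ℝ}
  {S : ℕ → Matrix (Col n d) (Col n d) ℝ} {SInf : Matrix (Col n d) (Col n d) ℝ} {σ δ B : ℝ}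
  {μ : Col n d → Col n d → Col n d → Col n d → ℝ}
  (h : ErrorModel P err S SInf σ δ B μ) (a₀ : ℕ → Fin n → ℝ)
include h

lemma meas_apply (i : ℕ) (p : Col n d) : Measurable fun ω => err i ω p :=
  (measurable_pi_apply p).comp (h.meas i)

lemma measurable_row (i : ℕ) : Measurable fun ω => pairVec (a₀ i) (err i ω) (σ ^ 2 • S i) :=
  (measurable_pairVec _ _).comp (h.meas i)

lemma indep_row : iIndepFun (fun i ω => pairVec (a₀ i) (err i ω) (σ ^ 2 • S i)) P :=
  h.indep.comp (fun i (e : Col n d → ℝ) => pairVec (a₀ i) e (σ ^ 2 • S i))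
    fun _ => measurable_pairVec _ _

variable [IsProbabilityMeasure P]

lemma integrable_sq (i : ℕ) (p : Col n d) : Integrable (fun ω => err i ω p ^ 2) P := by
  have h1 := h.moment_integrable i p
  have e : 4 + 2 * δ = 2 + (2 + 2 * δ) := by ring
  rw [e] at h1
  exact integrable_sq_of_integrable_rpow (h.meas_apply i p) (by linarith [h.delta_pos]) h1

lemma integrable_mul (i : ℕ) (p q : Col n d) : Integrable (fun ω => err i ω p * err i ω q) P :=
  integrable_mul_of_integrable_sq (h.meas_apply i p) (h.meas_apply i q) (h.integrable_sq i p)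
    (h.integrable_sq i q)

omit [IsProbabilityMeasure P] in
lemma integrable_mul_rpow (i : ℕ) (p q : Col n d) :
    Integrable (fun ω => |err i ω p * err i ω q| ^ (2 + δ)) P := by
  have := h.meas_apply
  refine Integrable.mono' ((h.moment_integrable i p).add (h.moment_integrable i q))
    (((this i p).mul (this i q)).abs.pow_const _).aestronglyMeasurable (ae_of_all _ fun ω => ?_)
  rw [Real.norm_eq_abs, abs_of_nonneg (by positivity)]
  exact abs_mul_rpow_le _ _ δ

omit [IsProbabilityMeasure P] in
lemma integral_mul_rpow_le (i : ℕ) (p q : Col n d) :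
    ∫ ω, |err i ω p * err i ω q| ^ (2 + δ) ∂P ≤ 2 * B := by
  have h1 := integral_mono (h.integrable_mul_rpow i p q)
    ((h.moment_integrable i p).add (h.moment_integrable i q)) (fun _ => abs_mul_rpow_le _ _ δ)
  rw [integral_add' (h.moment_integrable i p) (h.moment_integrable i q)] at h1
  linarith [h.moment_le i p, h.moment_le i q]

lemma integrable_mul_sq (i : ℕ) (p q : Col n d) :
    Integrable (fun ω => (err i ω p * err i ω q) ^ 2) P :=
  integrable_sq_of_integrable_rpow ((h.meas_apply i p).mul (h.meas_apply i q)) h.delta_pos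
    (h.integrable_mul_rpow i p q)

lemma abs_second_le (i : ℕ) (p q : Col n d) : |σ ^ 2 * S i p q| ≤ 1 + 2 * B := by
  rw [← h.second]
  refine (abs_integral_le_integral_abs).trans ?_
  have h1 := integral_mono (h.integrable_mul i p q).abs
    ((integrable_const 1).add (h.integrable_mul_rpow i p q))
    fun ω => le_one_add_rpow (abs_nonneg (err i ω p * err i ω q))
      (by linarith [h.delta_pos] : 1 ≤ 2 + δ)
  rw [integral_add' (integrable_const 1) (h.integrable_mul_rpow i p q)] at h1
  simp only [integral_const, probReal_univ, one_smul] at h1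
  linarith [h.integral_mul_rpow_le i p q]

lemma integral_row (i : ℕ) (x : Idx n d) :
    ∫ ω, pairVec (a₀ i) (err i ω) (σ ^ 2 • S i) x ∂P = 0 := by
  rcases x with x | x
  · simp only [pairVec, Sum.elim_inl]
    rw [integral_const_mul, h.mean, mul_zero]
  · simp only [pairVec, Sum.elim_inr]
    rw [integral_sub (h.integrable_mul i _ _) (integrable_const _), h.second]
    simp

lemma integrable_err_rpow (i : ℕ) (p : Col n d) :
    Integrable (fun ω => |err i ω p| ^ (2 + δ)) P := by
  refine Integrable.mono' ((integrable_const 1).add (h.moment_integrable i p))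
    ((h.meas_apply i p).abs.pow_const _).aestronglyMeasurable (ae_of_all _ fun ω => ?_)
  rw [Real.norm_eq_abs, abs_of_nonneg (by positivity)]
  exact abs_rpow_le_one_add _ δ

lemma integral_err_rpow_le (i : ℕ) (p : Col n d) : ∫ ω, |err i ω p| ^ (2 + δ) ∂P ≤ 1 + B := by
  have h1 := integral_mono (h.integrable_err_rpow i p)
    ((integrable_const 1).add (h.moment_integrable i p)) (fun _ => abs_rpow_le_one_add _ δ)
  rw [integral_add' (integrable_const 1) (h.moment_integrable i p)] at h1
  simp only [integral_const, probReal_univ, one_smul] at h1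
  linarith [h.moment_le i p]

lemma row_inr_rpow_le (i : ℕ) (x : Col n d × Col n d) (ω : Ω) :
    |pairVec (a₀ i) (err i ω) (σ ^ 2 • S i) (Sum.inr x)| ^ (2 + δ) ≤
      2 ^ (2 + δ) * (|err i ω x.1 * err i ω x.2| ^ (2 + δ) + (1 + 2 * B) ^ (2 + δ)) := by
  have hδ := h.delta_pos
  refine (abs_sub_rpow_le _ _ (by linarith)).trans ?_
  have := Real.rpow_le_rpow (abs_nonneg _) (h.abs_second_le i x.1 x.2) (by linarith : 0 ≤ 2 + δ)
  rw [Matrix.smul_apply, smul_eq_mul]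
  gcongr

lemma integrable_row_rpow (i : ℕ) (x : Idx n d) :
    Integrable (fun ω => |pairVec (a₀ i) (err i ω) (σ ^ 2 • S i) x| ^ (2 + δ)) P := by
  rcases x with x | x
  · simp only [pairVec, Sum.elim_inl, abs_mul]
    simp only [Real.mul_rpow (abs_nonneg _) (abs_nonneg _)]
    exact (h.integrable_err_rpow i x.2).const_mul _
  · refine Integrable.mono' (((h.integrable_mul_rpow i x.1 x.2).add
      (integrable_const ((1 + 2 * B) ^ (2 + δ)))).const_mul (2 ^ (2 + δ)))
      (((measurable_pi_apply _).comp (h.measurable_row a₀ i)).abs.pow_const _).aestronglyMeasurable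
      (ae_of_all _ fun ω => ?_)
    rw [Real.norm_eq_abs, abs_of_nonneg (by positivity)]
    exact h.row_inr_rpow_le a₀ i x ω

variable {a₀} (h_lyap : Tendsto (fun m : ℕ => 1 / (m : ℝ) ^ (1 + δ / 2) *
      ∑ i ∈ Finset.range m, ‖WithLp.toLp 2 (a₀ i)‖ ^ (2 + δ)) atTop (𝓝 0))
include h_lyap

/-- The Lyapunov condition for the entries of `(a₀ᵢ c̃ᵢᵀ, c̃ᵢ c̃ᵢᵀ - σ² Sᵢ)`. -/
lemma lyapunov_row (x : Idx n d) : Tendsto (fun m : ℕ => 1 / (m : ℝ) ^ (1 + δ / 2) *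
    ∑ i ∈ Finset.range m, ∫ ω, |pairVec (a₀ i) (err i ω) (σ ^ 2 • S i) x| ^ (2 + δ) ∂P)
      atTop (𝓝 0) := by
  have hδ := h.delta_pos
  have hnn : ∀ m : ℕ, 0 ≤ 1 / (m : ℝ) ^ (1 + δ / 2) *
      ∑ i ∈ Finset.range m, ∫ ω, |pairVec (a₀ i) (err i ω) (σ ^ 2 • S i) x| ^ (2 + δ) ∂P :=
    fun m => mul_nonneg (by positivity) (Finset.sum_nonneg fun i _ =>
      integral_nonneg fun ω => by positivity)
  rcases x with x | x
  · have h1 := h_lyap.mul_const (1 + B)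
    rw [zero_mul] at h1
    refine squeeze_zero hnn (fun m => ?_) h1
    rw [mul_assoc, Finset.sum_mul]
    gcongr with i hi
    simp only [pairVec, Sum.elim_inl, abs_mul]
    simp only [Real.mul_rpow (abs_nonneg _) (abs_nonneg _)]
    rw [integral_const_mul]
    have h2 : |a₀ i x.1| ≤ ‖WithLp.toLp 2 (a₀ i)‖ := PiLp.norm_apply_le (WithLp.toLp 2 (a₀ i)) x.1
    have h3 : 0 ≤ ∫ ω, |err i ω x.2| ^ (2 + δ) ∂P := integral_nonneg fun ω => by positivity
    have h4 := h.integral_err_rpow_le i x.2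
    gcongr
  · set C := 2 ^ (2 + δ) * (2 * B + (1 + 2 * B) ^ (2 + δ)) with hC
    have h1 : Tendsto (fun m : ℕ => C * (m : ℝ) ^ (-(δ / 2))) atTop (𝓝 0) := by
      have := ((tendsto_rpow_neg_atTop (by linarith : 0 < δ / 2)).comp
        tendsto_natCast_atTop_atTop).const_mul C
      rwa [mul_zero] at this
    refine squeeze_zero' (Eventually.of_forall hnn) ?_ h1
    filter_upwards [eventually_gt_atTop 0] with m hm
    have hm' : (0 : ℝ) < m := by exact_mod_cast hm
    have h2 : ∀ i, ∫ ω, |pairVec (a₀ i) (err i ω) (σ ^ 2 • S i) (Sum.inr x)| ^ (2 + δ) ∂P ≤ C :=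
      fun i => by
      have h3 := integral_mono (h.integrable_row_rpow a₀ i (Sum.inr x))
        (((h.integrable_mul_rpow i x.1 x.2).add
          (integrable_const ((1 + 2 * B) ^ (2 + δ)))).const_mul (2 ^ (2 + δ)))
        (h.row_inr_rpow_le a₀ i x)
      refine h3.trans ?_
      rw [integral_const_mul, hC]
      refine mul_le_mul_of_nonneg_left ?_ (by positivity)
      rw [integral_add' (h.integrable_mul_rpow i x.1 x.2) (integrable_const _)]
      simp only [integral_const, probReal_univ, one_smul]
      linarith [h.integral_mul_rpow_le i x.1 x.2]
    calc 1 / (m : ℝ) ^ (1 + δ / 2) * ∑ i ∈ Finset.range m,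
          ∫ ω, |pairVec (a₀ i) (err i ω) (σ ^ 2 • S i) (Sum.inr x)| ^ (2 + δ) ∂P
        ≤ 1 / (m : ℝ) ^ (1 + δ / 2) * ∑ i ∈ Finset.range m, C := by
          gcongr with i hi; exact h2 i
      _ = C * (m : ℝ) ^ (-(δ / 2)) := by
          rw [Finset.sum_const, Finset.card_range, nsmul_eq_mul, Real.rpow_neg hm'.le,
            Real.rpow_add hm', Real.rpow_one]
          field_simp

omit h_lyap
variable {V : Matrix (Fin n) (Fin n) ℝ}
  (h_gram : ∀ k l, Tendsto (fun m : ℕ => 1 / (m : ℝ) * ∑ i ∈ Finset.range m, a₀ i k * a₀ i l)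
    atTop (𝓝 (V k l)))
include h_gram

omit h in
lemma tendsto_weighted_gram {s : ℕ → ℝ} {s₀ : ℝ} (hs : Tendsto s atTop (𝓝 s₀)) (k l : Fin n) :
    Tendsto (fun m : ℕ => 1 / (m : ℝ) * ∑ i ∈ Finset.range m, a₀ i k * a₀ i l * s i) atTop
      (𝓝 (V k l * s₀)) := by
  have hsum : ∀ m : ℕ, 1 / (m : ℝ) * ∑ i ∈ Finset.range m, a₀ i ⬝ᵥ a₀ i =
      ∑ k, 1 / (m : ℝ) * ∑ i ∈ Finset.range m, a₀ i k * a₀ i k := fun m => by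
    rw [← Finset.mul_sum, Finset.sum_comm]
    rfl
  have hlim : Tendsto (fun m : ℕ => 1 / (m : ℝ) * ∑ i ∈ Finset.range m, a₀ i ⬝ᵥ a₀ i) atTop
      (𝓝 (∑ k, V k k)) := by
    simp only [hsum]
    exact tendsto_finsetSum _ fun k _ => h_gram k k
  have hs0 : Tendsto (fun i => s i - s₀) atTop (𝓝 0) := by simpa using hs.sub_const s₀
  have h1 := tendsto_average_of_abs_le (α := ℕ) (l := atTop) (N := id) tendsto_id
    (w := fun i _ => |s i - s₀|) (k := fun i _ => a₀ i ⬝ᵥ a₀ i)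
    (f := fun i _ => a₀ i k * a₀ i l * (s i - s₀))
    (fun ε hε => by
      obtain ⟨i₀, hi₀⟩ := eventually_atTop.1 (hs0.eventually (Metric.closedBall_mem_nhds 0 hε))
      exact ⟨i₀, Eventually.of_forall fun _ i hi => by simpa using hi₀ i hi⟩)
    (fun i => ⟨|s i - s₀|, Eventually.of_forall fun _ => (abs_abs _).le⟩)
    (fun i _ => dotProduct_self_nonneg _)
    (hlim.eventually_le_const (lt_add_one _))
    (fun i => tendsto_const_nhds.div_atTop tendsto_natCast_atTop_atTop)
    (fun i _ => by
      rw [abs_mul, mul_comm]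
      exact mul_le_mul_of_nonneg_left (abs_mul_le_dotProduct_self _ _ _) (abs_nonneg _))
  have h2 := h1.add ((h_gram k l).mul_const s₀)
  rw [zero_add] at h2
  refine h2.congr fun m => ?_
  simp only [id_eq]
  rw [mul_assoc, Finset.sum_mul, ← mul_add, ← Finset.sum_add_distrib]
  congr 1
  exact Finset.sum_congr rfl fun i _ => by ring

/-- The averaged covariances of the entries of `(a₀ᵢ c̃ᵢᵀ, c̃ᵢ c̃ᵢᵀ - σ² Sᵢ)` converge. -/
lemma tendsto_cov_row (x y : Idx n d) : Tendsto (fun m : ℕ => 1 / (m : ℝ) *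
    ∑ i ∈ Finset.range m, ∫ ω, pairVec (a₀ i) (err i ω) (σ ^ 2 • S i) x *
      pairVec (a₀ i) (err i ω) (σ ^ 2 • S i) y ∂P) atTop (𝓝 (limitCov V SInf σ μ x y)) := by
  have hSpq : ∀ p q, Tendsto (fun i => σ ^ 2 * S i p q) atTop (𝓝 (σ ^ 2 * SInf p q)) := fun p q =>
    (tendsto_pi_nhds.1 (tendsto_pi_nhds.1 h.S_tendsto p) q).const_mul _
  have hcross : ∀ i (x : Fin n × Col n d) (y : Col n d × Col n d),
      ∫ ω, a₀ i x.1 * err i ω x.2 * (err i ω y.1 * err i ω y.2 - σ ^ 2 * S i y.1 y.2) ∂P = 0 := by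
    intro i x y
    have e : ∀ ω, a₀ i x.1 * err i ω x.2 * (err i ω y.1 * err i ω y.2 - σ ^ 2 * S i y.1 y.2) =
        a₀ i x.1 * (err i ω x.2 * (err i ω y.1 * err i ω y.2)) -
          a₀ i x.1 * σ ^ 2 * S i y.1 y.2 * err i ω x.2 := fun ω => by ring
    have h3 := h.third i x.2 y.1 y.2
    simp only [mul_assoc] at h3
    have hint : Integrable (fun ω => err i ω x.2) P :=
      ((memLp_two_iff_integrable_sq (h.meas_apply i x.2).aestronglyMeasurable).2
        (h.integrable_sq i x.2)).integrable (by norm_num)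
    simp only [e]
    rw [integral_sub, integral_const_mul, integral_const_mul, h.mean, h3]
    · simp
    · exact (integrable_mul_of_integrable_sq (h.meas_apply i _)
        ((h.meas_apply i _).mul (h.meas_apply i _)) (h.integrable_sq i _)
        (h.integrable_mul_sq i _ _)).const_mul _
    · exact hint.const_mul _
  rcases x with x | x <;> rcases y with y | y
  · simp only [pairVec, Sum.elim_inl, limitCov, fromBlocks_apply₁₁, Matrix.of_apply]
    have e : ∀ i ω, a₀ i x.1 * err i ω x.2 * (a₀ i y.1 * err i ω y.2) =
        a₀ i x.1 * a₀ i y.1 * (err i ω x.2 * err i ω y.2) := fun i ω => by ring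
    simp only [e, integral_const_mul, h.second]
    exact tendsto_weighted_gram h_gram (hSpq x.2 y.2) x.1 y.1
  · simp only [pairVec, Sum.elim_inl, Sum.elim_inr, limitCov, fromBlocks_apply₁₂,
      Matrix.zero_apply, Matrix.smul_apply, smul_eq_mul, hcross]
    simp
  · simp only [pairVec, Sum.elim_inl, Sum.elim_inr, limitCov, fromBlocks_apply₂₁,
      Matrix.zero_apply, Matrix.smul_apply, smul_eq_mul, mul_comm (_ - _), hcross]
    simp
  · simp only [pairVec, Sum.elim_inr, limitCov, fromBlocks_apply₂₂, Matrix.of_apply,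
      Matrix.smul_apply, smul_eq_mul]
    have e : ∀ i, ∫ ω, (err i ω x.1 * err i ω x.2 - σ ^ 2 * S i x.1 x.2) *
        (err i ω y.1 * err i ω y.2 - σ ^ 2 * S i y.1 y.2) ∂P =
        ∫ ω, err i ω x.1 * err i ω x.2 * err i ω y.1 * err i ω y.2 ∂P -
          σ ^ 2 * S i x.1 x.2 * (σ ^ 2 * S i y.1 y.2) := fun i => by
      have hL : ∀ p q, MemLp (fun ω => err i ω p * err i ω q) 2 P := fun p q =>
        (memLp_two_iff_integrable_sq ((h.meas_apply i p).mul
          (h.meas_apply i q)).aestronglyMeasurable).2 (h.integrable_mul_sq i p q)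
      have h1 := covariance_eq_sub (hL x.1 x.2) (hL y.1 y.2)
      simp only [covariance, Pi.mul_apply, h.second] at h1
      simp only [h1, mul_assoc]
    simp only [e]
    simp only [Finset.sum_sub_distrib, mul_sub]
    refine (h.fourth _ _ _ _).sub ?_
    have h1 := ((hSpq x.1 x.2).mul (hSpq y.1 y.2)).cesaro
    simpa only [one_div] using h1

end ErrorModel
end

/-! ### Linearization of the estimator -/

section
variable {n d : ℕ}

/-- The pair of matrices with given entries. -/
def pairOf (v : Idx n d → ℝ) : Matrix (Fin n) (Col n d) ℝ × Matrix (Col n d) (Col n d) ℝ :=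
  (Matrix.of fun i j => v (Sum.inl (i, j)), Matrix.of fun i j => v (Sum.inr (i, j)))

lemma pairOf_pairVec (a : Fin n → ℝ) (e : Col n d → ℝ) (s : Matrix (Col n d) (Col n d) ℝ) :
    pairOf (pairVec a e s) = (vecMulVec a e, vecMulVec e e - s) := rfl

/-- The coefficients of the `(k, j)` entry of `Γ₁ R + A Γ₂ R` as a linear form in `(Γ₁, Γ₂)`, where
`A` and `R` are the factors of the score. -/
noncomputable def scoreCoeff (S : Matrix (Col n d) (Col n d) ℝ) (X : Matrix (Fin n) (Fin d) ℝ)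
    (k : Fin n) (j : Fin d) : Idx n d → ℝ :=
  Sum.elim (fun x => (1 : Matrix (Fin n) (Fin n) ℝ) k x.1 * scoreRight S X x.2 j)
    fun x => scoreLeft S X k x.1 * scoreRight S X x.2 j

lemma pairOf_score_apply (S : Matrix (Col n d) (Col n d) ℝ) (X : Matrix (Fin n) (Fin d) ℝ)
    (v : Idx n d → ℝ) (k : Fin n) (j : Fin d) :
    ((pairOf v).1 * scoreRight S X + scoreLeft S X * (pairOf v).2 * scoreRight S X) k j =
      ∑ x, scoreCoeff S X k j x * v x := by
  rw [Fintype.sum_sum_type, Matrix.add_apply]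
  congr 1
  · rw [← Matrix.one_mul ((pairOf v).1), Matrix.mul_assoc, Matrix.mul_apply, Fintype.sum_prod_type]
    refine Finset.sum_congr rfl fun a _ => ?_
    rw [Matrix.mul_apply, Finset.mul_sum]
    refine Finset.sum_congr rfl fun q _ => ?_
    simp only [scoreCoeff, Sum.elim_inl, pairOf, Matrix.of_apply]
    ring
  · have := score_apply S X (pairOf v).2 k j
    rw [score] at this
    rw [this, Fintype.sum_prod_type]
    rfl

lemma pairOf_add (v w : Idx n d → ℝ) : pairOf (v + w) = pairOf v + pairOf w := rfl

lemma pairOf_smul (r : ℝ) (v : Idx n d → ℝ) : pairOf (r • v) = r • pairOf v := rfl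

lemma Gam_add (S : Matrix (Col n d) (Col n d) ℝ)
    (g g' : Matrix (Fin n) (Col n d) ℝ × Matrix (Col n d) (Col n d) ℝ)
    (X : Matrix (Fin n) (Fin d) ℝ) : Gam S (g + g') X = Gam S g X + Gam S g' X := by
  simp only [Gam, Prod.fst_add, Prod.snd_add, Matrix.mul_add, Matrix.add_mul]
  abel

lemma Gam_smul (S : Matrix (Col n d) (Col n d) ℝ) (r : ℝ)
    (g : Matrix (Fin n) (Col n d) ℝ × Matrix (Col n d) (Col n d) ℝ)
    (X : Matrix (Fin n) (Fin d) ℝ) : Gam S (r • g) X = r • Gam S g X := by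
  simp only [Gam, Prod.smul_fst, Prod.smul_snd, Matrix.mul_smul, Matrix.smul_mul, smul_sub,
    smul_add]

/-- The map `v ↦ V⁻¹ Γ(X)`, in terms of the entries `v` of `(Γ₁, Γ₂)`. -/
noncomputable def limitMap (V : Matrix (Fin n) (Fin n) ℝ) (S : Matrix (Col n d) (Col n d) ℝ)
    (X : Matrix (Fin n) (Fin d) ℝ) : (Idx n d → ℝ) →ₗ[ℝ] Fin n → Fin d → ℝ where
  toFun v a b := (V⁻¹ * Gam S (pairOf v) X) a b
  map_add' v w := by
    ext a b
    rw [pairOf_add, Gam_add, Matrix.mul_add]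
    rfl
  map_smul' r v := by
    ext a b
    rw [pairOf_smul, Gam_smul, Matrix.mul_smul]
    rfl

lemma exists_norm_limitMap_le (V : Matrix (Fin n) (Fin n) ℝ) (S : Matrix (Col n d) (Col n d) ℝ)
    (X : Matrix (Fin n) (Fin d) ℝ) :
    ∃ K, 0 ≤ K ∧ ∀ v, ‖limitMap V S X v‖ ≤ K * ∑ x, |v x| := by
  refine ⟨‖(limitMap V S X).toContinuousLinearMap‖, norm_nonneg _, fun v => ?_⟩
  refine ((limitMap V S X).toContinuousLinearMap.le_opNorm v).trans ?_
  gcongr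
  refine (pi_norm_le_iff_of_nonneg (Finset.sum_nonneg fun _ _ => abs_nonneg _)).2 fun x => ?_
  exact Finset.single_le_sum (f := fun x => |v x|) (fun _ _ => abs_nonneg _) (Finset.mem_univ x)

lemma tendsto_scoreCoeff {S : ℕ → Matrix (Col n d) (Col n d) ℝ}
    {S₀ : Matrix (Col n d) (Col n d) ℝ} {X : Matrix (Fin n) (Fin d) ℝ}
    (hS : Tendsto S atTop (𝓝 S₀)) (h0 : (gram S₀ X).det ≠ 0) (k : Fin n) (j : Fin d)
    (x : Idx n d) :
    Tendsto (fun i => scoreCoeff (S i) X k j x) atTop (𝓝 (scoreCoeff S₀ X k j x)) := by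
  have hM : Tendsto (fun i => (gram (S i) X)⁻¹) atTop (𝓝 (gram S₀ X)⁻¹) :=
    tendsto_matrix_inv (((continuous_gram_left X).tendsto S₀).comp hS) h0
  have hR : Tendsto (fun i => scoreRight (S i) X) atTop (𝓝 (scoreRight S₀ X)) :=
    ((continuous_const.matrix_mul continuous_id).tendsto (gram S₀ X)⁻¹).comp hM
  have hL : Tendsto (fun i => scoreLeft (S i) X) atTop (𝓝 (scoreLeft S₀ X)) := by
    have hc : Continuous fun y : Matrix (Col n d) (Col n d) ℝ × Matrix (Fin d) (Fin d) ℝ =>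
        Pa n d - Pa n d * y.1 * Z X * y.2 * (Z X)ᵀ := by fun_prop
    have hp : Tendsto (fun i => (S i, (gram (S i) X)⁻¹)) atTop (𝓝 (S₀, (gram S₀ X)⁻¹)) :=
      hS.prodMk_nhds hM
    have h4 := (hc.tendsto (S₀, (gram S₀ X)⁻¹)).comp hp
    simp only [Function.comp_def] at h4
    exact h4
  have hRe := fun p q => tendsto_pi_nhds.1 (tendsto_pi_nhds.1 hR p) q
  have hLe := fun p q => tendsto_pi_nhds.1 (tendsto_pi_nhds.1 hL p) q
  rcases x with x | x
  · exact (hRe x.2 j).const_mul _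
  · exact (hLe k x.1).mul (hRe x.2 j)

end

section
variable {n d : ℕ} {Ω : Type*} [MeasurableSpace Ω] {P : Measure Ω} [IsProbabilityMeasure P]
  {err : ℕ → Ω → Col n d → ℝ} {J : Finset (Col n d)} {Sig : ℕ → Matrix J J ℝ}
  {SigInf : Matrix J J ℝ} {σ δ B : ℝ} {μ : Col n d → Col n d → Col n d → Col n d → ℝ}
  {a₀ : ℕ → Fin n → ℝ} {V : Matrix (Fin n) (Fin n) ℝ} {X₀ : Matrix (Fin n) (Fin d) ℝ}

/-- The normalized sum `m^(-1/2) ∑ (a₀ᵢ c̃ᵢᵀ, c̃ᵢ c̃ᵢᵀ - σ² Sᵢ)` over the first `m` rows, as a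
vector of entries. -/
noncomputable def normSum (a₀ : ℕ → Fin n → ℝ) (err : ℕ → Ω → Col n d → ℝ)
    (S : ℕ → Matrix (Col n d) (Col n d) ℝ) (σ : ℝ) (m : ℕ) (ω : Ω) : Idx n d → ℝ :=
  fun x => 1 / √(m : ℝ) * ∑ i ∈ Finset.range m, pairVec (a₀ i) (err i ω) (σ ^ 2 • S i) x

namespace ErrorModel
section
variable {S : ℕ → Matrix (Col n d) (Col n d) ℝ} {SInf : Matrix (Col n d) (Col n d) ℝ}
  (h : ErrorModel P err S SInf σ δ B μ)
  (h_gram : ∀ k l, Tendsto (fun m : ℕ => 1 / (m : ℝ) * ∑ i ∈ Finset.range m, a₀ i k * a₀ i l)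
    atTop (𝓝 (V k l)))
include h

omit [IsProbabilityMeasure P] in
lemma measurable_row_apply (i : ℕ) (x : Idx n d) :
    Measurable fun ω => pairVec (a₀ i) (err i ω) (σ ^ 2 • S i) x :=
  (measurable_pi_apply x).comp (h.measurable_row a₀ i)

omit [IsProbabilityMeasure P] in
lemma indep_row_apply (x : Idx n d) :
    iIndepFun (fun i ω => pairVec (a₀ i) (err i ω) (σ ^ 2 • S i) x) P :=
  (h.indep_row a₀).comp (fun _ v => v x) fun _ => measurable_pi_apply x

lemma integrable_row_sq (i : ℕ) (x : Idx n d) :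
    Integrable (fun ω => pairVec (a₀ i) (err i ω) (σ ^ 2 • S i) x ^ 2) P :=
  integrable_sq_of_integrable_rpow (h.measurable_row_apply i x) h.delta_pos
    (h.integrable_row_rpow a₀ i x)

include h_gram

lemma tendsto_row_sq (x : Idx n d) : Tendsto (fun m : ℕ => 1 / (m : ℝ) *
    ∑ i ∈ Finset.range m, ∫ ω, pairVec (a₀ i) (err i ω) (σ ^ 2 • S i) x ^ 2 ∂P) atTop
      (𝓝 (limitCov V SInf σ μ x x)) := by
  simpa only [sq] using h.tendsto_cov_row h_gram x x

lemma exists_normSum_bound (x : Idx n d) : ∃ K, ∀ m,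
    Integrable (fun ω => normSum a₀ err S σ m ω x ^ 2) P ∧
      ∫ ω, normSum a₀ err S σ m ω x ^ 2 ∂P ≤ K := by
  obtain ⟨K, hK⟩ := (h.tendsto_row_sq h_gram x).bddAbove_range
  refine ⟨K, fun m => ?_⟩
  have h1 := integral_sq_sum_of_indep (fun i => h.measurable_row_apply (a₀ := a₀) i x)
    (h.indep_row_apply x) (fun i => h.integral_row a₀ i x) (fun i => h.integrable_row_sq i x)
    (fun _ => 1) m
  simp only [one_mul, one_pow] at h1
  have e : ∀ ω, normSum a₀ err S σ m ω x ^ 2 = 1 / (m : ℝ) *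
      (∑ i ∈ Finset.range m, pairVec (a₀ i) (err i ω) (σ ^ 2 • S i) x) ^ 2 := fun ω => by
    rw [normSum, mul_pow, div_pow, one_pow, Real.sq_sqrt (Nat.cast_nonneg m)]
  simp only [e]
  refine ⟨h1.1.const_mul _, ?_⟩
  rw [integral_const_mul, h1.2]
  exact hK (Set.mem_range_self m)

/-- The law of large numbers for `(a₀ᵢ c̃ᵢᵀ, c̃ᵢ c̃ᵢᵀ - σ² Sᵢ)`. -/
lemma tendsto_average_row (x : Idx n d) : Tendsto (fun z : ℕ × Ω => 1 / (z.1 : ℝ) *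
    ∑ i ∈ Finset.range z.1, pairVec (a₀ i) (err i z.2) (σ ^ 2 • S i) x) (inProb P) (𝓝 0) := by
  obtain ⟨K, hK⟩ := h.exists_normSum_bound h_gram x
  have h0 : Tendsto (fun m : ℕ => 1 / √(m : ℝ)) atTop (𝓝 0) :=
    tendsto_const_nhds.div_atTop
      (Real.tendsto_sqrt_atTop.comp tendsto_natCast_atTop_atTop)
  have h1 := tendsto_inProb_mul_of_bounded_sq (fun m => (hK m).1) (fun m => (hK m).2)
    (h0.comp tendsto_fst_inProb)
  refine h1.congr fun z => ?_
  have e : 1 / (z.1 : ℝ) = 1 / √(z.1 : ℝ) * (1 / √(z.1 : ℝ)) := by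
    rw [div_mul_div_comm, one_mul, Real.mul_self_sqrt (Nat.cast_nonneg _)]
  simp only [normSum, Function.comp_apply]
  rw [e]
  ring

end

variable (h : ErrorModel P err (fun i => extend J (Sig i)) (extend J SigInf) σ δ B μ)
  (h_gram : ∀ k l, Tendsto (fun m : ℕ => 1 / (m : ℝ) * ∑ i ∈ Finset.range m, a₀ i k * a₀ i l)
    atTop (𝓝 (V k l)))
  (h_sig : ∀ i, (Sig i).PosDef) (h_sigInf : SigInf.PosDef) (h_lim : Tendsto Sig atTop (𝓝 SigInf))
  (h_V : V.PosDef) (h_reg : Regular J X₀) (h_sigma : 0 < σ)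
include h h_gram h_sig h_sigInf h_reg

include h_lim h_V h_sigma in
/-- The observed rows `[I, X₀]ᵀ a₀ᵢ + c̃ᵢ` satisfy the law of large numbers in probability. -/
theorem rowLLN : RowLLN (inProb P) Prod.fst
    (fun i z => (truth X₀)ᵀ *ᵥ a₀ i + err i z.2) Sig SigInf V X₀ σ where
  size := tendsto_fst_inProb
  sig_posDef := h_sig
  sigInf_posDef := h_sigInf
  sig_tendsto := h_lim
  V_posDef := h_V
  regular := h_reg
  sigma_pos := h_sigma
  head i := by
    refine tendsto_inProb_div_fst (k := fun ω => ((truth X₀)ᵀ *ᵥ a₀ i + err i ω) ⬝ᵥ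
      ((truth X₀)ᵀ *ᵥ a₀ i + err i ω)) ?_
    have := h.meas_apply i
    simp only [dotProduct, Pi.add_apply]
    fun_prop
  moment := by
    refine tendsto_pi_nhds.2 fun p => tendsto_pi_nhds.2 fun q => ?_
    have hav := h.tendsto_average_row h_gram
    have h1 : Tendsto (fun z : ℕ × Ω => ∑ k, ∑ l, truth X₀ k p * truth X₀ l q *
        (1 / (z.1 : ℝ) * ∑ i ∈ Finset.range z.1, a₀ i k * a₀ i l)) (inProb P)
        (𝓝 (∑ k, ∑ l, truth X₀ k p * truth X₀ l q * V k l)) :=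
      tendsto_finsetSum _ fun k _ => tendsto_finsetSum _ fun l _ =>
        ((h_gram k l).comp tendsto_fst_inProb).const_mul _
    have h2 : ∀ p q, Tendsto (fun z : ℕ × Ω => ∑ k, truth X₀ k p *
        (1 / (z.1 : ℝ) * ∑ i ∈ Finset.range z.1,
          pairVec (a₀ i) (err i z.2) (σ ^ 2 • extend J (Sig i)) (Sum.inl (k, q)))) (inProb P)
        (𝓝 0) := fun p q => by
      simpa using tendsto_finsetSum Finset.univ fun k _ =>
        (hav (Sum.inl (k, q))).const_mul (truth X₀ k p)
    have h3 : Tendsto (fun z : ℕ × Ω => 1 / (z.1 : ℝ) * ∑ i ∈ Finset.range z.1,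
        σ ^ 2 * extend J (Sig i) p q) (inProb P) (𝓝 (σ ^ 2 * extend J SigInf p q)) := by
      have := ((tendsto_pi_nhds.1 (tendsto_pi_nhds.1 h.S_tendsto p) q).const_mul
        (σ ^ 2)).cesaro.comp (tendsto_fst_inProb (P := P))
      simpa only [one_div, Function.comp_def] using this
    have h4 := (((h1.add (h2 p q)).add (h2 q p)).add (hav (Sum.inr (p, q)))).add h3
    have e : ∑ k, ∑ l, truth X₀ k p * truth X₀ l q * V k l + 0 + 0 + 0 +
        σ ^ 2 * extend J SigInf p q = momentLimit V X₀ σ (extend J SigInf) p q := by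
      rw [momentLimit, Matrix.add_apply, Matrix.smul_apply, smul_eq_mul, add_zero, add_zero,
        add_zero, Matrix.mul_assoc, Matrix.mul_apply]
      congr 1
      refine Finset.sum_congr rfl fun k _ => ?_
      rw [Matrix.mul_apply, Finset.mul_sum]
      refine Finset.sum_congr rfl fun l _ => ?_
      rw [transpose_apply]
      ring
    rw [e] at h4
    refine h4.congr fun z => ?_
    rw [Matrix.smul_apply, Matrix.sum_apply, smul_eq_mul]
    simp only [mul_left_comm _ (1 / (z.1 : ℝ)), ← Finset.mul_sum]
    simp only [← mul_add]
    congr 1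
    simp only [Finset.mul_sum]
    have hswap : ∑ k, ∑ l, ∑ i ∈ Finset.range z.1, truth X₀ k p * truth X₀ l q *
        (a₀ i k * a₀ i l) = ∑ i ∈ Finset.range z.1, ∑ k, ∑ l, truth X₀ k p * truth X₀ l q *
        (a₀ i k * a₀ i l) := by
      rw [Finset.sum_comm]
      refine (Finset.sum_congr rfl fun l _ => Finset.sum_comm).trans ?_
      rw [Finset.sum_comm]
      exact Finset.sum_congr rfl fun i _ => Finset.sum_comm
    rw [hswap, Finset.sum_comm (s := Finset.univ), Finset.sum_comm (s := Finset.univ),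
      ← Finset.sum_add_distrib, ← Finset.sum_add_distrib, ← Finset.sum_add_distrib,
      ← Finset.sum_add_distrib]
    refine Finset.sum_congr rfl fun i _ => ?_
    simp only [pairVec, Sum.elim_inl, Sum.elim_inr, Matrix.smul_apply, smul_eq_mul,
      vecMulVec_apply, Pi.add_apply]
    have et : ∀ r, ((truth X₀)ᵀ *ᵥ a₀ i) r = ∑ k, truth X₀ k r * a₀ i k := fun r => rfl
    have e1 : ∑ k, ∑ l, truth X₀ k p * truth X₀ l q * (a₀ i k * a₀ i l) =
        ((truth X₀)ᵀ *ᵥ a₀ i) p * ((truth X₀)ᵀ *ᵥ a₀ i) q := by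
      rw [et, et, Finset.sum_mul_sum]
      exact Finset.sum_congr rfl fun k _ => Finset.sum_congr rfl fun l _ => by ring
    have e2 : ∀ p q, ∑ k, truth X₀ k p * (a₀ i k * err i z.2 q) =
        ((truth X₀)ᵀ *ᵥ a₀ i) p * err i z.2 q := fun p q => by
      rw [et, Finset.sum_mul]
      exact Finset.sum_congr rfl fun k _ => by ring
    rw [e1, e2, e2]
    ring

/-- The normalized score at the true parameter is asymptotically the linear function `Γ(X₀)` of the
normalized sums, up to the factor `(Z₀ᵀ S_∞ Z₀)⁻¹`. -/
theorem tendsto_score_truth : Tendsto (fun z : ℕ × Ω => (1 / √(z.1 : ℝ)) •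
    ∑ i ∈ Finset.range z.1, score (extend J (Sig i)) X₀
      (vecMulVec ((truth X₀)ᵀ *ᵥ a₀ i + err i z.2) ((truth X₀)ᵀ *ᵥ a₀ i + err i z.2)) -
    Gam (extend J SigInf) (pairOf (normSum a₀ err (fun i => extend J (Sig i)) σ z.1 z.2)) X₀ *
      (gram (extend J SigInf) X₀)⁻¹) (inProb P) (𝓝 0) := by
  refine tendsto_pi_nhds.2 fun k => tendsto_pi_nhds.2 fun j => ?_
  have hdet := (gram_posDef h_sigInf h_reg).det_pos.ne'
  have h1 : Tendsto (fun z : ℕ × Ω => ∑ x, 1 / √(z.1 : ℝ) * ∑ i ∈ Finset.range z.1,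
      (scoreCoeff (extend J (Sig i)) X₀ k j x - scoreCoeff (extend J SigInf) X₀ k j x) *
        pairVec (a₀ i) (err i z.2) (σ ^ 2 • extend J (Sig i)) x) (inProb P) (𝓝 0) := by
    have h2 := tendsto_finsetSum (Finset.univ : Finset (Idx n d)) fun x _ =>
      tendsto_inProb_sum_of_tendsto_zero (fun i => h.measurable_row_apply (a₀ := a₀) i x)
        (h.indep_row_apply x) (fun i => h.integral_row a₀ i x) (fun i => h.integrable_row_sq i x)
        (h.tendsto_row_sq h_gram x)
        (c := fun i => scoreCoeff (extend J (Sig i)) X₀ k j x -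
          scoreCoeff (extend J SigInf) X₀ k j x)
        (sub_self (scoreCoeff (extend J SigInf) X₀ k j x) ▸
          (tendsto_scoreCoeff h.S_tendsto hdet k j x).sub_const _)
    simpa using h2
  refine h1.congr fun z => ?_
  rw [Matrix.sub_apply, Gam_mul_inv, pairOf_score_apply, Matrix.smul_apply, Matrix.sum_apply,
    smul_eq_mul]
  have e : ∀ i, score (extend J (Sig i)) X₀
      (vecMulVec ((truth X₀)ᵀ *ᵥ a₀ i + err i z.2) ((truth X₀)ᵀ *ᵥ a₀ i + err i z.2)) k j =
      ∑ x, scoreCoeff (extend J (Sig i)) X₀ k j x *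
        pairVec (a₀ i) (err i z.2) (σ ^ 2 • extend J (Sig i)) x := fun i => by
    rw [score_truth (gram_posDef (h_sig i) h_reg).det_pos.ne' _ _ (σ ^ 2),
      ← pairOf_score_apply, pairOf_pairVec]
  simp only [e]
  rw [Finset.sum_comm, Finset.mul_sum, ← Finset.sum_sub_distrib]
  refine Finset.sum_congr rfl fun x _ => ?_
  rw [normSum, mul_left_comm, ← mul_sub]
  congr 1
  rw [Finset.mul_sum, ← Finset.sum_sub_distrib]
  exact Finset.sum_congr rfl fun i _ => by ring

include h_lim h_V h_sigma in
/-- **Linearization of the estimator**: `√m (X̂ - X₀) + V⁻¹ Γ(X₀)`, with `Γ` evaluated at the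
normalized sums, tends to zero in probability. -/
theorem tendsto_linearization {Xh : ℕ × Ω → Matrix (Fin n) (Fin d) ℝ}
    (hXh : ∀ᶠ z in inProb P, Regular J (Xh z) ∧ ∀ X', Regular J X' →
      objective (fun i => extend J (Sig i)) (fun i => (truth X₀)ᵀ *ᵥ a₀ i + err i z.2) z.1 (Xh z) ≤
      objective (fun i => extend J (Sig i)) (fun i => (truth X₀)ᵀ *ᵥ a₀ i + err i z.2) z.1 X') :
    Tendsto (fun z : ℕ × Ω => (fun a b => √(z.1 : ℝ) * (Xh z a b - X₀ a b)) +
      limitMap V (extend J SigInf) X₀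
        (normSum a₀ err (fun i => extend J (Sig i)) σ z.1 z.2)) (inProb P) (𝓝 0) := by
  have hR := h.rowLLN h_gram h_sig h_sigInf h_lim h_V h_reg h_sigma
  have hX : Tendsto Xh (inProb P) (𝓝 X₀) := by
    refine tendsto_pi_nhds.2 fun a => tendsto_pi_nhds.2 fun b => ?_
    refine Metric.tendsto_nhds.2 fun ε hε => ?_
    filter_upwards [hXh, hR.eventually_abs_sub_le (half_pos hε)] with z h1 h2
    exact (h2 (Xh z) h1.1 (h1.2 X₀ h_reg) a b).trans_lt (half_lt_self hε)
  have hscore := hXh.mono fun z hz => sum_score_eq_zero h_sig _ _ hz.1 hz.2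
  have hE := hR.isLittleO_expansion hX hscore
    (h.tendsto_score_truth h_gram h_sig h_sigInf h_reg)
  set v : ℕ × Ω → Idx n d → ℝ := fun z =>
    normSum a₀ err (fun i => extend J (Sig i)) σ z.1 z.2 with hv
  set L := limitMap V (extend J SigInf) X₀ with hL
  obtain ⟨K, hK0, hK⟩ := exists_norm_limitMap_le V (extend J SigInf) X₀
  set E : ℕ × Ω → Fin n → Fin d → ℝ := fun z =>
    (fun a b => √(z.1 : ℝ) * (Xh z a b - X₀ a b)) + L (v z) with hE'
  have hE2 : Tendsto (fun z => ‖E z‖ / (1 + ‖L (v z)‖)) (inProb P) (𝓝 0) := by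
    have := hE.norm_left.tendsto_div_nhds_zero
    exact this
  have hB : ∀ x, Tendsto (fun z => |v z x * (‖E z‖ / (1 + ‖L (v z)‖))|) (inProb P) (𝓝 0) :=
    fun x => by
    obtain ⟨K', hK'⟩ := h.exists_normSum_bound h_gram x
    have := tendsto_inProb_mul_of_bounded_sq (fun m => (hK' m).1) (fun m => (hK' m).2) hE2
    simpa using this.abs
  have hsum := hE2.add ((tendsto_finsetSum Finset.univ fun x _ => hB x).const_mul K)
  simp only [Finset.sum_const_zero, mul_zero, add_zero] at hsum
  refine squeeze_zero_norm (fun z => ?_) hsum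
  set ε := ‖E z‖ / (1 + ‖L (v z)‖) with hε
  have hε0 : 0 ≤ ε := by positivity
  have h1 : ‖E z‖ = ε * (1 + ‖L (v z)‖) := by
    rw [hε, div_mul_cancel₀]
    positivity
  have h2 : ∑ x, |v z x * ε| = (∑ x, |v z x|) * ε := by
    rw [Finset.sum_mul]
    exact Finset.sum_congr rfl fun x _ => by rw [abs_mul, abs_of_nonneg hε0]
  rw [h2]
  change ‖E z‖ ≤ _
  rw [h1]
  have h3 := mul_le_mul_of_nonneg_left (hK (v z)) hε0
  nlinarith

end ErrorModel
end

/-! ### Reduction of the assumptions to all columns -/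

section
variable {ι : Type*} [Fintype ι]

lemma posSemidef_of_tendsto {A : ℕ → Matrix ι ι ℝ} {A₀ : Matrix ι ι ℝ}
    (hA : ∀ i, (A i).PosSemidef) (h : Tendsto A atTop (𝓝 A₀)) : A₀.PosSemidef := by
  refine PosSemidef.of_dotProduct_mulVec_nonneg ?_ fun v => ?_
  · rw [IsHermitian, conjTranspose_eq_transpose_of_trivial]
    have h1 := (continuous_id.matrix_transpose.tendsto A₀).comp h
    refine tendsto_nhds_unique h1 (h.congr fun i => ?_)
    exact ((hA i).transpose_eq).symm
  · have hc : Continuous fun B : Matrix ι ι ℝ => v ⬝ᵥ B *ᵥ v := by fun_prop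
    exact ge_of_tendsto' ((hc.tendsto A₀).comp h) fun i => (hA i).quad_nonneg v

variable [DecidableEq ι]

lemma posSemidef_sub_smul_one_of_spectrum {A : Matrix ι ι ℝ} (hA : Aᵀ = A) {a : ℝ}
    (h : ∀ l ∈ spectrum ℝ A, a ≤ l) : (A - a • (1 : Matrix ι ι ℝ)).PosSemidef := by
  have hH : (A - a • (1 : Matrix ι ι ℝ)).IsHermitian := by
    rw [IsHermitian, conjTranspose_eq_transpose_of_trivial, transpose_sub, transpose_smul,
      transpose_one, hA]
  rw [hH.posSemidef_iff_eigenvalues_nonneg]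
  intro i
  have h1 := hH.eigenvalues_mem_spectrum_real i
  change 0 ≤ hH.eigenvalues i
  generalize hH.eigenvalues i = e at h1 ⊢
  rw [← Algebra.algebraMap_eq_smul_one, ← spectrum.sub_singleton_eq] at h1
  obtain ⟨l, hl, b, hb, hlb⟩ := h1
  rw [Set.mem_singleton_iff] at hb
  have := h l hl
  simp only [hb] at hlb
  linarith

omit [Fintype ι] in
lemma posDef_of_sub_smul_one {A : Matrix ι ι ℝ} {a : ℝ} (ha : 0 < a)
    (h : (A - a • (1 : Matrix ι ι ℝ)).PosSemidef) : A.PosDef := by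
  have := PosDef.posSemidef_add h (PosDef.one.smul ha)
  rwa [sub_add_cancel] at this

end

section
variable {n : ℕ} {a₀ : ℕ → Fin n → ℝ} {V : Matrix (Fin n) (Fin n) ℝ}

lemma trueInput_gram_apply (a₀ : ℕ → Fin n → ℝ) (m : ℕ) (k l : Fin n) :
    ((1 / (m : ℝ)) • ((trueInput a₀ m)ᵀ * trueInput a₀ m)) k l =
      1 / (m : ℝ) * ∑ i ∈ Finset.range m, a₀ i k * a₀ i l := by
  rw [Matrix.smul_apply, Matrix.mul_apply, smul_eq_mul,
    ← Fin.sum_univ_eq_sum_range (fun i => a₀ i k * a₀ i l)]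
  rfl

lemma posDef_of_tendsto_gram (h : Tendsto (fun m : ℕ =>
      (1 / (m : ℝ)) • ((trueInput a₀ m)ᵀ * trueInput a₀ m)) atTop (𝓝 V)) (hV : IsUnit V) :
    V.PosDef := by
  refine (posSemidef_of_tendsto (fun m => ?_) h).posDef_iff_isUnit.2 hV
  have := posSemidef_conjTranspose_mul_self (trueInput a₀ m)
  rw [conjTranspose_eq_transpose_of_trivial] at this
  exact this.smul (by positivity)

end

section
variable {n d : ℕ} {Ω : Type*} [MeasurableSpace Ω] {P : Measure Ω} [IsProbabilityMeasure P]
  {err : ℕ → Ω → Col n d → ℝ} {J : Finset (Col n d)} {Sig : ℕ → Matrix J J ℝ} {σ : ℝ}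

omit [IsProbabilityMeasure P] in
lemma covMat_transpose {ι : Type*} (ξ : Ω → ι → ℝ) : (covMat P ξ)ᵀ = covMat P ξ := by
  ext p q
  exact covariance_comm _ _

omit [IsProbabilityMeasure P] in
lemma ae_eq_zero_of_integral_sq (h_sq : ∀ i j, MemLp (fun ω => err i ω j) 2 P) {i : ℕ}
    {j : Col n d} (h : ∫ ω, err i ω j ^ 2 ∂P = 0) : ∀ᵐ ω ∂P, err i ω j = 0 := by
  filter_upwards [(integral_eq_zero_iff_of_nonneg (fun ω => sq_nonneg _)
    (h_sq i j).integrable_sq).1 h] with ω hω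
  exact pow_eq_zero_iff two_ne_zero |>.1 hω

variable (h_sq : ∀ i j, MemLp (fun ω => err i ω j) 2 P)
  (h_mean : ∀ i j, ∫ ω, err i ω j ∂P = 0)
  (h_zero : ∀ i, ∀ j ∉ J, ∀ᵐ ω ∂P, err i ω j = 0) (h_sigma : 0 < σ)
  (h_cov : ∀ i, covMat P (fun ω (j : J) => err i ω j) = σ ^ 2 • Sig i)
include h_sq h_mean h_zero h_sigma h_cov

omit h_mean h_sigma in
lemma cov_eq_extend (i : ℕ) (p q : Col n d) :
    cov[fun ω => err i ω p, fun ω => err i ω q; P] = σ ^ 2 * extend J (Sig i) p q := by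
  rw [extend_apply]
  split_ifs with h
  · have := congrFun (congrFun (h_cov i) ⟨p, h.1⟩) ⟨q, h.2⟩
    exact this
  · have hz : ∀ᵐ ω ∂P, err i ω p * err i ω q = 0 := by
      by_cases hp : p ∈ J
      · filter_upwards [h_zero i q fun hq => h ⟨hp, hq⟩] with ω hω
        rw [hω, mul_zero]
      · filter_upwards [h_zero i p hp] with ω hω
        rw [hω, zero_mul]
    have hz2 : (∫ ω, err i ω p ∂P) * ∫ ω, err i ω q ∂P = 0 := by
      by_cases hp : p ∈ J
      · rw [integral_eq_zero_of_ae (h_zero i q fun hq => h ⟨hp, hq⟩), mul_zero]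
      · rw [integral_eq_zero_of_ae (h_zero i p hp), zero_mul]
    rw [covariance_eq_sub (h_sq i p) (h_sq i q), hz2, sub_zero, mul_zero]
    exact integral_eq_zero_of_ae hz

omit h_mean in
lemma S_eq_extend : S P err σ = fun i => extend J (Sig i) := by
  ext i p q
  have := cov_eq_extend h_sq h_zero h_cov i p q
  rw [S, Matrix.smul_apply, covMat, Matrix.of_apply, this, smul_eq_mul]
  field_simp

omit h_sigma in
/-- The assumptions on the columns in `J`, extended to all columns. -/
theorem exists_errorModel {SigInf : Matrix J J ℝ} {δ : ℝ} {μ₄ : J → J → J → J → ℝ}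
    (h_meas : ∀ i, Measurable (err i)) (h_indep : iIndepFun err P) (h_delta : 0 < δ)
    (h_mom : (⨆ (i : ℕ) (j : J), ∫⁻ ω, ‖err i ω j‖ₑ ^ (4 + 2 * δ) ∂P) < ⊤)
    (h_SigInf : Tendsto Sig atTop (𝓝 SigInf))
    (h_third : ∀ i, ∀ p q s : J, ∫ ω, err i ω p * err i ω q * err i ω s ∂P = 0)
    (h_fourth : ∀ p q s u : J, Tendsto (fun m : ℕ => 1 / (m : ℝ) * ∑ i ∈ Finset.range m,
      ∫ ω, err i ω p * err i ω q * err i ω s * err i ω u ∂P) atTop (𝓝 (μ₄ p q s u))) :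
    ∃ B μ, ErrorModel P err (fun i => extend J (Sig i)) (extend J SigInf) σ δ B μ := by
  have hmp : ∀ i j, Measurable fun ω => err i ω j := fun i j =>
    (measurable_pi_apply j).comp (h_meas i)
  set K := ⨆ (i : ℕ) (j : J), ∫⁻ ω, ‖err i ω j‖ₑ ^ (4 + 2 * δ) ∂P with hK
  have hq : 0 ≤ 4 + 2 * δ := by linarith
  have hmom : ∀ i j, Integrable (fun ω => |err i ω j| ^ (4 + 2 * δ)) P ∧
      ∫ ω, |err i ω j| ^ (4 + 2 * δ) ∂P ≤ K.toReal := fun i j => by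
    by_cases hj : j ∈ J
    · have e : ∀ ω, ‖err i ω j‖ₑ ^ (4 + 2 * δ) = ENNReal.ofReal (|err i ω j| ^ (4 + 2 * δ)) :=
        fun ω => by
        rw [Real.enorm_eq_ofReal_abs, ENNReal.ofReal_rpow_of_nonneg (abs_nonneg _) hq]
      have hle : ∫⁻ ω, ENNReal.ofReal (|err i ω j| ^ (4 + 2 * δ)) ∂P ≤ K := by
        simp only [← e]
        exact le_iSup₂_of_le i (⟨j, hj⟩ : J) le_rfl
      have hm : AEStronglyMeasurable (fun ω => |err i ω j| ^ (4 + 2 * δ)) P :=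
        ((hmp i j).abs.pow_const _).aestronglyMeasurable
      have hnn : 0 ≤ᵐ[P] fun ω => |err i ω j| ^ (4 + 2 * δ) :=
        ae_of_all _ fun ω => by positivity
      refine ⟨⟨hm, (hasFiniteIntegral_iff_ofReal hnn).2 (hle.trans_lt h_mom)⟩, ?_⟩
      rw [integral_eq_lintegral_of_nonneg_ae hnn hm]
      exact ENNReal.toReal_mono h_mom.ne hle
    · have hz : (fun ω => |err i ω j| ^ (4 + 2 * δ)) =ᵐ[P] 0 := by
        filter_upwards [h_zero i j hj] with ω hω
        rw [hω, abs_zero, Real.zero_rpow (by linarith), Pi.zero_apply]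
      refine ⟨(integrable_zero _ _ _).congr hz.symm, ?_⟩
      rw [integral_eq_zero_of_ae hz]
      exact ENNReal.toReal_nonneg
  refine ⟨K.toReal, fun p q s u => if h : p ∈ J ∧ q ∈ J ∧ s ∈ J ∧ u ∈ J then
    μ₄ ⟨p, h.1⟩ ⟨q, h.2.1⟩ ⟨s, h.2.2.1⟩ ⟨u, h.2.2.2⟩ else 0, ?_⟩
  exact
  { meas := h_meas
    indep := h_indep
    mean := h_mean
    delta_pos := h_delta
    moment_integrable := fun i j => (hmom i j).1
    moment_le := fun i j => (hmom i j).2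
    second := fun i p q => by
      have := cov_eq_extend h_sq h_zero h_cov i p q
      rw [covariance_eq_sub (h_sq i p) (h_sq i q), h_mean, zero_mul, sub_zero] at this
      exact this
    S_tendsto := ((continuous_extend J).tendsto SigInf).comp h_SigInf
    third := fun i p q s => by
      by_cases hp : p ∈ J
      · by_cases hq : q ∈ J
        · by_cases hs : s ∈ J
          · exact h_third i ⟨p, hp⟩ ⟨q, hq⟩ ⟨s, hs⟩
          · refine integral_eq_zero_of_ae ?_
            filter_upwards [h_zero i s hs] with ω hω
            simp [hω]
        · refine integral_eq_zero_of_ae ?_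
          filter_upwards [h_zero i q hq] with ω hω
          simp [hω]
      · refine integral_eq_zero_of_ae ?_
        filter_upwards [h_zero i p hp] with ω hω
        simp [hω]
    fourth := fun p q s u => by
      split_ifs with h
      · exact h_fourth ⟨p, h.1⟩ ⟨q, h.2.1⟩ ⟨s, h.2.2.1⟩ ⟨u, h.2.2.2⟩
      · have hz : ∀ i, ∫ ω, err i ω p * err i ω q * err i ω s * err i ω u ∂P = 0 := fun i => by
          refine integral_eq_zero_of_ae ?_
          simp only [not_and_or] at h
          rcases h with h | h | h | h
          · filter_upwards [h_zero i p h] with ω hω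
            simp [hω]
          · filter_upwards [h_zero i q h] with ω hω
            simp [hω]
          · filter_upwards [h_zero i s h] with ω hω
            simp [hω]
          · filter_upwards [h_zero i u h] with ω hω
            simp [hω]
        simp [hz] }

end

/-! ### The Gaussian limit law -/

section
variable {ι Ω Ω' Ω'' E : Type*} {l : Filter ι} [MeasurableSpace Ω] [MeasurableSpace Ω']
  [MeasurableSpace Ω''] [TopologicalSpace E] [MeasurableSpace E] [OpensMeasurableSpace E]
  {P : Measure Ω} [IsProbabilityMeasure P] {μ' : Measure Ω'} [IsProbabilityMeasure μ']
  {μ'' : Measure Ω''} [IsProbabilityMeasure μ'']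

/-- Convergence in distribution depends on the limit variable only through its law. -/
lemma tendstoInDistribution_of_map_eq {X : ι → Ω → E} {Y : Ω' → E} {Y' : Ω'' → E}
    (h : TendstoInDistribution X l Y (fun _ => P) μ') (hY' : AEMeasurable Y' μ'')
    (e : μ'.map Y = μ''.map Y') : TendstoInDistribution X l Y' (fun _ => P) μ'' where
  forall_aemeasurable := h.forall_aemeasurable
  aemeasurable_limit := hY'
  tendsto := by
    have h1 := h.tendsto
    have e2 : (⟨μ'.map Y, Measure.isProbabilityMeasure_map h.aemeasurable_limit⟩ :
        ProbabilityMeasure E) = ⟨μ''.map Y', Measure.isProbabilityMeasure_map hY'⟩ :=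
      Subtype.ext e
    rwa [e2] at h1

omit [IsProbabilityMeasure P] in
lemma indepFun_fst_snd_map {α β : Type*} [MeasurableSpace α] [MeasurableSpace β]
    {f : Ω → α × β} (hf : Measurable f)
    (h : IndepFun (fun ω => (f ω).1) (fun ω => (f ω).2) P) :
    IndepFun Prod.fst Prod.snd (P.map f) := by
  rw [indepFun_iff_measure_inter_preimage_eq_mul] at h ⊢
  intro s t hs ht
  rw [Measure.map_apply hf ((measurable_fst hs).inter (measurable_snd ht)),
    Measure.map_apply hf (measurable_fst hs), Measure.map_apply hf (measurable_snd ht)]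
  exact h s t hs ht

end

section
variable {ι : Type*} [Fintype ι] [DecidableEq ι] {C : Matrix ι ι ℝ}

lemma map_neg_multivariateGaussian (hC : C.PosSemidef) :
    (multivariateGaussian 0 C).map (fun v => -v) = multivariateGaussian 0 C := by
  have hp : IsProbabilityMeasure ((multivariateGaussian 0 C).map fun v => -v) :=
    Measure.isProbabilityMeasure_map (by fun_prop)
  refine Measure.ext_of_charFun ?_
  ext t
  have h1 : charFun ((multivariateGaussian 0 C).map fun v => -v) t =
      charFun (multivariateGaussian 0 C) (-t) := by
    rw [charFun_apply, charFun_apply, integral_map (by fun_prop) (by fun_prop)]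
    simp only [inner_neg_left, inner_neg_right]
  rw [h1, charFun_multivariateGaussian hC, charFun_multivariateGaussian hC]
  simp [mulVec_neg]

lemma integral_eval_multivariateGaussian (hC : C.PosSemidef) (i : ι) :
    ∫ v, v i ∂(multivariateGaussian 0 C) = 0 := by
  have hmp := measurePreserving_eval_multivariateGaussian (μ := 0) hC (i := i)
  have h2 := integral_map (μ := multivariateGaussian 0 C) (φ := fun v => v i) (f := fun y : ℝ => y)
    hmp.measurable.aemeasurable (by fun_prop)
  rw [← h2, hmp.map_eq, integral_id_gaussianReal]
  rfl

lemma covariance_sum_multivariateGaussian (hC : C.PosSemidef) (b b' : ι → ℝ) :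
    cov[fun v => ∑ x, b x * v x, fun v => ∑ x, b' x * v x; multivariateGaussian 0 C] =
      b ⬝ᵥ C *ᵥ b' := by
  have e : ∀ b : ι → ℝ, (fun v : EuclideanSpace ℝ ι => ∑ x, b x * v x) =
      fun v => inner ℝ (WithLp.toLp 2 b) v := fun b => by
    ext v
    simp [PiLp.inner_apply, mul_comm]
  rw [e, e, ← covarianceBilin_apply_eq_cov IsGaussian.memLp_two_id,
    covarianceBilin_multivariateGaussian hC]

end

section
variable {n d : ℕ} {C : Matrix (Idx n d) (Idx n d) ℝ}

/-- The continuous linear map that assembles a pair of matrices from its entries. -/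
def pairMap (n d : ℕ) : EuclideanSpace ℝ (Idx n d) →L[ℝ]
    Matrix (Fin n) (Col n d) ℝ × Matrix (Col n d) (Col n d) ℝ where
  toFun v := pairOf v.ofLp
  map_add' _ _ := rfl
  map_smul' _ _ := rfl
  cont := by
    refine Continuous.prodMk ?_ ?_
    · refine continuous_pi fun i => continuous_pi fun j => ?_
      change Continuous fun v : EuclideanSpace ℝ (Idx n d) => v (Sum.inl (i, j))
      fun_prop
    · refine continuous_pi fun i => continuous_pi fun j => ?_
      change Continuous fun v : EuclideanSpace ℝ (Idx n d) => v (Sum.inr (i, j))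
      fun_prop

/-- The centred Gaussian law of a pair of matrices with covariance matrix `C` of the entries. -/
noncomputable def pairLaw (C : Matrix (Idx n d) (Idx n d) ℝ) :
    Measure (Matrix (Fin n) (Col n d) ℝ × Matrix (Col n d) (Col n d) ℝ) :=
  (multivariateGaussian 0 C).map (pairMap n d)

lemma measurable_pairMap : Measurable (pairMap n d) := (pairMap n d).continuous.measurable

instance isGaussian_pairLaw : IsGaussian (pairLaw C) :=
  isGaussian_map_of_measurable measurable_pairMap

lemma integral_pairLaw_fst (hC : C.PosSemidef) (i : Fin n) (j : Col n d) :
    ∫ g, g.1 i j ∂(pairLaw C) = 0 := by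
  have hm : Measurable fun g : Matrix (Fin n) (Col n d) ℝ × Matrix (Col n d) (Col n d) ℝ =>
      g.1 i j := (measurable_pi_apply j).comp ((measurable_pi_apply i).comp measurable_fst)
  rw [pairLaw, integral_map measurable_pairMap.aemeasurable hm.aestronglyMeasurable]
  exact integral_eval_multivariateGaussian hC (Sum.inl (i, j))

lemma integral_pairLaw_snd (hC : C.PosSemidef) (i j : Col n d) :
    ∫ g, g.2 i j ∂(pairLaw C) = 0 := by
  have hm : Measurable fun g : Matrix (Fin n) (Col n d) ℝ × Matrix (Col n d) (Col n d) ℝ =>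
      g.2 i j := (measurable_pi_apply j).comp ((measurable_pi_apply i).comp measurable_snd)
  rw [pairLaw, integral_map measurable_pairMap.aemeasurable hm.aestronglyMeasurable]
  exact integral_eval_multivariateGaussian hC (Sum.inr (i, j))

/-- Uncorrelated components of the Gaussian pair are independent. -/
lemma indepFun_pairLaw (hC : C.PosSemidef) (h0 : ∀ x y, C (Sum.inl x) (Sum.inr y) = 0) :
    IndepFun Prod.fst Prod.snd (pairLaw C) := by
  refine indepFun_fst_snd_map measurable_pairMap ?_
  have hG : HasGaussianLaw (fun v : EuclideanSpace ℝ (Idx n d) =>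
      ((fun x => v (Sum.inl x) : Fin n × Col n d → ℝ),
        (fun x => v (Sum.inr x) : Col n d × Col n d → ℝ))) (multivariateGaussian 0 C) := by
    let L : EuclideanSpace ℝ (Idx n d) →L[ℝ]
        (Fin n × Col n d → ℝ) × (Col n d × Col n d → ℝ) :=
      { toFun := fun v => (fun x => v (Sum.inl x), fun x => v (Sum.inr x))
        map_add' := fun _ _ => rfl
        map_smul' := fun _ _ => rfl
        cont := by fun_prop }
    exact ⟨isGaussian_map_of_measurable (L := L) L.continuous.measurable⟩
  have h1 := hG.indepFun_of_covariance_eval fun x y => by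
    rw [covariance_eval_multivariateGaussian hC, h0]
  refine h1.comp (φ := fun f i j => f (i, j)) (ψ := fun f i j => f (i, j)) ?_ ?_
  · exact measurable_pi_lambda _ fun i => measurable_pi_lambda _ fun j => measurable_pi_apply _
  · exact measurable_pi_lambda _ fun i => measurable_pi_lambda _ fun j => measurable_pi_apply _

lemma linear_eq_sum (f : (Idx n d → ℝ) →ₗ[ℝ] ℝ) (v : Idx n d → ℝ) :
    f v = ∑ x, f (Pi.single x 1) * v x := by
  rw [LinearMap.pi_apply_eq_sum_univ f v]
  refine Finset.sum_congr rfl fun x _ => ?_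
  rw [smul_eq_mul, mul_comm]
  congr 2
  ext y
  simp [Pi.single_apply, eq_comm]

/-- The covariance matrix of linear functions of the Gaussian pair. -/
lemma covMat_pairLaw (hC : C.PosSemidef) (f : (Idx n d → ℝ) →ₗ[ℝ] Fin n → ℝ)
    {F : Matrix (Fin n) (Col n d) ℝ × Matrix (Col n d) (Col n d) ℝ → Fin n → ℝ}
    (hF : Measurable F) (hf : ∀ v, F (pairOf v) = f v) :
    covMat (pairLaw C) F =
      Matrix.of (fun a x => f (Pi.single x 1) a) * C *
        (Matrix.of fun a x => f (Pi.single x 1) a)ᵀ := by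
  ext a b
  have hFa : ∀ a, AEStronglyMeasurable (fun g => F g a) (pairLaw C) := fun a =>
    ((measurable_pi_apply a).comp hF).aestronglyMeasurable
  have e : ∀ a, ((fun g => F g a) ∘ pairMap n d) =
      fun v : EuclideanSpace ℝ (Idx n d) => ∑ x, f (Pi.single x 1) a * v x := fun a => by
    ext v
    have h1 : (LinearMap.proj a ∘ₗ f) v.ofLp = f v.ofLp a := rfl
    change F (pairOf v.ofLp) a = _
    rw [hf, ← h1, linear_eq_sum]
    rfl
  rw [covMat, Matrix.of_apply, pairLaw,
    covariance_map (hFa a) (hFa b) measurable_pairMap.aemeasurable, e, e,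
    covariance_sum_multivariateGaussian hC, Matrix.mul_assoc, Matrix.mul_apply]
  refine Finset.sum_congr rfl fun x _ => ?_
  rw [Matrix.mul_apply]
  rfl

end

section
variable {n d : ℕ}

lemma measurable_finitePart : @Measurable _ _ (borel _) _
    (finitePart : OnePoint (Matrix (Fin n) (Fin d) ℝ) → Matrix (Fin n) (Fin d) ℝ) := by
  let _ : MeasurableSpace (OnePoint (Matrix (Fin n) (Fin d) ℝ)) := borel _
  have _ : BorelSpace (OnePoint (Matrix (Fin n) (Fin d) ℝ)) := ⟨rfl⟩
  have hemb : MeasurableEmbedding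
      ((↑) : Matrix (Fin n) (Fin d) ℝ → OnePoint (Matrix (Fin n) (Fin d) ℝ)) :=
    OnePoint.isOpenEmbedding_coe.measurableEmbedding
  intro A hA
  have e : finitePart ⁻¹' A = ((↑) : Matrix (Fin n) (Fin d) ℝ → OnePoint _) '' A ∪
      {x | x = OnePoint.infty ∧ (0 : Matrix (Fin n) (Fin d) ℝ) ∈ A} := by
    ext x
    induction x with
    | infty => simp [finitePart]
    | coe X => simp [finitePart]
  rw [e]
  refine (hemb.measurableSet_image.2 hA).union ?_
  by_cases h0 : (0 : Matrix (Fin n) (Fin d) ℝ) ∈ A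
  · simp only [h0, and_true]
    exact (OnePoint.isClosed_infty).measurableSet
  · simp [h0]

end

/-! ### Nonsingularity of the limiting covariance -/

section
variable {n d : ℕ} {V : Matrix (Fin n) (Fin n) ℝ} {σ : ℝ}
  {μ : Col n d → Col n d → Col n d → Col n d → ℝ} {J : Finset (Col n d)} {A : Matrix J J ℝ}
  {X : Matrix (Fin n) (Fin d) ℝ}

lemma quad_limitCov (S : Matrix (Col n d) (Col n d) ℝ) (b : Fin n × Col n d → ℝ)
    (b' : Col n d × Col n d → ℝ) :
    (Sum.elim b b') ⬝ᵥ limitCov V S σ μ *ᵥ (Sum.elim b b') =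
      b ⬝ᵥ (Matrix.of fun x y : Fin n × Col n d => V x.1 y.1 * (σ ^ 2 * S x.2 y.2)) *ᵥ b +
        (Sum.elim 0 b') ⬝ᵥ limitCov V S σ μ *ᵥ (Sum.elim 0 b') := by
  rw [limitCov, fromBlocks_mulVec, fromBlocks_mulVec]
  simp [sumElim_dotProduct_sumElim]

lemma quad_product (S : Matrix (Col n d) (Col n d) ℝ) (y : Fin n → ℝ) (z : Col n d → ℝ) :
    (fun x : Fin n × Col n d => y x.1 * z x.2) ⬝ᵥ
      (Matrix.of fun x y : Fin n × Col n d => V x.1 y.1 * (σ ^ 2 * S x.2 y.2)) *ᵥ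
        (fun x => y x.1 * z x.2) = (y ⬝ᵥ V *ᵥ y) * (σ ^ 2 * (z ⬝ᵥ S *ᵥ z)) := by
  have h1 : (Matrix.of fun x y : Fin n × Col n d => V x.1 y.1 * (σ ^ 2 * S x.2 y.2)) *ᵥ
      (fun x => y x.1 * z x.2) = fun x => (V *ᵥ y) x.1 * (σ ^ 2 * (S *ᵥ z) x.2) := by
    ext x
    simp only [mulVec, dotProduct, Matrix.of_apply]
    rw [Fintype.sum_prod_type, Finset.mul_sum, Finset.sum_mul_sum]
    exact Finset.sum_congr rfl fun _ _ => Finset.sum_congr rfl fun _ _ => by ring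
  rw [h1]
  simp only [dotProduct]
  rw [Fintype.sum_prod_type, Finset.mul_sum, Finset.sum_mul_sum]
  exact Finset.sum_congr rfl fun _ _ => Finset.sum_congr rfl fun _ _ => by ring

/-- The limit law has nonsingular covariance in every direction: the part contributed by `Γ₁` is
`σ² (uᵀ Z₀ᵀ S_∞ Z₀ u) V⁻¹`, and the independent remainder can only add to it. -/
theorem isUnit_covMat_limit (hV : V.PosDef) (hA : A.PosDef) (hX : Regular J X) (hσ : 0 < σ)
    (hC : (limitCov V (extend J A) σ μ).PosSemidef) {u : Fin d → ℝ} (hu : u ≠ 0) :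
    IsUnit (covMat (pairLaw (limitCov V (extend J A) σ μ))
      fun g => (V⁻¹ * Gam (extend J A) g X) *ᵥ u) := by
  let f : (Idx n d → ℝ) →ₗ[ℝ] Fin n → ℝ :=
    { toFun := fun v => (V⁻¹ * Gam (extend J A) (pairOf v) X) *ᵥ u
      map_add' := fun v w => by rw [pairOf_add, Gam_add, Matrix.mul_add, add_mulVec]
      map_smul' := fun r v => by
        rw [pairOf_smul, Gam_smul, Matrix.mul_smul, smul_mulVec, RingHom.id_apply] }
  have hFm : Measurable fun g : Matrix (Fin n) (Col n d) ℝ × Matrix (Col n d) (Col n d) ℝ =>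
      (V⁻¹ * Gam (extend J A) g X) *ᵥ u := by
    refine Continuous.measurable ?_
    unfold Gam
    fun_prop
  rw [covMat_pairLaw hC f hFm fun _ => rfl]
  set C := limitCov V (extend J A) σ μ with hCdef
  set B : Matrix (Fin n) (Idx n d) ℝ := Matrix.of fun a x => f (Pi.single x 1) a with hB
  refine PosDef.isUnit (PosDef.of_dotProduct_mulVec_pos ?_ fun w hw => ?_)
  · rw [IsHermitian, conjTranspose_eq_transpose_of_trivial, transpose_mul, transpose_mul,
      transpose_transpose, hC.transpose_eq, Matrix.mul_assoc]
  have hq := dotProduct_transpose_mul_mul_mulVec Bᵀ C w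
  rw [transpose_transpose] at hq
  change 0 < w ⬝ᵥ (B * C * Bᵀ) *ᵥ w
  rw [hq]
  set y : Fin n → ℝ := w ᵥ* V⁻¹ with hy
  set z : Col n d → ℝ := Z X *ᵥ u with hz
  have hβ : Bᵀ *ᵥ w = Sum.elim (fun x : Fin n × Col n d => y x.1 * z x.2)
      (fun x => (Bᵀ *ᵥ w) (Sum.inr x)) := by
    ext x
    rcases x with x | x
    · have e1 : (Bᵀ *ᵥ w) (Sum.inl x) = w ⬝ᵥ f (Pi.single (Sum.inl x) 1) := by
        rw [dotProduct_comm]; rfl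
      have e2 : pairOf (Pi.single (Sum.inl x) 1 : Idx n d → ℝ) = (Matrix.single x.1 x.2 1, 0) := by
        refine Prod.ext ?_ ?_
        · ext i j
          simp [pairOf, Pi.single_apply, Matrix.single_apply, Prod.ext_iff, eq_comm]
        · ext i j
          simp [pairOf]
      have e3 : f (Pi.single (Sum.inl x) 1) = V⁻¹ *ᵥ Pi.single x.1 (z x.2) := by
        change (V⁻¹ * Gam (extend J A) (pairOf _) X) *ᵥ u = _
        rw [e2, Gam]
        simp only [Matrix.mul_zero, Matrix.zero_mul, add_zero, sub_zero]
        rw [← mulVec_mulVec, ← mulVec_mulVec, single_mulVec, one_mul]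
        rfl
      rw [e1, e3, dotProduct_mulVec, dotProduct_single, Sum.elim_inl]
    · rfl
  rw [hβ, hCdef, quad_limitCov, quad_product]
  have hy0 : y ≠ 0 := fun h0 => hw (by
    have : y ᵥ* V = w := by
      rw [hy, vecMul_vecMul, nonsing_inv_mul _ hV.det_pos.ne'.isUnit, vecMul_one]
    rw [← this, h0, zero_vecMul])
  have hzJ : (fun j : J => z j) ≠ 0 := fun h0 => hu (hX (by
    rw [mulVec_zero, ← h0]; rfl))
  have h1 := hV.quad_pos hy0
  have h2 := hA.quad_pos hzJ
  rw [quad_extend]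
  exact add_pos_of_pos_of_nonneg (by positivity) (hC.quad_nonneg _)

end

/-! ### Asymptotic normality of the estimator -/

section
variable {n d : ℕ} {Ω : Type*}

lemma data_eq (X₀ : Matrix (Fin n) (Fin d) ℝ) (a₀ : ℕ → Fin n → ℝ) (err : ℕ → Ω → Col n d → ℝ)
    (m : ℕ) (ω : Ω) :
    data X₀ a₀ err m ω = Matrix.of fun i : Fin m => (truth X₀)ᵀ *ᵥ a₀ i + err i ω := by
  ext i j
  rw [data, Matrix.add_apply, Matrix.of_apply, Matrix.of_apply, Pi.add_apply]
  congr 1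
  rw [mulVec_transpose, truth, vecMul_fromCols]
  rcases j with j | j
  · simp [trueInput]
  · simp [trueInput, Matrix.mul_apply, vecMul, dotProduct]

lemma measurable_data [MeasurableSpace Ω] (X₀ : Matrix (Fin n) (Fin d) ℝ) (a₀ : ℕ → Fin n → ℝ)
    {err : ℕ → Ω → Col n d → ℝ} (h : ∀ i, Measurable (err i)) (m : ℕ) :
    Measurable (data X₀ a₀ err m) :=
  measurable_pi_lambda _ fun i => measurable_pi_lambda _ fun j =>
    ((measurable_pi_apply j).comp (h i)).const_add _

end
end EWTLS

theorem theorem7 {n d : ℕ} {Ω : Type*} [MeasurableSpace Ω] (P : Measure Ω) [IsProbabilityMeasure P]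
    (X₀ : Matrix (Fin n) (Fin d) ℝ) (a₀ : ℕ → Fin n → ℝ)
    (err : ℕ → Ω → EWTLS.Col n d → ℝ) (J : Finset (EWTLS.Col n d))
    (σ : ℝ) (Sig : ℕ → Matrix J J ℝ) (SigInf : Matrix J J ℝ) (κ r δ : ℝ)
    (V : Matrix (Fin n) (Fin n) ℝ) (μ₄ : J → J → J → J → ℝ)
    (T : (m : ℕ) → Matrix (Fin m) (EWTLS.Col n d) ℝ → OnePoint (Matrix (Fin n) (Fin d) ℝ))
    -- errors: independent rows, zero mean, finite second moments
    (h_meas : ∀ i, Measurable (err i))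
    (h_indep : iIndepFun err P)
    (h_sq : ∀ i j, MemLp (fun ω => err i ω j) 2 P)
    (h_mean : ∀ i j, ∫ ω, err i ω j ∂P = 0)
    -- error-free columns outside `J`; covariance known up to the factor `σ²`
    (h_free : ∀ i, ∀ j ∉ J, ∫ ω, err i ω j ^ 2 ∂P = 0)
    (h_sigma : 0 < σ)
    (h_cov : ∀ i, EWTLS.covMat P (fun ω (j : J) => err i ω j) = σ ^ 2 • Sig i)
    -- `λ_min(Σᵢ) ≥ κ²`
    (h_kappa : 0 < κ)
    (h_eig : ∀ i, ∀ l ∈ spectrum ℝ (Sig i), κ ^ 2 ≤ l)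
    -- `rank Z₀_J = d`
    (h_rank : (EWTLS.rowsIn J (EWTLS.Z X₀)).rank = d)
    -- moments of order `2r`
    (h_r : 2 ≤ r)
    (h_r_dim : (d : ℝ) * ((J.card : ℝ) - ((d : ℝ) + 1) / 2) < r)
    (h_mom_r : (⨆ (i : ℕ) (j : J), ∫⁻ ω, ‖err i ω j‖ₑ ^ (2 * r) ∂P) < ⊤)
    -- moments of order `4 + 2δ`
    (h_delta : 0 < δ)
    (h_mom_delta : (⨆ (i : ℕ) (j : J), ∫⁻ ω, ‖err i ω j‖ₑ ^ (4 + 2 * δ) ∂P) < ⊤)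
    -- Lyapunov-type condition on the true inputs
    (h_lyap : Tendsto (fun m : ℕ => 1 / (m : ℝ) ^ (1 + δ / 2) *
      ∑ i ∈ Finset.range m, ‖WithLp.toLp 2 (a₀ i)‖ ^ (2 + δ)) atTop (𝓝 0))
    -- `m⁻¹ A₀ᵀ A₀ → V`, nonsingular
    (h_V : Tendsto (fun m : ℕ =>
      (1 / (m : ℝ)) • ((EWTLS.trueInput a₀ m)ᵀ * EWTLS.trueInput a₀ m)) atTop (𝓝 V))
    (h_V_unit : IsUnit V)
    -- `Σᵢ → Σ_∞`
    (h_SigInf : Tendsto Sig atTop (𝓝 SigInf))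
    -- vanishing third moments
    (h_third : ∀ i, ∀ p q s : J, ∫ ω, err i ω p * err i ω q * err i ω s ∂P = 0)
    -- averaged fourth moments converge
    (h_fourth : ∀ p q s u : J, Tendsto (fun m : ℕ => 1 / (m : ℝ) * ∑ i ∈ Finset.range m,
      ∫ ω, err i ω p * err i ω q * err i ω s * err i ω u ∂P) atTop (𝓝 (μ₄ p q s u)))
    -- the estimator
    (h_T : ∀ m, EWTLS.IsEstimator Sig (T m)) :
    ∃ SInf : Matrix (EWTLS.Col n d) (EWTLS.Col n d) ℝ,
      -- `S_∞ = lim Sᵢ`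
      Tendsto (EWTLS.S P err σ) atTop (𝓝 SInf) ∧
      ∃ γ : Measure (Matrix (Fin n) (EWTLS.Col n d) ℝ ×
          Matrix (EWTLS.Col n d) (EWTLS.Col n d) ℝ),
        -- `γ` is the law of `(Γ₁, Γ₂)`, the centered Gaussian limit with independent components
        ∃ _ : IsGaussian γ,
          (∀ i j, ∫ g, g.1 i j ∂γ = 0) ∧ (∀ i j, ∫ g, g.2 i j ∂γ = 0) ∧
          IndepFun Prod.fst Prod.snd γ ∧
          TendstoInDistribution
            (fun (m : ℕ) ω => (1 / √(m : ℝ)) • ∑ i ∈ Finset.range m, EWTLS.W P a₀ err σ i ω)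
            atTop id (fun _ => P) γ ∧
          -- the estimator is finite with probability tending to one and asymptotically normal
          Tendsto (fun m => P {ω | T m (EWTLS.data X₀ a₀ err m ω) = OnePoint.infty}) atTop (𝓝 0) ∧
          TendstoInDistribution
            (fun (m : ℕ) ω =>
              √(m : ℝ) • (EWTLS.finitePart (T m (EWTLS.data X₀ a₀ err m ω)) - X₀))
            atTop (fun g => V⁻¹ * EWTLS.Gam SInf g X₀) (fun _ => P) γ ∧
          -- the limit has a nonsingular covariance structure
          ∀ u : Fin d → ℝ, u ≠ 0 →
            IsUnit (EWTLS.covMat γ fun g => (V⁻¹ * EWTLS.Gam SInf g X₀) *ᵥ u) := by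
  have hSigT : ∀ i, (Sig i)ᵀ = Sig i := fun i => by
    have h1 := EWTLS.covMat_transpose (P := P) fun ω (j : J) => err i ω j
    rw [h_cov, transpose_smul] at h1
    exact smul_right_injective _ (by positivity : σ ^ 2 ≠ 0) h1
  have hκ : (0 : ℝ) < κ ^ 2 := by positivity
  have hSub := fun i => EWTLS.posSemidef_sub_smul_one_of_spectrum (hSigT i) (h_eig i)
  have hSig : ∀ i, (Sig i).PosDef := fun i => EWTLS.posDef_of_sub_smul_one hκ (hSub i)
  have hSigInf : SigInf.PosDef := EWTLS.posDef_of_sub_smul_one hκ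
    (EWTLS.posSemidef_of_tendsto hSub (h_SigInf.sub_const _))
  have hV : V.PosDef := EWTLS.posDef_of_tendsto_gram h_V h_V_unit
  have hreg : EWTLS.Regular J X₀ := (EWTLS.regular_iff_rank J X₀).1 h_rank
  have hgram : ∀ k l, Tendsto (fun m : ℕ => 1 / (m : ℝ) *
      ∑ i ∈ Finset.range m, a₀ i k * a₀ i l) atTop (𝓝 (V k l)) := fun k l => by
    simpa only [EWTLS.trueInput_gram_apply] using
      tendsto_pi_nhds.1 (tendsto_pi_nhds.1 h_V k) l
  have hzero : ∀ i, ∀ j ∉ J, ∀ᵐ ω ∂P, err i ω j = 0 := fun i j hj =>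
    EWTLS.ae_eq_zero_of_integral_sq h_sq (h_free i j hj)
  obtain ⟨B, μ, hE⟩ := EWTLS.exists_errorModel h_sq h_mean hzero h_cov h_meas h_indep h_delta
    h_mom_delta h_SigInf h_third h_fourth
  have hS := EWTLS.S_eq_extend h_sq hzero h_sigma h_cov
  set S : ℕ → Matrix (EWTLS.Col n d) (EWTLS.Col n d) ℝ := fun i => EWTLS.extend J (Sig i)
    with hS_def
  set SInf := EWTLS.extend J SigInf with hSInf
  refine ⟨SInf, hS ▸ hE.S_tendsto, ?_⟩
  -- the central limit theorem for the entries
  obtain ⟨hC, hclt⟩ := EWTLS.tendstoInDistribution_of_lyapunov (hE.measurable_row a₀)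
    (hE.indep_row a₀) (hE.integral_row a₀) h_delta (hE.integrable_row_rpow a₀)
    (hE.lyapunov_row h_lyap) (hE.tendsto_cov_row hgram)
  set C := EWTLS.limitCov V SInf σ μ with hC_def
  have hpm := EWTLS.measurable_pairMap (n := n) (d := d)
  have hlimT := hE.rowLLN hgram hSig hSigInf h_SigInf hV hreg h_sigma
  -- the estimator minimises the reduced objective with probability tending to one
  have hmin : ∀ᶠ z in EWTLS.inProb P, ∃ X : Matrix (Fin n) (Fin d) ℝ,
      T z.1 (EWTLS.data X₀ a₀ err z.1 z.2) = ↑X ∧ EWTLS.Regular J X ∧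
      ∀ X', EWTLS.Regular J X' →
        EWTLS.objective S (fun i => (EWTLS.truth X₀)ᵀ *ᵥ a₀ i + err i z.2) z.1 X ≤
        EWTLS.objective S (fun i => (EWTLS.truth X₀)ᵀ *ᵥ a₀ i + err i z.2) z.1 X' := by
    refine hlimT.eventually_exists_minimiser.mono fun z hz => ?_
    obtain ⟨X, hX⟩ := hz
    have h1 : EWTLS.Solves Sig (EWTLS.data X₀ a₀ err z.1 z.2) X := by
      rw [EWTLS.data_eq]
      exact (EWTLS.solves_iff hSig (fun i => (EWTLS.truth X₀)ᵀ *ᵥ a₀ i + err i z.2) X).2 hX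
    obtain ⟨X', hT, hX'⟩ := (h_T z.1).solves _ ⟨X, h1⟩
    rw [EWTLS.data_eq] at hX'
    exact ⟨X', hT,
      (EWTLS.solves_iff hSig (fun i => (EWTLS.truth X₀)ᵀ *ᵥ a₀ i + err i z.2) X').1 hX'⟩
  refine ⟨EWTLS.pairLaw C, inferInstance, EWTLS.integral_pairLaw_fst hC,
    EWTLS.integral_pairLaw_snd hC, EWTLS.indepFun_pairLaw hC fun x y => rfl, ?_, ?_, ?_,
    fun u hu => EWTLS.isUnit_covMat_limit hV hSigInf hreg h_sigma hC hu⟩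
  · have h1 := hclt.continuous_comp (EWTLS.pairMap n d).continuous
    have h2 := EWTLS.tendstoInDistribution_of_map_eq h1 (μ'' := EWTLS.pairLaw C) aemeasurable_id
      (by rw [Measure.map_id]; rfl)
    convert h2 using 2 with m
    ext ω : 1
    have e : ∀ i, EWTLS.W P a₀ err σ i ω =
        EWTLS.pairOf (EWTLS.pairVec (a₀ i) (err i ω) (σ ^ 2 • S i)) := fun i => by
      rw [EWTLS.pairOf_pairVec, EWTLS.W, hS]
    simp only [e]
    have hsum : ∀ (s : Finset ℕ) (f : ℕ → EWTLS.Idx n d → ℝ),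
        ∑ i ∈ s, EWTLS.pairOf (f i) = EWTLS.pairOf (∑ i ∈ s, f i) := fun s f => by
      induction s using Finset.cons_induction with
      | empty => rfl
      | cons i s hi ih => rw [Finset.sum_cons, Finset.sum_cons, EWTLS.pairOf_add, ih]
    rw [hsum, ← EWTLS.pairOf_smul, Function.comp_apply]
    change _ = EWTLS.pairOf _
    congr 1
    ext p
    simp only [Pi.smul_apply, Finset.sum_apply, smul_eq_mul]
  · have h1 := EWTLS.eventually_inProb.1 hmin
    refine tendsto_of_tendsto_of_tendsto_of_le_of_le tendsto_const_nhds h1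
      (fun _ => zero_le) fun m => measure_mono fun ω hω => ?_
    rintro ⟨X, hX, -⟩
    exact OnePoint.coe_ne_infty X (hX.symm.trans hω)
  · set Xh : ℕ × Ω → Matrix (Fin n) (Fin d) ℝ := fun z =>
      EWTLS.finitePart (T z.1 (EWTLS.data X₀ a₀ err z.1 z.2)) with hXh
    have hlin := hE.tendsto_linearization hgram hSig hSigInf h_SigInf hV hreg h_sigma (Xh := Xh)
      (hmin.mono fun z hz => by
        obtain ⟨X, hT, hX⟩ := hz
        have e : Xh z = X := by rw [hXh]; simp only [hT]; rfl
        rw [e]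
        exact hX)
    set L := EWTLS.limitMap V SInf X₀ with hL
    have hLc : Continuous L := L.continuous_of_finiteDimensional
    have hnegc : Continuous fun v : EuclideanSpace ℝ (EWTLS.Idx n d) => -L v.ofLp := by
      fun_prop
    have h1 := hclt.continuous_comp hnegc
    have hm : ∀ m : ℕ, Measurable fun ω => fun a b =>
        √(m : ℝ) * (Xh (m, ω) a b - X₀ a b) := fun m => by
      have hmX : Measurable fun ω => Xh (m, ω) :=
        EWTLS.measurable_finitePart.comp
          ((h_T m).borel_measurable.comp (EWTLS.measurable_data X₀ a₀ h_meas m))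
      exact measurable_pi_lambda _ fun a => measurable_pi_lambda _ fun b =>
        (((measurable_pi_apply b).comp ((measurable_pi_apply a).comp hmX)).sub_const _).const_mul _
    have h2 := tendstoInDistribution_of_tendstoInMeasure_sub
      (fun (m : ℕ) ω a b => √(m : ℝ) * (Xh (m, ω) a b - X₀ a b)) _ h1
      (EWTLS.tendstoInMeasure_zero_iff_inProb.2 (hlin.congr fun z => by
        ext a b
        simp only [Pi.sub_apply, Function.comp_apply, Pi.neg_apply, Pi.add_apply, sub_neg_eq_add]
        rfl)) fun m => (hm m).aemeasurable
    have hof : Continuous fun f : Fin n → Fin d → ℝ => (Matrix.of f : Matrix (Fin n) (Fin d) ℝ) :=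
      continuous_id
    have h3 := h2.continuous_comp hof
    have hGm : Measurable fun g : Matrix (Fin n) (EWTLS.Col n d) ℝ ×
        Matrix (EWTLS.Col n d) (EWTLS.Col n d) ℝ => V⁻¹ * EWTLS.Gam SInf g X₀ := by
      refine Continuous.measurable ?_
      unfold EWTLS.Gam
      fun_prop
    refine EWTLS.tendstoInDistribution_of_map_eq h3 hGm.aemeasurable ?_
    have hLm : Measurable ((fun g => V⁻¹ * EWTLS.Gam SInf g X₀) ∘ ⇑(EWTLS.pairMap n d)) :=
      hGm.comp hpm
    rw [EWTLS.pairLaw, Measure.map_map hGm hpm]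
    -- the Gaussian law is symmetric
    conv_rhs =>
      rw [← EWTLS.map_neg_multivariateGaussian hC, Measure.map_map hLm
        (by fun_prop : Measurable fun v : EuclideanSpace ℝ (EWTLS.Idx n d) => -v)]
    congr 1
    ext v a b
    change (-L v.ofLp) a b = L (-v.ofLp) a b
    rw [map_neg]
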